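/- Let $M$ be a loopless matroid of rank $r+1$ on the ground set $E=\{0,\ldots,n\}$, with rank function $\operatorname{rk}$ and Tutte polynomial $$T_M(x,y)=\sum_{S\subseteq E}(x-1)^{r+1-\operatorname{rk}(S)}(y-1)^{|S|-\operatorname{rk}(S)}.$$ Let $A^\bullet(M)=\mathbb{Z}[x_F : F \text{ a nonempty proper flat of } M]/(I_M+J_M)$ be its combinatorial Chow ring, where $I_M$ is generated by the products $x_Fx_G$ with $F,G$ incomparable, and $J_M$ by the elements $\sum_{F\ni i}x_F-\sum_{F\ni j}x_F$ with $i,j\in E$. Let $\deg_{A^\bullet(M)}:A^r(M)\to\mathbb{Z}$ be its degree map, that is, the unique homomorphism with $x_{F_1}\cdots x_{F_r}\mapsto 1$ for every chain $F_1\subsetneq\cdots\subsetneq F_r$ of nonempty proper flats (extended by $0$ to the other graded pieces); this map exists and is unique. Let $U=U_{n+1,n+1}$ be the uniform matroid of rank $n+1$ on $E$, all of whose subsets are flats, so that $A^\bullet(U)$ is the Chow ring of the permutohedral toric variety. Let $A^\bullet(U)\to A^\bullet(M)$ be the restriction homomorphism, which sends $x_F$ to $x_F$ if $F$ is a flat of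 $M$ and to $0$ otherwise; $\deg_{A^\bullet(M)}$ of an element of $A^\bullet(U)$ means the degree of its image in $A^\bullet(M)$. For $0\le k\le n-r$, let $\Phi_{r,k}\in A^r(U)$ be the one-window symmetrized Minkowski weight $\delta'_{[k+1,k+r]}$, that is, a class such that, for every chain $\emptyset\neq G_1\subsetneq\cdots\subsetneq G_{n-r}\subsetneq E$, $$\deg_{A^\bullet(U)}(\Phi_{r,k}\,x_{G_1}\cdots x_{G_{n-r}})=\begin{cases}1 & \text{if } \{|G_1|,\ldots,|G_{n-r}|\}=\{1,\ldots,n\}\setminus\{k+1,\ldots,k+r\},\\ 0&\text{otherwise.}\end{cases}$$ Such classes exist, and for every choice of them $$T_M(1,y)=\sum_{k=0}^{n-r}\deg_{A^\bullet(M)}(\Phi_{r,k})\,y^k .$$ Moreover, for a chain $\mathcal F=(F_1\subsetneq\cdots\subsetneq F_r)$ of nonempty proper flats of $M$, with $F_0=\emptyset$ and $F_{r+1}=E$, let $g_k(\mathcal F)$ be the number of tuples $(x_1,\ldots,x_{r+1})\in\prod_{i=1}^{r+1}(F_i\setminus F_{i-1})$ with $x_1>\cdots>x_{r+1}$ and $\sum_{i=1}^{r+1}|\{y\in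 F_i\setminus F_{i-1}: y<x_i\}|=k$. Then, for $0\le k\le n-r$, $$\deg_{A^\bullet(M)}(\Phi_{r,k})=\sum_{\mathcal F}g_k(\mathcal F),$$ the sum being over all such chains, and this number equals the number of bases $B$ of $M$ of external activity $k$, i.e. those with exactly $k$ elements $j\in E\setminus B$ such that for no $i<j$ is $(B\setminus\{i\})\cup\{j\}$ a basis of $M$. -/

import Mathlib

noncomputable section

namespace MatroidChow

open Finset Polynomial

open scoped Classical in
/-- The Tutte polynomial of a matroid on a finite type (whose ground set is the whole type), in the
variables `x = X 0`, `y = X 1`: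
`∑_S (x - 1)^(rk M - rk S) (y - 1)^(|S| - rk S)`. -/
def tuttePolynomial {α : Type*} [Fintype α] (M : Matroid α) : MvPolynomial (Fin 2) ℤ :=
  ∑ S : Finset α,
    (MvPolynomial.X 0 - 1) ^ (M.eRank.toNat - (M.eRk (S : Set α)).toNat) *
      (MvPolynomial.X 1 - 1) ^ (S.card - (M.eRk (S : Set α)).toNat)

/-- The specialization `T_M(1, y)`, a polynomial in the single variable `y = X`. -/
def tutteOne {α : Type*} [Fintype α] (M : Matroid α) : ℤ[X] :=
  MvPolynomial.aeval ![1, X] (tuttePolynomial M)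

/-- Nonempty proper flats. -/
abbrev ProperFlat {n : ℕ} (M : Matroid (Fin (n + 1))) : Type :=
  {F : Finset (Fin (n + 1)) // M.IsFlat (F : Set (Fin (n + 1))) ∧ F.Nonempty ∧ F ≠ univ}

instance {n : ℕ} (M : Matroid (Fin (n + 1))) : Fintype (ProperFlat M) := Fintype.ofFinite _

/-- Chains `F_1 ⊊ ... ⊊ F_c` of nonempty proper flats. The term `F_i` is `F.1 (i - 1)`. -/
abbrev FlatChain {n : ℕ} (M : Matroid (Fin (n + 1))) (c : ℕ) : Type :=
  {F : Fin c → ProperFlat M // StrictMono F}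

instance {n : ℕ} (M : Matroid (Fin (n + 1))) (c : ℕ) : Fintype (FlatChain M c) :=
  Fintype.ofFinite _

/-- The generators of the ideal of relations `I_M + J_M` of the Chow ring. -/
def chowRelations {n : ℕ} (M : Matroid (Fin (n + 1))) : Set (MvPolynomial (ProperFlat M) ℤ) :=
  {p | ∃ F G : ProperFlat M, ¬ F ≤ G ∧ ¬ G ≤ F ∧ p = MvPolynomial.X F * MvPolynomial.X G} ∪
  {p | ∃ i j : Fin (n + 1), p =
    (∑ F : ProperFlat M with i ∈ F.1, MvPolynomial.X F) -
      ∑ F : ProperFlat M with j ∈ F.1, MvPolynomial.X F}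

/-- The combinatorial Chow ring `A(M)`. -/
abbrev ChowRing {n : ℕ} (M : Matroid (Fin (n + 1))) : Type :=
  MvPolynomial (ProperFlat M) ℤ ⧸ Ideal.span (chowRelations M)

/-- The class of `x_F` in `A(M)`. -/
def chowX {n : ℕ} (M : Matroid (Fin (n + 1))) (F : ProperFlat M) : ChowRing M :=
  Ideal.Quotient.mk (Ideal.span (chowRelations M)) (MvPolynomial.X F)

/-- The class of the product `x_{F_1} ... x_{F_c}` of a chain. -/
def chainClass {n : ℕ} {M : Matroid (Fin (n + 1))} {c : ℕ} (F : FlatChain M c) : ChowRing M :=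
  ∏ i, chowX M (F.1 i)

/-- The graded piece `A^k(M)`. -/
def chowGraded {n : ℕ} (M : Matroid (Fin (n + 1))) (k : ℕ) : Submodule ℤ (ChowRing M) :=
  (MvPolynomial.homogeneousSubmodule (ProperFlat M) ℤ k).map
    (Ideal.Quotient.mkₐ ℤ (Ideal.span (chowRelations M))).toLinearMap

/-- `d` is the degree map of `A(M)`, for `M` of rank `r + 1`: it sends the class of each chain of
`r` nonempty proper flats to `1`. It lives on `A^r(M)` and is extended by zero to the other
graded pieces. -/
def IsDegreeMap {n : ℕ} (M : Matroid (Fin (n + 1))) (r : ℕ) (d : ChowRing M →ₗ[ℤ] ℤ) : Prop :=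
  (∀ k, k ≠ r → ∀ a ∈ chowGraded M k, d a = 0) ∧ ∀ F : FlatChain M r, d (chainClass F) = 1

open scoped Classical in
/-- The degree map of `A(M)`, for `M` of rank `r + 1`. -/
def chowDeg {n : ℕ} (M : Matroid (Fin (n + 1))) (r : ℕ) : ChowRing M →ₗ[ℤ] ℤ :=
  if h : ∃ d, IsDegreeMap M r d then h.choose else 0

/-- The uniform matroid `U_{n+1,n+1}`, all of whose subsets are flats. Its Chow ring is that of the
permutohedral toric variety. -/
abbrev boolMatroid (n : ℕ) : Matroid (Fin (n + 1)) := Matroid.freeOn Set.univ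

open scoped Classical in
/-- The image of the variable `x_F` of `A(U_{n+1,n+1})` in `A(M)`: it is `x_F` if `F` is a flat of
`M`, and `0` otherwise. -/
def restrictX {n : ℕ} (M : Matroid (Fin (n + 1))) (F : ProperFlat (boolMatroid n)) : ChowRing M :=
  if h : M.IsFlat (F.1 : Set (Fin (n + 1))) then chowX M ⟨F.1, h, F.2.2⟩ else 0

theorem boolMatroid_isFlat {n : ℕ} (F : Set (Fin (n + 1))) : (boolMatroid n).IsFlat F := by
  refine ⟨fun I X hI hX => ?_, by simp⟩
  have h1 := hI.eq_of_subset_indep (J := F) (by simp) hI.subset subset_rfl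
  have h2 := hX.eq_of_subset_indep (J := X) (by simp) hX.subset subset_rfl
  rw [← h2, h1]

theorem sum_restrictX {n : ℕ} (M : Matroid (Fin (n + 1))) (i : Fin (n + 1)) :
    ∑ F : ProperFlat (boolMatroid n) with i ∈ F.1, restrictX M F =
      ∑ F : ProperFlat M with i ∈ F.1, chowX M F := by
  classical
  symm
  refine Finset.sum_of_injOn (fun F => ⟨F.1, boolMatroid_isFlat _, F.2.2⟩) ?_ ?_ ?_ ?_
  · intro F _ G _ h
    exact Subtype.ext (congrArg (fun K : ProperFlat (boolMatroid n) => K.1) h)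
  · intro F hF
    simpa using hF
  · intro F hF hF'
    unfold restrictX
    rw [dif_neg]
    intro h
    apply hF'
    exact ⟨⟨F.1, h, F.2.2⟩, by simpa using hF, rfl⟩
  · intro F _
    unfold restrictX
    rw [dif_pos F.2.1]

theorem restrict_relations {n : ℕ} (M : Matroid (Fin (n + 1)))
    (p : MvPolynomial (ProperFlat (boolMatroid n)) ℤ)
    (hp : p ∈ Ideal.span (chowRelations (boolMatroid n))) :
    MvPolynomial.aeval (restrictX M) p = 0 := by
  suffices h : Ideal.span (chowRelations (boolMatroid n)) ≤
      RingHom.ker (MvPolynomial.aeval (R := ℤ) (restrictX M)) from h hp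
  rw [Ideal.span_le]
  rintro q (⟨F, G, h1, h2, rfl⟩ | ⟨i, j, rfl⟩)
  · change MvPolynomial.aeval (restrictX M) _ = 0
    rw [map_mul, MvPolynomial.aeval_X, MvPolynomial.aeval_X]
    unfold restrictX
    split_ifs with hF hG
    · unfold chowX
      rw [← map_mul, Ideal.Quotient.eq_zero_iff_mem]
      exact Ideal.subset_span (Or.inl ⟨_, _, h1, h2, rfl⟩)
    all_goals simp
  · change MvPolynomial.aeval (restrictX M) _ = 0
    rw [map_sub, map_sum, map_sum]
    simp only [MvPolynomial.aeval_X]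
    rw [sum_restrictX, sum_restrictX]
    unfold chowX
    rw [← map_sum, ← map_sum, ← map_sub, Ideal.Quotient.eq_zero_iff_mem]
    exact Ideal.subset_span (Or.inr ⟨i, j, rfl⟩)

/-- The restriction homomorphism `A(U_{n+1,n+1}) → A(M)`. -/
def chowRestrict {n : ℕ} (M : Matroid (Fin (n + 1))) : ChowRing (boolMatroid n) →+* ChowRing M :=
  Ideal.Quotient.lift _ (MvPolynomial.aeval (R := ℤ) (restrictX M)).toRingHom
    (restrict_relations M)

/-- The symmetrized weight `δ_S` on chains of nonempty proper subsets of `{0, ..., n}`: the value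
is `1` if the cardinalities of the members of the chain are exactly the elements of `S`, and `0`
otherwise. -/
def symWeight {n : ℕ} (S : Finset ℕ) {c : ℕ} (G : FlatChain (boolMatroid n) c) : ℤ :=
  if univ.image (fun i => (G.1 i).1.card) = S then 1 else 0

/-- The weight `δ'_S = δ_{{1, ..., n} \ S}`. -/
def coSymWeight {n : ℕ} (S : Finset ℕ) {c : ℕ} (G : FlatChain (boolMatroid n) c) : ℤ :=
  symWeight (Icc 1 n \ S) G

/-- The one-window weight `δ'_{[k+1, k+r]}`, on chains of length `n - r`. -/
def oneWindowWeight (n r k : ℕ) (G : FlatChain (boolMatroid n) (n - r)) : ℤ :=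
  coSymWeight (Icc (k + 1) (k + r)) G

/-- The class `a ∈ A^r(U_{n+1,n+1})` corresponds to the function `w` on the cones of codimension
`r` of the permutohedral fan, i.e. to the function taking the cone of a chain
`G_1 ⊊ ... ⊊ G_{n-r}` to `deg (a · x_{G_1} ... x_{G_{n-r}})`. -/
def HasWeight {n r : ℕ} (a : ChowRing (boolMatroid n))
    (w : FlatChain (boolMatroid n) (n - r) → ℤ) : Prop :=
  a ∈ chowGraded (boolMatroid n) r ∧
    ∀ G : FlatChain (boolMatroid n) (n - r), chowDeg (boolMatroid n) n (a * chainClass G) = w G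

/-- The term `F_i` of a chain `F_1 ⊊ ... ⊊ F_c`, with `F_0 = ∅` and `F_{c+1} = {0, ..., n}`. -/
def flagTerm {n : ℕ} {M : Matroid (Fin (n + 1))} {c : ℕ} (F : FlatChain M c) (i : ℕ) :
    Finset (Fin (n + 1)) :=
  if i = 0 then ∅ else if h : i - 1 < c then (F.1 ⟨i - 1, h⟩).1 else univ

/-- The block `F_{i+1} \ F_i`, for `0 ≤ i ≤ c`. -/
def flagBlock {n : ℕ} {M : Matroid (Fin (n + 1))} {c : ℕ} (F : FlatChain M c) (i : Fin (c + 1)) :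
    Finset (Fin (n + 1)) :=
  flagTerm F (i + 1) \ flagTerm F i

open scoped Classical in
/-- The sliding count `g_k(F)`: the number of decreasing sequences `x_1 > ... > x_{c+1}` with `x_i`
in `F_i \ F_{i-1}` such that in total `k` elements are smaller than the chosen element of
their block. -/
def slidingCount {n : ℕ} {M : Matroid (Fin (n + 1))} {c : ℕ} (F : FlatChain M c) (k : ℕ) : ℕ :=
  #{x : Fin (c + 1) → Fin (n + 1) | (∀ i, x i ∈ flagBlock F i) ∧
    ∑ i, #{y ∈ flagBlock F i | y < x i} = k ∧ StrictAnti x}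

open scoped Classical in
/-- The elements `j ∉ B` that are externally active for the basis `B`: no `B - i ∪ j` with `i < j`
is a basis. -/
def externallyActive {n : ℕ} (M : Matroid (Fin (n + 1))) (B : Finset (Fin (n + 1))) :
    Finset (Fin (n + 1)) :=
  {j | j ∉ B ∧ ∀ i < j, ¬ M.IsBase (insert j (B.erase i) : Finset (Fin (n + 1)))}

open scoped Classical in
/-- The number of bases of external activity `k`. -/
def activityCount {n : ℕ} (M : Matroid (Fin (n + 1))) (k : ℕ) : ℕ :=
  #{B : Finset (Fin (n + 1)) | M.IsBase (B : Set (Fin (n + 1))) ∧ #(externallyActive M B) = k}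

end MatroidChow

end

/-!
The rank `r` sliding classes are written down explicitly: `slidingClass n r k` is the sum of the
chain monomials `x_{F_1} ⋯ x_{F_r}` of `A(U_{n+1,n+1})`, each with the sliding count `g_k` of the
chain as coefficient. Everything follows once this class is known to be `Φ_{r,k}`, because its
restriction to `A(M)` only keeps the chains of flats of `M`, all of which have degree one.

*Bases.* In a loopless matroid of rank `r + 1`, a decreasing transversal `x` of the blocks of a
chain of `r` nonempty proper flats is a basis listed in decreasing order. Conversely it determines
the chain, since `F_i` is the closure of `x_1, ..., x_i`. An element outside a basis is externally
active if and only if it lies in the closure of the larger elements of the basis, so the sliding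
statistic of `x` is the external activity of the basis (`sum_slidingCount_eq_activityCount`). In
the specialization at `x = 1` of the Tutte polynomial only the spanning sets contribute. They are
partitioned into the intervals from a basis `B` to the union of `B` with its externally active
elements, which gives `∑_B y ^ (external activity of B)` (`tutteOne_eq_sum_activityCount`).

*The degree map.* It is constructed through Minkowski weights, that is, functions on flags that
satisfy the balancing condition (`balancedWeights`). A variable `x_H` acts on such a function by
`(x_H w)(τ) = w(τ ∪ {H})` if `H` is not in `τ`. If `H` is in `τ`, a linear relation for two
elements separated by `H` alone replaces `x_H` by variables outside `τ`, and balancing makes the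
result independent of the choice. These operators preserve balancing, commute and satisfy the
defining relations of the Chow ring, so that the Chow ring acts on weights. The function with value
one on the maximal flags is balanced, because the flats that cover a given flat partition the
remaining elements. Acting on it and evaluating at the empty flag is the degree map. Uniqueness
holds since the same rewriting shows that the monomials of flags span the ring
(`chowGraded_eq_flagSpan`).

*Duality.* A class of `A(U_{n+1,n+1})` is determined by its weight
(`eq_zero_of_forall_chowDeg_eq_zero`). For a permutation `u`, let `x_{Des u}` and `x_{Asc u}` be
the products of the variables of the initial segments of `u` that end at a descent, respectively at
an ascent. The monomials `x_{Des u}` span: if a flag is refined to a permutation with increasing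
blocks and some member of the flag ends at an ascent, the linear relation of the two neighbouring
elements rewrites the monomial by flags with more inversions. The degree of `x_{Des u} x_{Asc v}`
is one if `u = v`, and it vanishes unless the inversions of `u` are inversions of `v`. Hence the
pairing is triangular.

*The weight of the sliding class.* Let `P(A, B)` be the generating function, in a variable `y`, of
the sliding statistic over chains between `A` and `B` (`slideSum`). The linear relations show that,
for `A ⊂ H` and in the presence of the factor `x_A x_H`, `P(A, E) = y ^ |H \ A| P(H, E) + P(A, H)`
(`mul_slideSum`). Therefore the product of the sliding class with the monomial of a chain `G` is
the sum of the contributions `y ^ |G_i| P(G_i, G_{i+1})` of its gaps (`prod_mul_slideSum`). If `G`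
has `n - r` members, its gaps have at most `r + 1` elements. A smaller gap contains no transversal
with `r + 1` elements and contributes zero. A gap with `r + 1` elements contributes a maximal
chain, of degree one. Reading off the coefficient of `y ^ k` yields the one-window weight
(`hasWeight_slidingClass`).
-/

namespace MatroidChow

open Finset Polynomial

noncomputable section

/-! ### External activity and the specialization at `x = 1` -/

variable {n : ℕ} {M : Matroid (Fin (n + 1))}

/-- An element outside a basis is externally active if and only if it is spanned by the larger
elements of the basis, that is, if it is the smallest element of its fundamental circuit. -/
theorem mem_externallyActive_iff (hE : M.E = Set.univ) {B : Finset (Fin (n + 1))}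
    (hB : M.IsBase (B : Set (Fin (n + 1)))) (j : Fin (n + 1)) :
    j ∈ externallyActive M B ↔ j ∉ B ∧ j ∈ M.closure {b | b ∈ B ∧ j < b} := by
  classical
  simp only [externallyActive, mem_filter, mem_univ, true_and]
  refine and_congr_right fun hj => ⟨fun h => ?_, fun h i hi hb => ?_⟩
  -- the other elements of the fundamental circuit of `j` span `j`, and each of them is larger
  · have hjE : j ∈ M.closure (B : Set (Fin (n + 1))) := by simp [hB.closure_eq, hE]
    have hC := hB.indep.fundCircuit_isCircuit hjE (by simpa using hj)
    have h1 := hC.mem_closure_sdiff_singleton_of_mem (M.mem_fundCircuit j _)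
    refine M.closure_subset_closure ?_ h1
    rintro b ⟨hb, hbj⟩
    have hbB : b ∈ B := by
      rcases M.fundCircuit_subset_insert j _ hb with h | h
      · exact absurd h hbj
      · exact h
    refine ⟨hbB, lt_of_not_ge fun hle => ?_⟩
    have hlt : b < j := lt_of_le_of_ne hle hbj
    apply h b hlt
    rw [hB.indep.mem_fundCircuit_iff hjE (by simpa using hj)] at hb
    have h2 := hB.exchange_isBase_of_indep' (e := b) (f := j) (by simpa using hbB)
      (by simpa using hj) hb
    convert h2 using 1
    ext x
    simp only [coe_insert, coe_erase, Set.mem_insert_iff, Set.mem_sdiff, Set.mem_singleton_iff,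
      mem_coe]
    constructor
    · rintro (rfl | h)
      · exact ⟨Or.inl rfl, by rintro rfl; exact absurd hbB hj⟩
      · exact ⟨Or.inr h.1, h.2⟩
    · rintro ⟨h | h, h3⟩
      · exact Or.inl h
      · exact Or.inr ⟨h, h3⟩
  · have h1 := hb.indep.notMem_closure_sdiff_of_mem (e := j) (by simp)
    apply h1
    refine M.closure_subset_closure ?_ h
    rintro b ⟨hb1, hb2⟩
    exact ⟨by simp [hb1, (hi.trans hb2).ne'], by simpa using hb2.ne'⟩

/-- The greedy basis of a set `S`, where large elements are preferred. -/
def greedyBasis (M : Matroid (Fin (n + 1))) (S : Finset (Fin (n + 1))) : Finset (Fin (n + 1)) :=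
  by classical exact {s ∈ S | s ∉ M.closure {t | t ∈ S ∧ s < t}}

theorem mem_greedyBasis {S : Finset (Fin (n + 1))} {s : Fin (n + 1)} :
    s ∈ greedyBasis M S ↔ s ∈ S ∧ s ∉ M.closure {t | t ∈ S ∧ s < t} := by
  simp [greedyBasis]

theorem greedyBasis_subset (S : Finset (Fin (n + 1))) : greedyBasis M S ⊆ S :=
  fun _ h => (mem_greedyBasis.1 h).1

/-- By downward induction on `s`: an element of `S` that is not in the greedy basis is spanned by
larger elements of `S`. -/
theorem mem_closure_greedyBasis (hE : M.E = Set.univ) (S : Finset (Fin (n + 1))) (s : Fin (n + 1))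
    (hs : s ∈ S) : s ∈ M.closure {b | b ∈ greedyBasis M S ∧ s ≤ b} := by
  induction s using WellFoundedGT.induction with
  | ind s ih =>
    by_cases h : s ∈ greedyBasis M S
    · exact M.mem_closure_of_mem' (X := {b | b ∈ greedyBasis M S ∧ s ≤ b}) ⟨h, le_rfl⟩
        (by simp [hE])
    · have h1 : s ∈ M.closure {t | t ∈ S ∧ s < t} := by
        by_contra h2
        exact h (mem_greedyBasis.2 ⟨hs, h2⟩)
      refine M.closure_subset_closure_of_subset_closure ?_ h1
      rintro t ⟨ht, hst⟩
      refine M.closure_subset_closure ?_ (ih t hst ht)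
      exact fun b hb => ⟨hb.1, hst.le.trans hb.2⟩

/-- The smallest element of a circuit is spanned by the larger ones, so it is not greedy. -/
theorem indep_greedyBasis (hE : M.E = Set.univ) (S : Finset (Fin (n + 1))) :
    M.Indep (greedyBasis M S : Set (Fin (n + 1))) := by
  classical
  by_contra h
  have hd : M.Dep (greedyBasis M S : Set (Fin (n + 1))) := ⟨h, by simp [hE]⟩
  obtain ⟨C, hCB, hC⟩ := hd.exists_isCircuit_subset
  obtain ⟨b, hb, hmin⟩ := Set.exists_min_image C id C.toFinite hC.nonempty
  have h1 := hC.mem_closure_sdiff_singleton_of_mem hb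
  apply (mem_greedyBasis.1 (hCB hb)).2
  refine M.closure_subset_closure ?_ h1
  rintro t ⟨ht, htb⟩
  exact ⟨greedyBasis_subset S (hCB ht), lt_of_le_of_ne (hmin t ht) (Ne.symm htb)⟩

theorem isBase_greedyBasis (hE : M.E = Set.univ) {S : Finset (Fin (n + 1))}
    (hS : M.Spanning (S : Set (Fin (n + 1)))) :
    M.IsBase (greedyBasis M S : Set (Fin (n + 1))) := by
  refine (indep_greedyBasis hE S).isBase_of_ground_subset_closure ?_
  rw [← hS.closure_eq]
  refine M.closure_subset_closure_of_subset_closure fun s hs => ?_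
  exact M.closure_subset_closure (fun b hb => hb.1) (mem_closure_greedyBasis hE S s hs)

theorem sdiff_greedyBasis_subset (hE : M.E = Set.univ) {S : Finset (Fin (n + 1))}
    (hS : M.Spanning (S : Set (Fin (n + 1)))) :
    S \ greedyBasis M S ⊆ externallyActive M (greedyBasis M S) := by
  intro s hs
  rw [mem_sdiff] at hs
  rw [mem_externallyActive_iff hE (isBase_greedyBasis hE hS)]
  refine ⟨hs.2, ?_⟩
  refine M.closure_subset_closure ?_ (mem_closure_greedyBasis hE S s hs.1)
  rintro b ⟨hb, hsb⟩
  exact ⟨hb, lt_of_le_of_ne hsb (by rintro rfl; exact hs.2 hb)⟩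

/-- Adding externally active elements to a basis does not change the greedy basis: it recovers the
basis from any set of the interval. -/
theorem greedyBasis_union (hE : M.E = Set.univ) {B A : Finset (Fin (n + 1))}
    (hB : M.IsBase (B : Set (Fin (n + 1)))) (hA : A ⊆ externallyActive M B) :
    greedyBasis M (B ∪ A) = B := by
  classical
  have key : ∀ s, M.closure {t | t ∈ B ∪ A ∧ s < t} ⊆ M.closure {b | b ∈ B ∧ s < b} := by
    intro s
    refine M.closure_subset_closure_of_subset_closure ?_
    rintro t ⟨ht, hst⟩
    rcases mem_union.1 ht with h | h
    · exact M.mem_closure_of_mem' (X := {b | b ∈ B ∧ s < b}) ⟨h, hst⟩ (by simp [hE])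
    · refine M.closure_subset_closure ?_ ((mem_externallyActive_iff hE hB t).1 (hA h)).2
      exact fun b hb => ⟨hb.1, hst.trans hb.2⟩
  ext s
  rw [mem_greedyBasis]
  constructor
  · rintro ⟨hs, hs'⟩
    rcases mem_union.1 hs with h | h
    · exact h
    · refine absurd (M.closure_subset_closure ?_
        ((mem_externallyActive_iff hE hB s).1 (hA h)).2) hs'
      exact fun b hb => ⟨mem_union_left _ hb.1, hb.2⟩
  · intro hs
    refine ⟨mem_union_left _ hs, fun h => ?_⟩
    refine hB.indep.notMem_closure_sdiff_of_mem (e := s) (by simpa using hs) ?_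
    refine M.closure_subset_closure ?_ (key s h)
    exact fun b hb => ⟨hb.1, hb.2.ne'⟩

open scoped Classical in
/-- The spanning sets are partitioned into the intervals `[B, B ∪ EA(B)]`, for `B` a basis; on each
of them the sum is a binomial expansion of `((X - 1) + 1) ^ |EA(B)|`. -/
theorem sum_spanning_eq (hE : M.E = Set.univ) {r : ℕ} (hr : M.eRank = ((r + 1 : ℕ) : ℕ∞)) :
    ∑ S ∈ univ.filter (fun S : Finset (Fin (n + 1)) => M.Spanning (S : Set (Fin (n + 1)))),
        (X - 1 : ℤ[X]) ^ (S.card - (r + 1)) =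
      ∑ B ∈ univ.filter (fun B : Finset (Fin (n + 1)) => M.IsBase (B : Set (Fin (n + 1)))),
        (X : ℤ[X]) ^ (externallyActive M B).card := by
  have hcard : ∀ B : Finset (Fin (n + 1)), M.IsBase (B : Set (Fin (n + 1))) → B.card = r + 1 := by
    intro B hB
    have := hB.encard_eq_eRank
    rw [hr, Set.encard_coe_eq_coe_finsetCard] at this
    exact_mod_cast this
  have h1 : ∀ B : Finset (Fin (n + 1)), (X : ℤ[X]) ^ (externallyActive M B).card =
      ∑ A ∈ (externallyActive M B).powerset, (X - 1 : ℤ[X]) ^ A.card := by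
    intro B
    have := Finset.sum_pow_mul_eq_add_pow (X - 1 : ℤ[X]) 1 (externallyActive M B)
    simpa using this.symm
  simp_rw [h1]
  rw [Finset.sum_sigma']
  symm
  refine Finset.sum_bij' (fun x _ => x.1 ∪ x.2) (fun S _ => ⟨greedyBasis M S, S \ greedyBasis M S⟩)
    ?_ ?_ ?_ ?_ ?_
  · rintro ⟨B, A⟩ h
    simp only [mem_sigma, mem_filter, mem_univ, true_and, mem_powerset] at h ⊢
    exact h.1.spanning.superset (by simp) (by simp [hE])
  · intro S hS
    simp only [mem_sigma, mem_filter, mem_univ, true_and, mem_powerset] at hS ⊢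
    exact ⟨isBase_greedyBasis hE hS, sdiff_greedyBasis_subset hE hS⟩
  · rintro ⟨B, A⟩ h
    simp only [mem_sigma, mem_filter, mem_univ, true_and, mem_powerset] at h ⊢
    rw [greedyBasis_union hE h.1 h.2, union_sdiff_cancel_left]
    rw [disjoint_right]
    exact fun a ha => ((mem_externallyActive_iff hE h.1 a).1 (h.2 ha)).1
  · intro S hS
    exact union_sdiff_of_subset (greedyBasis_subset S)
  · rintro ⟨B, A⟩ h
    simp only [mem_sigma, mem_filter, mem_univ, true_and, mem_powerset] at h ⊢
    rw [card_union_of_disjoint, hcard B h.1, Nat.add_sub_cancel_left]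
    rw [disjoint_right]
    exact fun a ha => ((mem_externallyActive_iff hE h.1 a).1 (h.2 ha)).1

open scoped Classical in
/-- At `x = 1` only the spanning sets contribute to the Tutte polynomial, because
`0 ^ (rk M - rk S) = 0` for all other sets `S`. -/
theorem tutteOne_eq_sum_bases (hE : M.E = Set.univ) {r : ℕ}
    (hr : M.eRank = ((r + 1 : ℕ) : ℕ∞)) :
    tutteOne M =
      ∑ B ∈ univ.filter (fun B : Finset (Fin (n + 1)) => M.IsBase (B : Set (Fin (n + 1)))),
        (X : ℤ[X]) ^ (externallyActive M B).card := by
  rw [← sum_spanning_eq hE hr, sum_filter, tutteOne, tuttePolynomial, map_sum]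
  refine sum_congr rfl fun S _ => ?_
  have hle := M.eRk_le_eRank (S : Set (Fin (n + 1)))
  have hsp : M.Spanning (S : Set (Fin (n + 1))) ↔ M.eRk (S : Set (Fin (n + 1))) = M.eRank := by
    constructor
    · intro h
      rw [← M.eRk_closure_eq, h.closure_eq, M.eRk_ground]
    · intro h
      obtain ⟨I, hI⟩ := M.exists_isBasis (S : Set (Fin (n + 1))) (by simp [hE])
      have hb := hI.indep.isBase_of_eRk_ge (Set.toFinite I) (by rw [← h, hI.eRk_eq_eRk])
      exact hb.spanning.superset hI.subset (by simp [hE])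
  rw [map_mul, map_pow, map_pow]
  simp only [map_sub, MvPolynomial.aeval_X, map_one, Matrix.cons_val_zero, Matrix.cons_val_one,
    sub_self]
  split_ifs with h
  · rw [hsp] at h
    rw [h, hr, ENat.toNat_natCast]
    simp
  · rw [hsp] at h
    have hlt := lt_of_le_of_ne hle h
    rw [hr] at hlt ⊢
    obtain ⟨k, hk⟩ := ENat.ne_top_iff_exists.1 hlt.ne_top
    rw [← hk] at hlt ⊢
    have : k < r + 1 := by exact_mod_cast hlt
    rw [ENat.toNat_natCast, ENat.toNat_natCast, zero_pow (by omega), zero_mul]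

theorem tutteOne_eq_sum_activityCount (hE : M.E = Set.univ) {r : ℕ}
    (hr : M.eRank = ((r + 1 : ℕ) : ℕ∞)) :
    tutteOne M = ∑ k ∈ range (n - r + 1), monomial k (activityCount M k : ℤ) := by
  classical
  rw [tutteOne_eq_sum_bases hE hr]
  have hmaps : ∀ B ∈ univ.filter (fun B : Finset (Fin (n + 1)) =>
      M.IsBase (B : Set (Fin (n + 1)))),
      (externallyActive M B).card ∈ range (n - r + 1) := by
    intro B hB
    simp only [mem_filter, mem_univ, true_and] at hB
    have h1 : B.card = r + 1 := by
      have := hB.encard_eq_eRank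
      rw [hr, Set.encard_coe_eq_coe_finsetCard] at this
      exact_mod_cast this
    have h2 : externallyActive M B ⊆ univ \ B := by
      intro j hj
      simp [((mem_externallyActive_iff hE hB j).1 hj).1]
    have h3 := card_le_card h2
    rw [card_sdiff_of_subset (subset_univ _), card_univ, Fintype.card_fin] at h3
    rw [mem_range]
    omega
  rw [← sum_fiberwise_of_maps_to hmaps]
  refine sum_congr rfl fun k _ => ?_
  rw [sum_congr rfl (g := fun _ => (X : ℤ[X]) ^ k)
    (fun B hB => by rw [(mem_filter.1 hB).2]), sum_const, activityCount, filter_filter,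
    ← C_mul_X_pow_eq_monomial, nsmul_eq_mul]
  simp

/-! ### Decreasing transversals of flag chains and bases -/

@[simp] theorem flagTerm_zero {c : ℕ} (F : FlatChain M c) : flagTerm F 0 = ∅ := by simp [flagTerm]

theorem flagTerm_succ {c : ℕ} (F : FlatChain M c) {i : ℕ} (h : i < c) :
    flagTerm F (i + 1) = (F.1 ⟨i, h⟩).1 := by simp [flagTerm, h]

theorem flagTerm_last {c : ℕ} (F : FlatChain M c) : flagTerm F (c + 1) = univ := by
  simp [flagTerm]

theorem flagTerm_mono {c : ℕ} (F : FlatChain M c) : Monotone (flagTerm F) := by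
  refine monotone_nat_of_le_succ fun i => ?_
  rcases Nat.eq_zero_or_pos i with rfl | hi
  · simp
  · obtain ⟨j, rfl⟩ : ∃ j, i = j + 1 := ⟨i - 1, by omega⟩
    by_cases h : j + 1 < c
    · rw [flagTerm_succ F (by omega : j < c), flagTerm_succ F h]
      exact F.2.monotone (by simp)
    · have : flagTerm F (j + 1 + 1) = univ := by simp [flagTerm, h]
      rw [this]
      exact subset_univ _

theorem isFlat_flagTerm (hE : M.E = Set.univ) (hL : M.Loopless) {c : ℕ} (F : FlatChain M c)
    (i : ℕ) : M.IsFlat (flagTerm F i : Set (Fin (n + 1))) := by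
  unfold flagTerm
  split_ifs with h1 h2
  · have := M.isFlat_closure ∅
    rw [← Matroid.loops, M.loops_eq_empty] at this
    simpa using this
  · exact (F.1 _).2.1
  · simp [← hE]

theorem mem_flagBlock {c : ℕ} {F : FlatChain M c} {i : Fin (c + 1)} {y : Fin (n + 1)} :
    y ∈ flagBlock F i ↔ y ∈ flagTerm F (i + 1) ∧ y ∉ flagTerm F i := by
  simp [flagBlock]

theorem flagBlock_unique {c : ℕ} {F : FlatChain M c} {i j : Fin (c + 1)} {y : Fin (n + 1)}
    (hi : y ∈ flagBlock F i) (hj : y ∈ flagBlock F j) : i = j := by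
  rw [mem_flagBlock] at hi hj
  by_contra h
  rcases lt_or_gt_of_ne h with h | h
  · exact hj.2 (flagTerm_mono F (Nat.succ_le_of_lt h) hi.1)
  · exact hi.2 (flagTerm_mono F (Nat.succ_le_of_lt h) hj.1)

theorem exists_mem_flagBlock {c : ℕ} (F : FlatChain M c) (y : Fin (n + 1)) :
    ∃ i, y ∈ flagBlock F i := by
  classical
  have h : ∃ i, y ∈ flagTerm F i := ⟨c + 1, by simp [flagTerm_last]⟩
  have h0 : Nat.find h ≠ 0 := by
    intro h0
    have := Nat.find_spec h
    rw [h0] at this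
    simp at this
  have hle : Nat.find h ≤ c + 1 := Nat.find_min' h (by simp [flagTerm_last])
  refine ⟨⟨Nat.find h - 1, by omega⟩, mem_flagBlock.2 ⟨?_, Nat.find_min h (by simp)⟩⟩
  have := Nat.find_spec h
  convert this using 2
  simp

/-- The set of the first `i` terms of a sequence. -/
def initialTerms {c : ℕ} (x : Fin c → Fin (n + 1)) (i : ℕ) : Set (Fin (n + 1)) :=
  x '' {j | j.val < i}

theorem initialTerms_succ {c : ℕ} (x : Fin c → Fin (n + 1)) (i : Fin c) :
    initialTerms x (i + 1) = insert (x i) (initialTerms x i) := by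
  ext y
  simp only [initialTerms, Set.mem_image, Set.mem_ofPred_eq, Set.mem_insert_iff]
  constructor
  · rintro ⟨j, hj, rfl⟩
    rcases Nat.lt_succ_iff_lt_or_eq.1 hj with h | h
    · exact Or.inr ⟨j, h, rfl⟩
    · exact Or.inl (by rw [Fin.ext h])
  · rintro (rfl | ⟨j, hj, rfl⟩)
    · exact ⟨i, by simp, rfl⟩
    · exact ⟨j, by omega, rfl⟩

@[simp] theorem initialTerms_zero {c : ℕ} (x : Fin c → Fin (n + 1)) : initialTerms x 0 = ∅ := by
  simp [initialTerms]

theorem initialTerms_last {c : ℕ} (x : Fin c → Fin (n + 1)) :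
    initialTerms x c = ((univ.image x : Finset (Fin (n + 1))) : Set (Fin (n + 1))) := by
  simp [initialTerms]

theorem initialTerms_mono {c : ℕ} (x : Fin c → Fin (n + 1)) : Monotone (initialTerms x) :=
  fun _ _ h => Set.image_mono fun _ hk => lt_of_lt_of_le hk h

section transversal

variable {c : ℕ} {F : FlatChain M c} {x : Fin (c + 1) → Fin (n + 1)}

theorem initialTerms_subset_flagTerm (hx : ∀ i, x i ∈ flagBlock F i) (i : ℕ) :
    initialTerms x i ⊆ flagTerm F i := by
  rintro _ ⟨j, hj, rfl⟩
  exact flagTerm_mono F (Nat.succ_le_of_lt hj) (mem_flagBlock.1 (hx j)).1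

theorem closure_subset_flagTerm (hE : M.E = Set.univ) (hL : M.Loopless)
    {I : Set (Fin (n + 1))} {i : ℕ} (h : I ⊆ flagTerm F i) : M.closure I ⊆ flagTerm F i := by
  rw [← (isFlat_flagTerm hE hL F i).closure]
  exact M.closure_subset_closure h

/-- Independence is preserved when a transversal is continued, since each chosen element lies
outside the flat that contains everything before it. -/
theorem indep_union_initialTerms (hE : M.E = Set.univ) (hL : M.Loopless)
    (hx : ∀ i, x i ∈ flagBlock F i) {I : Set (Fin (n + 1))} {i : ℕ} (hIF : I ⊆ flagTerm F i)
    (hI : M.Indep (I ∪ initialTerms x i)) (m : ℕ) (him : i ≤ m) (hm : m ≤ c + 1) :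
    M.Indep (I ∪ initialTerms x m) := by
  induction m, him using Nat.le_induction with
  | base => exact hI
  | succ m him ih =>
    have h1 := initialTerms_succ x ⟨m, hm⟩
    simp only at h1
    rw [h1, Set.union_insert, Matroid.insert_indep_iff]
    refine ⟨ih (by omega), fun _ => ⟨by simp [hE], fun h => ?_⟩⟩
    refine (mem_flagBlock.1 (hx ⟨m, hm⟩)).2 (closure_subset_flagTerm hE hL ?_ h)
    exact Set.union_subset (hIF.trans (flagTerm_mono F him)) (initialTerms_subset_flagTerm hx m)

theorem indep_image_of_mem_flagBlock (hE : M.E = Set.univ) (hL : M.Loopless)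
    (hx : ∀ i, x i ∈ flagBlock F i) : M.Indep (univ.image x : Finset (Fin (n + 1))) := by
  have := indep_union_initialTerms (I := ∅) (i := 0) hE hL hx (by simp) (by simp) (c + 1)
    (by simp) le_rfl
  rwa [initialTerms_last, Set.empty_union] at this

theorem injective_of_mem_flagBlock (hx : ∀ i, x i ∈ flagBlock F i) : Function.Injective x :=
  fun i j h => flagBlock_unique (hx i) (h ▸ hx j)

theorem isBase_image_of_mem_flagBlock (hE : M.E = Set.univ) (hL : M.Loopless)
    (hr : M.eRank = ((c + 1 : ℕ) : ℕ∞)) (hx : ∀ i, x i ∈ flagBlock F i) :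
    M.IsBase (univ.image x : Finset (Fin (n + 1))) := by
  have hI := indep_image_of_mem_flagBlock hE hL hx
  refine hI.isBase_of_eRk_ge (Finset.finite_toSet _) ?_
  rw [hI.eRk_eq_encard, Set.encard_coe_eq_coe_finsetCard,
    card_image_of_injective _ (injective_of_mem_flagBlock hx), hr]
  simp

/-- A chain of `r` nonempty proper flats in a matroid of rank `r + 1` is determined by any of its
transversals. -/
theorem closure_initialTerms (hE : M.E = Set.univ) (hL : M.Loopless)
    (hr : M.eRank = ((c + 1 : ℕ) : ℕ∞)) (hx : ∀ i, x i ∈ flagBlock F i) {i : ℕ} (hi : i ≤ c + 1) :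
    M.closure (initialTerms x i) = flagTerm F i := by
  refine (closure_subset_flagTerm hE hL (initialTerms_subset_flagTerm hx i)).antisymm fun y hy => ?_
  by_contra hcl
  have hI := indep_image_of_mem_flagBlock hE hL hx
  rw [← initialTerms_last] at hI
  have h1 : M.Indep ({y} ∪ initialTerms x i) := by
    rw [Set.singleton_union, Matroid.insert_indep_iff]
    exact ⟨hI.subset (initialTerms_mono x hi), fun _ => ⟨by simp [hE], hcl⟩⟩
  have h2 := indep_union_initialTerms hE hL hx (by simpa using hy) h1 (c + 1) hi le_rfl
  have hB := isBase_image_of_mem_flagBlock hE hL hr hx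
  rw [← initialTerms_last] at hB
  have h3 := hB.eq_of_subset_indep h2 Set.subset_union_right
  have hyB : y ∈ initialTerms x (c + 1) := by rw [h3]; simp
  obtain ⟨j, hj, rfl⟩ := hyB
  have h4 : ¬ j.val < i := fun h => hcl (M.mem_closure_of_mem' ⟨j, h, rfl⟩ (by simp [hE]))
  exact (mem_flagBlock.1 (hx j)).2 (flagTerm_mono F (not_lt.1 h4) hy)

/-- For a decreasing transversal of a maximal chain of flats, the number counted by the sliding
statistic is the external activity of the corresponding basis. -/
theorem card_externallyActive_image (hE : M.E = Set.univ) (hL : M.Loopless)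
    (hr : M.eRank = ((c + 1 : ℕ) : ℕ∞)) (hx : ∀ i, x i ∈ flagBlock F i) (ha : StrictAnti x) :
    #(externallyActive M (univ.image x)) = ∑ i, #{y ∈ flagBlock F i | y < x i} := by
  classical
  -- an element `j` of the block `i` is spanned by the larger elements of the basis if and only if
  -- `x i` is one of them
  rw [← card_biUnion]
  · congr 1
    ext j
    rw [mem_externallyActive_iff hE (isBase_image_of_mem_flagBlock hE hL hr hx)]
    simp only [mem_biUnion, mem_univ, true_and, mem_filter]
    constructor
    · rintro ⟨hj1, hj2⟩
      obtain ⟨i, hi⟩ := exists_mem_flagBlock F j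
      refine ⟨i, hi, ?_⟩
      by_contra hle
      apply (mem_flagBlock.1 hi).2
      rw [← mem_coe, ← closure_initialTerms hE hL hr hx i.2.le]
      refine M.closure_subset_closure ?_ hj2
      rintro b ⟨hb, hjb⟩
      obtain ⟨l, -, rfl⟩ := mem_image.1 hb
      refine ⟨l, ?_, rfl⟩
      exact ha.lt_iff_gt.1 (lt_of_le_of_lt (not_lt.1 hle) hjb)
    · rintro ⟨i, hi, hlt⟩
      constructor
      · rw [mem_image]
        rintro ⟨l, -, rfl⟩
        rw [flagBlock_unique hi (hx l)] at hlt
        exact lt_irrefl _ hlt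
      · have := (mem_flagBlock.1 hi).1
        rw [← mem_coe, ← closure_initialTerms hE hL hr hx (by omega)] at this
        refine M.closure_subset_closure ?_ this
        rintro _ ⟨l, hl, rfl⟩
        refine ⟨mem_image_of_mem _ (mem_univ _), lt_of_lt_of_le hlt (ha.antitone ?_)⟩
        exact Nat.lt_succ_iff.1 hl
  · intro i _ j _ hij
    refine disjoint_left.2 fun y hy hy' => hij ?_
    exact flagBlock_unique (mem_filter.1 hy).1 (mem_filter.1 hy').1

end transversal

/-- The closures of the initial segments of an ordered basis form a chain of flats with the basis
as a transversal. -/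
theorem exists_flatChain_of_isBase (hE : M.E = Set.univ) (hL : M.Loopless) {c : ℕ}
    {x : Fin (c + 1) → Fin (n + 1)} (hinj : Function.Injective x)
    (hB : M.IsBase (univ.image x : Finset (Fin (n + 1)))) :
    ∃ F : FlatChain M c, ∀ i, x i ∈ flagBlock F i := by
  classical
  have hI : M.Indep (Set.range x) := by simpa using hB.indep
  have hcl : ∀ i : Fin (c + 1), ∀ m ≤ i.val, x i ∉ M.closure (initialTerms x m) := by
    intro i m hm h
    refine hI.notMem_closure_sdiff_of_mem (Set.mem_range_self i) (M.closure_subset_closure ?_ h)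
    rintro _ ⟨j, hj, rfl⟩
    refine ⟨Set.mem_range_self j, fun h => ?_⟩
    have := hinj h
    subst this
    exact absurd hm (not_le.2 hj)
  have hmem : ∀ i : Fin (c + 1), ∀ m, i.val < m → x i ∈ M.closure (initialTerms x m) :=
    fun i m hm => M.mem_closure_of_mem' ⟨i, hm, rfl⟩ (by simp [hE])
  let F : Fin c → ProperFlat M := fun i =>
    ⟨(M.closure (initialTerms x (i + 1))).toFinset, by simp,
      ⟨x 0, by simpa using hmem 0 _ (by simp)⟩, fun h => by
        have h1 : x (Fin.last c) ∈ (M.closure (initialTerms x (i + 1))).toFinset := by simp [h]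
        exact hcl _ _ (by simp) (Set.mem_toFinset.1 h1)⟩
  have hF : StrictMono F := by
    intro i j hij
    refine lt_of_le_of_ne ?_ fun h => ?_
    · change (M.closure (initialTerms x (i + 1))).toFinset ⊆
        (M.closure (initialTerms x (j + 1))).toFinset
      rw [Set.toFinset_subset_toFinset]
      exact M.closure_subset_closure (initialTerms_mono x (by simpa using hij.le))
    · have h1 := congrArg (fun K : ProperFlat M => K.1) h
      have h2 : x j.castSucc ∈ (M.closure (initialTerms x (j + 1))).toFinset := by
        simpa using hmem j.castSucc _ (by simp)
      simp only [F] at h1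
      rw [← h1] at h2
      exact hcl j.castSucc (i + 1) (by simpa using hij) (Set.mem_toFinset.1 h2)
  have hflag : ∀ i ≤ c + 1, (flagTerm ⟨F, hF⟩ i : Set (Fin (n + 1))) =
      M.closure (initialTerms x i) := by
    intro i hi
    rcases Nat.eq_zero_or_pos i with rfl | hpos
    · have h0 := M.loops_eq_empty
      rw [Matroid.loops] at h0
      simp [h0]
    · obtain ⟨j, rfl⟩ : ∃ j, i = j + 1 := ⟨i - 1, by omega⟩
      by_cases hj : j < c
      · rw [flagTerm_succ _ hj]
        simp [F]
      · obtain rfl : j = c := by omega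
        rw [flagTerm_last, initialTerms_last, hB.closure_eq, hE]
        simp
  refine ⟨⟨F, hF⟩, fun i => mem_flagBlock.2 ⟨?_, ?_⟩⟩
  · rw [← mem_coe, hflag _ (by omega)]
    exact hmem i _ (by simp)
  · rw [← mem_coe, hflag _ (by omega)]
    exact hcl i _ le_rfl

/-- Pairs of a chain of flats and a decreasing transversal correspond to bases, and the sliding
statistic to the external activity. -/
theorem sum_slidingCount_eq_activityCount (hE : M.E = Set.univ) (hL : M.Loopless) {r : ℕ}
    (hr : M.eRank = ((r + 1 : ℕ) : ℕ∞)) (k : ℕ) :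
    ∑ F : FlatChain M r, slidingCount F k = activityCount M k := by
  classical
  unfold slidingCount activityCount
  rw [← card_sigma]
  refine card_bij (fun p _ => univ.image p.2) ?_ ?_ ?_
  · rintro ⟨F, x⟩ h
    simp only [mem_sigma, mem_univ, mem_filter, true_and] at h ⊢
    exact ⟨isBase_image_of_mem_flagBlock hE hL hr h.1,
      (card_externallyActive_image hE hL hr h.1 h.2.2).trans h.2.1⟩
  · rintro ⟨F, x⟩ h ⟨G, z⟩ h' heq
    simp only [mem_sigma, mem_univ, mem_filter, true_and] at h h' heq
    have hxz : x = z := by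
      have hx : StrictMono (x ∘ Fin.rev) := fun i j hij => h.2.2 (by simpa using hij)
      have hz : StrictMono (z ∘ Fin.rev) := fun i j hij => h'.2.2 (by simpa using hij)
      have hrange : Set.range (x ∘ Fin.rev) = Set.range (z ∘ Fin.rev) := by
        rw [Fin.rev_surjective.range_comp, Fin.rev_surjective.range_comp]
        have := congrArg (fun s : Finset (Fin (n + 1)) => (s : Set (Fin (n + 1)))) heq
        simpa using this
      have h3 : x ∘ Fin.rev = z ∘ Fin.rev := (hx.range_inj hz).1 hrange
      funext i
      simpa using congrFun h3 i.rev
    subst hxz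
    have hFG : F = G := by
      apply Subtype.ext
      funext i
      apply Subtype.ext
      rw [← flagTerm_succ F i.2, ← flagTerm_succ G i.2, ← coe_inj,
        ← closure_initialTerms hE hL hr h.1 (by omega),
        ← closure_initialTerms hE hL hr h'.1 (by omega)]
    rw [hFG]
  · intro B hB
    simp only [mem_filter, mem_univ, true_and] at hB
    have hcard : B.card = r + 1 := by
      have := hB.1.encard_eq_eRank
      rw [hr, Set.encard_coe_eq_coe_finsetCard] at this
      exact_mod_cast this
    let x : Fin (r + 1) → Fin (n + 1) := B.orderEmbOfFin hcard ∘ Fin.rev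
    have hx : StrictAnti x := fun i j hij => (B.orderEmbOfFin hcard).strictMono (by simpa using hij)
    have himg : univ.image x = B := by
      rw [← coe_inj, coe_image, coe_univ, Set.image_univ, Fin.rev_surjective.range_comp]
      exact range_orderEmbOfFin B hcard
    obtain ⟨F, hF⟩ := exists_flatChain_of_isBase hE hL hx.injective (himg.symm ▸ hB.1)
    refine ⟨⟨F, x⟩, ?_, himg⟩
    simp only [mem_sigma, mem_univ, mem_filter, true_and]
    refine ⟨hF, ?_, hx⟩
    rw [← card_externallyActive_image hE hL hr hF hx, himg, hB.2]

/-! ### Flags and Minkowski weights -/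

/-- A finite set of nonempty proper flats that is totally ordered by inclusion. -/
abbrev IsFlag (τ : Finset (ProperFlat M)) : Prop :=
  IsChain (· ≤ ·) (τ : Set (ProperFlat M))

theorem IsFlag.subset {σ τ : Finset (ProperFlat M)} (h : IsFlag τ) (hs : σ ⊆ τ) : IsFlag σ :=
  IsChain.mono (by exact_mod_cast hs) h

theorem IsFlag.le_or_le {τ : Finset (ProperFlat M)} (h : IsFlag τ) {F G : ProperFlat M}
    (hF : F ∈ τ) (hG : G ∈ τ) : F ≤ G ∨ G ≤ F :=
  h.total (by exact_mod_cast hF) (by exact_mod_cast hG)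

theorem IsFlag.le_of_mem_of_notMem {τ : Finset (ProperFlat M)} (h : IsFlag τ) {F G : ProperFlat M}
    (hF : F ∈ τ) (hG : G ∈ τ) {p : Fin (n + 1)} (hpG : p ∈ G.1) (hpF : p ∉ F.1) : F ≤ G := by
  rcases h.le_or_le hF hG with h | h
  · exact h
  · exact absurd (h hpG) hpF

/-- Every set in `τ` contains both or none of `p` and `q`. -/
def Unseparated (τ : Finset (ProperFlat M)) (p q : Fin (n + 1)) : Prop :=
  ∀ J ∈ τ, (p ∈ J.1 ↔ q ∈ J.1)

/-- The flat `H` contains `p` but not `q`, and no other flat in `τ` tells them apart. -/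
def SeparatedBy (τ : Finset (ProperFlat M)) (H : ProperFlat M) (p q : Fin (n + 1)) : Prop :=
  p ∈ H.1 ∧ q ∉ H.1 ∧ ∀ J ∈ τ, J ≠ H → (p ∈ J.1 ↔ q ∈ J.1)

theorem Unseparated.symm {τ : Finset (ProperFlat M)} {p q : Fin (n + 1)} (h : Unseparated τ p q) :
    Unseparated τ q p := fun J hJ => (h J hJ).symm

/-- In a flag, every nonempty selection has a largest member. -/
theorem IsFlag.exists_max {τ : Finset (ProperFlat M)} (h : IsFlag τ) (P : ProperFlat M → Prop) :
    (∀ F ∈ τ, ¬ P F) ∨ ∃ F ∈ τ, P F ∧ ∀ G ∈ τ, P G → G ≤ F := by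
  classical
  rcases (τ.filter P).eq_empty_or_nonempty with h0 | h0
  · left
    intro F hF hP
    have : F ∈ τ.filter P := mem_filter.2 ⟨hF, hP⟩
    simp [h0] at this
  · right
    obtain ⟨F, hF⟩ := (τ.filter P).exists_maximal h0
    have hF1 := mem_filter.1 hF.1
    refine ⟨F, hF1.1, hF1.2, fun G hG hPG => ?_⟩
    rcases h.le_or_le hG hF1.1 with h1 | h1
    · exact h1
    · exact hF.2 (mem_filter.2 ⟨hG, hPG⟩) h1

/-- In a flag, every nonempty selection has a smallest member. -/
theorem IsFlag.exists_min {τ : Finset (ProperFlat M)} (h : IsFlag τ) (P : ProperFlat M → Prop) :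
    (∀ F ∈ τ, ¬ P F) ∨ ∃ F ∈ τ, P F ∧ ∀ G ∈ τ, P G → F ≤ G := by
  classical
  rcases (τ.filter P).eq_empty_or_nonempty with h0 | h0
  · left
    intro F hF hP
    have : F ∈ τ.filter P := mem_filter.2 ⟨hF, hP⟩
    simp [h0] at this
  · right
    obtain ⟨F, hF⟩ := (τ.filter P).exists_minimal h0
    have hF1 := mem_filter.1 hF.1
    refine ⟨F, hF1.1, hF1.2, fun G hG hPG => ?_⟩
    rcases h.le_or_le hF1.1 hG with h1 | h1
    · exact h1
    · exact hF.2 (mem_filter.2 ⟨hG, hPG⟩) h1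

theorem exists_mem_notMem_of_lt {F G : ProperFlat M} (h : F < G) : ∃ p ∈ G.1, p ∉ F.1 :=
  Finset.not_subset.1 (not_le_of_gt h)

/-- Take `p` in `H` outside the previous member of the flag, and `q` in the next member outside
`H`. -/
theorem IsFlag.exists_separatedBy {τ : Finset (ProperFlat M)} (h : IsFlag τ) {H : ProperFlat M}
    (hH : H ∈ τ) : ∃ p q, SeparatedBy τ H p q := by
  obtain ⟨p, hp, hp'⟩ : ∃ p ∈ H.1, ∀ J ∈ τ, J < H → p ∉ J.1 := by
    rcases h.exists_max (fun J => J < H) with h1 | ⟨F, hF, hFH, hmax⟩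
    · obtain ⟨p, hp⟩ := H.2.2.1
      exact ⟨p, hp, fun J hJ hlt => absurd hlt (h1 J hJ)⟩
    · obtain ⟨p, hp, hpF⟩ := exists_mem_notMem_of_lt hFH
      exact ⟨p, hp, fun J hJ hlt hpJ => hpF (hmax J hJ hlt hpJ)⟩
  obtain ⟨q, hq, hq'⟩ : ∃ q, q ∉ H.1 ∧ ∀ J ∈ τ, H < J → q ∈ J.1 := by
    rcases h.exists_min (fun J => H < J) with h1 | ⟨F, hF, hFH, hmin⟩
    · obtain ⟨q, hq⟩ : ∃ q, q ∉ H.1 := by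
        by_contra hcon
        push Not at hcon
        exact H.2.2.2 (eq_univ_iff_forall.2 hcon)
      exact ⟨q, hq, fun J hJ hlt => absurd hlt (h1 J hJ)⟩
    · obtain ⟨q, hq, hqF⟩ := exists_mem_notMem_of_lt hFH
      exact ⟨q, hqF, fun J hJ hlt => hmin J hJ hlt hq⟩
  refine ⟨p, q, hp, hq, fun J hJ hne => ?_⟩
  rcases h.le_or_le hJ hH with h1 | h1
  · have := hp' J hJ (lt_of_le_of_ne h1 hne)
    exact ⟨fun h => absurd h this, fun h => absurd (h1 h) hq⟩
  · exact ⟨fun _ => hq' J hJ (lt_of_le_of_ne h1 (Ne.symm hne)), fun _ => h1 hp⟩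

/-- Two pairs separated by exactly `H` lie in the same gaps of the flag below and above `H`. -/
theorem SeparatedBy.unseparated {τ : Finset (ProperFlat M)} (h : IsFlag τ) {H : ProperFlat M}
    (hH : H ∈ τ) {p q a b : Fin (n + 1)} (h1 : SeparatedBy τ H p q) (h2 : SeparatedBy τ H a b) :
    Unseparated τ p a ∧ Unseparated τ q b := by
  obtain ⟨hp, hq, hpq⟩ := h1
  obtain ⟨ha, hb, hab⟩ := h2
  constructor
  all_goals
    intro J hJ
    by_cases hJH : J = H
    · subst hJH; tauto
    · have h3 := hpq J hJ hJH
      have h4 := hab J hJ hJH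
      rcases h.le_or_le hJ hH with h5 | h5
      · have := fun h => hq (h5 h)
        have := fun h => hb (h5 h)
        tauto
      · have := h5 hp
        have := h5 ha
        tauto

/-- The sum of `w (τ ∪ {J})` over the flats `J` containing `p`. The value at a flat `J` of `τ` is
`w τ`. -/
def starSum (p : Fin (n + 1)) (w : Finset (ProperFlat M) → ℤ) (τ : Finset (ProperFlat M)) : ℤ :=
  ∑ J : ProperFlat M with p ∈ J.1, w (insert J τ)

/-- The sum of `w (τ ∪ {J})` over the flats `J` containing `p` but not `q`. -/
def cutSum (p q : Fin (n + 1)) (w : Finset (ProperFlat M) → ℤ) (τ : Finset (ProperFlat M)) : ℤ :=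
  ∑ J : ProperFlat M with p ∈ J.1 ∧ q ∉ J.1, w (insert J τ)

theorem sum_mem_sub_sum_mem {A : Type*} [AddCommGroup A] (f : ProperFlat M → A)
    (p q : Fin (n + 1)) :
    (∑ J : ProperFlat M with p ∈ J.1, f J) - ∑ J : ProperFlat M with q ∈ J.1, f J =
      (∑ J : ProperFlat M with p ∈ J.1 ∧ q ∉ J.1, f J) -
        ∑ J : ProperFlat M with q ∈ J.1 ∧ p ∉ J.1, f J := by
  simp only [sum_filter, ← sum_sub_distrib]
  refine sum_congr rfl fun J _ => ?_
  by_cases hp : p ∈ J.1 <;> by_cases hq : q ∈ J.1 <;> simp [hp, hq]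

theorem starSum_sub_starSum (p q : Fin (n + 1)) (w : Finset (ProperFlat M) → ℤ)
    (τ : Finset (ProperFlat M)) :
    starSum p w τ - starSum q w τ = cutSum p q w τ - cutSum q p w τ :=
  sum_mem_sub_sum_mem _ p q

variable (M) in
/-- Minkowski weights of all dimensions on the Bergman fan of `M`: functions on the sets of flats,
vanishing off the flags, that satisfy the balancing condition. -/
def balancedWeights : Submodule ℤ (Finset (ProperFlat M) → ℤ) where
  carrier := {w | (∀ τ, ¬ IsFlag τ → w τ = 0) ∧
    ∀ τ p q, Unseparated τ p q → starSum p w τ = starSum q w τ}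
  zero_mem' := ⟨fun _ _ => rfl, fun _ _ _ _ => by simp [starSum]⟩
  add_mem' := by
    rintro v w ⟨hv1, hv2⟩ ⟨hw1, hw2⟩
    refine ⟨fun τ hτ => by simp [hv1 τ hτ, hw1 τ hτ], fun τ p q h => ?_⟩
    have h1 := hv2 τ p q h
    have h2 := hw2 τ p q h
    simp only [starSum, Pi.add_apply, sum_add_distrib] at *
    rw [h1, h2]
  smul_mem' := by
    rintro c w ⟨hw1, hw2⟩
    refine ⟨fun τ hτ => by simp [hw1 τ hτ], fun τ p q h => ?_⟩
    have h2 := hw2 τ p q h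
    simp only [starSum, Pi.smul_apply, ← smul_sum] at *
    rw [h2]

open scoped Classical in
/-- The action of `x_H` on weights. At a flag containing `H`, the factor `x_H` is replaced by a
linearly equivalent sum of other variables, by means of a pair of elements separated by `H` alone.
-/
def mulX (H : ProperFlat M) (w : Finset (ProperFlat M) → ℤ) (τ : Finset (ProperFlat M)) : ℤ :=
  if h : H ∈ τ ∧ ∃ a : Fin (n + 1) × Fin (n + 1), SeparatedBy τ H a.1 a.2 then
    w τ - starSum h.2.choose.1 w τ + starSum h.2.choose.2 w τ
  else w (insert H τ)

section weights

variable {w : Finset (ProperFlat M) → ℤ}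

theorem mulX_of_notMem {H : ProperFlat M} {τ : Finset (ProperFlat M)} (h : H ∉ τ) :
    mulX H w τ = w (insert H τ) := by
  simp [mulX, h]

theorem eq_zero_of_subset (hw : w ∈ balancedWeights M) {σ τ : Finset (ProperFlat M)}
    (hs : σ ⊆ τ) (h : ¬ IsFlag σ) : w τ = 0 :=
  hw.1 τ fun hτ => h (hτ.subset hs)

theorem eq_zero_of_incomparable (hw : w ∈ balancedWeights M) {τ : Finset (ProperFlat M)}
    {F G : ProperFlat M} (hF : F ∈ τ) (hG : G ∈ τ) (h1 : ¬ F ≤ G) (h2 : ¬ G ≤ F) : w τ = 0 :=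
  hw.1 τ fun hτ => (hτ.le_or_le hF hG).elim h1 h2

theorem eq_zero_of_cross (hw : w ∈ balancedWeights M) {τ : Finset (ProperFlat M)}
    {F G : ProperFlat M} (hF : F ∈ τ) (hG : G ∈ τ) {p q : Fin (n + 1)} (hp : p ∈ F.1)
    (hp' : p ∉ G.1) (hq : q ∈ G.1) (hq' : q ∉ F.1) : w τ = 0 :=
  eq_zero_of_incomparable hw hF hG (fun h => hp' (h hp)) fun h => hq' (h hq)

theorem cutSum_eq_zero_of_not_isFlag (hw : w ∈ balancedWeights M) {τ : Finset (ProperFlat M)}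
    (h : ¬ IsFlag τ) (p q : Fin (n + 1)) : cutSum p q w τ = 0 :=
  sum_eq_zero fun J _ => eq_zero_of_subset hw (subset_insert J τ) h

theorem starSum_eq_zero_of_not_isFlag (hw : w ∈ balancedWeights M) {τ : Finset (ProperFlat M)}
    (h : ¬ IsFlag τ) (p : Fin (n + 1)) : starSum p w τ = 0 :=
  sum_eq_zero fun J _ => eq_zero_of_subset hw (subset_insert J τ) h

/-- The balancing condition, with the flats that contain both elements cancelled. -/
theorem cutSum_comm (hw : w ∈ balancedWeights M) {τ : Finset (ProperFlat M)} {p q : Fin (n + 1)}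
    (h : IsFlag τ → Unseparated τ p q) : cutSum p q w τ = cutSum q p w τ := by
  by_cases hτ : IsFlag τ
  · have h1 := starSum_sub_starSum p q w τ
    rw [hw.2 τ p q (h hτ), sub_self] at h1
    exact (sub_eq_zero.1 h1.symm)
  · rw [cutSum_eq_zero_of_not_isFlag hw hτ, cutSum_eq_zero_of_not_isFlag hw hτ]

/-- Any pair separated by `H` alone computes the action of `x_H`, by the balancing condition. The
sum over the flats containing `q` but not `p` vanishes as these are incomparable to `H`. -/
theorem mulX_of_mem (hw : w ∈ balancedWeights M) {H : ProperFlat M} {τ : Finset (ProperFlat M)}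
    (hH : H ∈ τ) {p q : Fin (n + 1)} (h : IsFlag τ → SeparatedBy τ H p q) :
    mulX H w τ = w τ - cutSum p q w τ := by
  by_cases hτ : IsFlag τ
  · have hpq := h hτ
    have hex : H ∈ τ ∧ ∃ a : Fin (n + 1) × Fin (n + 1), SeparatedBy τ H a.1 a.2 :=
      ⟨hH, (p, q), hpq⟩
    have hcs : cutSum q p w τ = 0 := sum_eq_zero fun J hJ => by
      rw [mem_filter] at hJ
      exact eq_zero_of_cross hw (mem_insert_of_mem hH) (mem_insert_self J τ) hpq.1 hJ.2.2 hJ.2.1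
        hpq.2.1
    have h1 := starSum_sub_starSum p q w τ
    have h2 := hex.2.choose_spec.unseparated hτ hH hpq
    rw [mulX, dif_pos hex, hw.2 _ _ _ h2.1, hw.2 _ _ _ h2.2]
    linarith
  · have h0 : w τ = 0 := hw.1 τ hτ
    rw [cutSum_eq_zero_of_not_isFlag hw hτ, h0, mulX]
    split_ifs
    · simp [h0, starSum_eq_zero_of_not_isFlag hw hτ]
    · simpa using eq_zero_of_subset hw (subset_insert H τ) hτ

theorem mulX_eq_zero_of_not_isFlag (hw : w ∈ balancedWeights M) {H : ProperFlat M}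
    {τ : Finset (ProperFlat M)} (hτ : ¬ IsFlag τ) : mulX H w τ = 0 := by
  by_cases hH : H ∈ τ
  · rw [mulX_of_mem (p := 0) (q := 0) hw hH (fun h => absurd h hτ), hw.1 τ hτ,
      cutSum_eq_zero_of_not_isFlag hw hτ, sub_zero]
  · rw [mulX_of_notMem hH]
    exact eq_zero_of_subset hw (subset_insert H τ) hτ

end weights

/-! ### The action of the variables on weights -/

section weights

variable {w : Finset (ProperFlat M) → ℤ}

/-- Away from `H`, the balancing condition of `x_H · w` at `τ` is that of `w` at `τ ∪ {H}`. -/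
theorem cutSum_mulX_of_notMem (hw : w ∈ balancedWeights M) {H : ProperFlat M}
    {τ : Finset (ProperFlat M)} (hH : H ∉ τ) {p q : Fin (n + 1)} (h : Unseparated τ p q) :
    cutSum p q (mulX H w) τ = cutSum q p (mulX H w) τ := by
  have hne : ∀ a b : Fin (n + 1), ¬ (a ∈ H.1 ∧ b ∉ H.1) →
      cutSum a b (mulX H w) τ = cutSum a b w (insert H τ) := by
    intro a b hab
    refine sum_congr rfl fun J hJ => ?_
    rw [mem_filter] at hJ
    have hJH : H ∉ insert J τ := by
      rw [mem_insert]
      rintro (rfl | h1)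
      · exact hab hJ.2
      · exact hH h1
    rw [mulX_of_notMem hJH, insert_comm]
  have hsep : ∀ a b : Fin (n + 1), Unseparated τ a b → a ∈ H.1 → b ∉ H.1 →
      cutSum a b (mulX H w) τ = cutSum b a (mulX H w) τ := by
    intro a b hab ha hb
    have h1 : cutSum b a w (insert H τ) = 0 := sum_eq_zero fun J hJ => by
      rw [mem_filter] at hJ
      exact eq_zero_of_cross hw (mem_insert_of_mem (mem_insert_self H τ)) (mem_insert_self J _)
        ha hJ.2.2 hJ.2.1 hb
    rw [hne b a (fun h => hb h.1), h1]
    have hHmem : H ∈ univ.filter (fun J : ProperFlat M => a ∈ J.1 ∧ b ∉ J.1) := by simp [ha, hb]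
    have h2 : SeparatedBy (insert H τ) H a b :=
      ⟨ha, hb, fun J hJ hne => hab J (mem_of_mem_insert_of_ne hJ hne)⟩
    have h3 : cutSum a b w (insert H τ) = w (insert H τ) +
        ∑ J ∈ (univ.filter (fun J : ProperFlat M => a ∈ J.1 ∧ b ∉ J.1)).erase H,
          w (insert J (insert H τ)) := by
      rw [cutSum, ← add_sum_erase _ _ hHmem, insert_idem]
    rw [cutSum, ← add_sum_erase _ _ hHmem, mulX_of_mem hw (mem_insert_self H τ) (fun _ => h2), h3]
    have h4 : ∀ J ∈ (univ.filter (fun J : ProperFlat M => a ∈ J.1 ∧ b ∉ J.1)).erase H,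
        mulX H w (insert J τ) = w (insert J (insert H τ)) := by
      intro J hJ
      have hJH : H ∉ insert J τ := by
        rw [mem_insert]
        rintro (rfl | h1)
        · simp at hJ
        · exact hH h1
      rw [mulX_of_notMem hJH, insert_comm]
    rw [sum_congr rfl h4]
    ring
  by_cases hp : p ∈ H.1 <;> by_cases hq : q ∈ H.1
  · rw [hne p q (by tauto), hne q p (by tauto)]
    exact cutSum_comm hw fun _ J hJ => by
      rcases mem_insert.1 hJ with rfl | h1
      · tauto
      · exact h J h1
  · exact hsep p q h hp hq
  · exact (hsep q p h.symm hq hp).symm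
  · rw [hne p q (by tauto), hne q p (by tauto)]
    exact cutSum_comm hw fun _ J hJ => by
      rcases mem_insert.1 hJ with rfl | h1
      · tauto
      · exact h J h1

/-- If a fixed pair `a, b` is separated by `H` alone in every flag that occurs in the sum, the
balancing sum of `x_H · w` is a double sum of values of `w`. -/
theorem cutSum_mulX_of_forall (hw : w ∈ balancedWeights M) {H : ProperFlat M}
    {τ : Finset (ProperFlat M)} (hH : H ∈ τ) {p q a b : Fin (n + 1)}
    (h : ∀ J : ProperFlat M, p ∈ J.1 → q ∉ J.1 → IsFlag (insert J τ) →
      SeparatedBy (insert J τ) H a b) :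
    cutSum p q (mulX H w) τ = cutSum p q w τ -
      ∑ J : ProperFlat M with p ∈ J.1 ∧ q ∉ J.1, ∑ K : ProperFlat M with a ∈ K.1 ∧ b ∉ K.1,
        w (insert J (insert K τ)) := by
  unfold cutSum
  rw [← sum_sub_distrib]
  refine sum_congr rfl fun J hJ => ?_
  rw [mem_filter] at hJ
  rw [mulX_of_mem hw (mem_insert_of_mem hH) (h J hJ.2.1 hJ.2.2), cutSum]
  congr 1
  exact sum_congr rfl fun K _ => by rw [insert_comm]

/-- At a flag containing `H`, the balancing condition of `x_H · w` follows from those of `w` at the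
flags `τ` and `τ ∪ {K}`, once the pair of elements that is used to rewrite `x_H` is adapted to the
pair for which the condition is tested. -/
theorem cutSum_mulX_of_mem (hw : w ∈ balancedWeights M) {H : ProperFlat M}
    {τ : Finset (ProperFlat M)} (hτ : IsFlag τ) (hH : H ∈ τ) {p q : Fin (n + 1)}
    (h : Unseparated τ p q) :
    cutSum p q (mulX H w) τ = cutSum q p (mulX H w) τ := by
  obtain ⟨a, b, hab⟩ := hτ.exists_separatedBy hH
  have h0 : cutSum p q w τ = cutSum q p w τ := cutSum_comm hw fun _ => h
  by_cases hi : SeparatedBy τ H p b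
  · -- `p` and `q` lie in the gap just below `H`
    have key : ∀ s t : Fin (n + 1), Unseparated τ s t → SeparatedBy τ H s b →
        cutSum s t (mulX H w) τ = cutSum s t w τ -
          ∑ K : ProperFlat M with s ∈ K.1 ∧ t ∈ K.1 ∧ b ∉ K.1, cutSum s t w (insert K τ) := by
      intro s t hst hs
      have ht : t ∈ H.1 := (hst H hH).1 hs.1
      rw [cutSum_mulX_of_forall hw hH (a := t) (b := b), sum_comm]
      · congr 1
        symm
        refine sum_subset_zero_on_sdiff (fun K hK => ?_) (fun K hK => ?_) fun K _ => rfl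
        · rw [mem_filter] at hK ⊢
          exact ⟨hK.1, hK.2.2⟩
        · simp only [mem_sdiff, mem_filter, mem_univ, true_and, not_and, not_not] at hK
          refine sum_eq_zero fun J hJ => ?_
          simp only [mem_filter, mem_univ, true_and] at hJ
          have hsK : s ∉ K.1 := fun h1 => hK.1.2 (hK.2 h1 hK.1.1)
          exact eq_zero_of_cross hw (mem_insert_self J _)
            (mem_insert_of_mem (mem_insert_self K τ)) hJ.1 hsK hK.1.1 hJ.2
      · intro J hsJ htJ hJτ
        have hJH : J ≤ H := hJτ.le_of_mem_of_notMem (mem_insert_self J τ)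
          (mem_insert_of_mem hH) ht htJ
        refine ⟨ht, hs.2.1, fun K hK hne => ?_⟩
        rcases mem_insert.1 hK with rfl | hK
        · exact ⟨fun h1 => absurd h1 htJ, fun h1 => absurd (hJH h1) hs.2.1⟩
        · exact (hst K hK).symm.trans (hs.2.2 K hK hne)
    have hi' : SeparatedBy τ H q b :=
      ⟨(h H hH).1 hi.1, hi.2.1, fun K hK hne => (h K hK).symm.trans (hi.2.2 K hK hne)⟩
    rw [key p q h hi, key q p h.symm hi', h0]
    congr 1
    refine sum_congr (by ext K; simp only [mem_filter]; tauto) fun K hK => ?_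
    refine cutSum_comm hw fun _ J hJ => ?_
    simp only [mem_filter, mem_univ, true_and] at hK
    rcases mem_insert.1 hJ with rfl | hJ
    · tauto
    · exact h J hJ
  by_cases hii : SeparatedBy τ H a p
  · -- `p` and `q` lie in the gap just above `H`
    have key : ∀ s t : Fin (n + 1), Unseparated τ s t → SeparatedBy τ H a s →
        cutSum s t (mulX H w) τ = cutSum s t w τ -
          ∑ K : ProperFlat M with s ∉ K.1 ∧ t ∉ K.1 ∧ a ∈ K.1, cutSum s t w (insert K τ) := by
      intro s t hst hs
      have ht : t ∉ H.1 := fun h1 => hs.2.1 ((hst H hH).2 h1)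
      rw [cutSum_mulX_of_forall hw hH (a := a) (b := s), sum_comm]
      · congr 1
        symm
        refine sum_subset_zero_on_sdiff (fun K hK => ?_) (fun K hK => ?_) fun K _ => rfl
        · rw [mem_filter] at hK ⊢
          exact ⟨hK.1, hK.2.2.2, hK.2.1⟩
        · simp only [mem_sdiff, mem_filter, mem_univ, true_and] at hK
          refine sum_eq_zero fun J hJ => ?_
          simp only [mem_filter, mem_univ, true_and] at hJ
          have htK : t ∈ K.1 := by tauto
          exact eq_zero_of_cross hw (mem_insert_self J _)
            (mem_insert_of_mem (mem_insert_self K τ)) hJ.1 hK.1.2 htK hJ.2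
      · intro J hsJ htJ hJτ
        have hJH : H ≤ J := hJτ.le_of_mem_of_notMem (mem_insert_of_mem hH)
          (mem_insert_self J τ) hsJ hs.2.1
        refine ⟨hs.1, hs.2.1, fun K hK hne => ?_⟩
        rcases mem_insert.1 hK with rfl | hK
        · exact ⟨fun _ => hsJ, fun _ => hJH hs.1⟩
        · exact hs.2.2 K hK hne
    have hii' : SeparatedBy τ H a q :=
      ⟨hii.1, fun h1 => hii.2.1 ((h H hH).2 h1), fun K hK hne =>
        (hii.2.2 K hK hne).trans (h K hK)⟩
    rw [key p q h hii, key q p h.symm hii', h0]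
    congr 1
    refine sum_congr (by ext K; simp only [mem_filter]; tauto) fun K hK => ?_
    refine cutSum_comm hw fun _ J hJ => ?_
    simp only [mem_filter, mem_univ, true_and] at hK
    rcases mem_insert.1 hJ with rfl | hJ
    · tauto
    · exact h J hJ
  · -- the gap of `p` and `q` is not adjacent to `H`
    have key : ∀ s t : Fin (n + 1), Unseparated τ s t → ¬ SeparatedBy τ H s b →
        ¬ SeparatedBy τ H a t → ∀ J : ProperFlat M, s ∈ J.1 → t ∉ J.1 → IsFlag (insert J τ) →
        (a ∈ J.1 ↔ b ∈ J.1) := by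
      intro s t hst h1 h2 J hsJ htJ hJτ
      have hJmem : ∀ K ∈ τ, J ≤ K ∨ K ≤ J := fun K hK =>
        hJτ.le_or_le (mem_insert_self J τ) (mem_insert_of_mem hK)
      by_cases haJ : a ∈ J.1
      · refine ⟨fun _ => by_contra fun hbJ => ?_, fun _ => haJ⟩
        rcases hJmem H hH with hle | hle
        · refine h1 ⟨hle hsJ, hab.2.1, fun K hK hne => ?_⟩
          have h3 := hab.2.2 K hK hne
          rcases hτ.le_or_le hK hH with h4 | h4
          · have hbK : b ∉ K.1 := fun h5 => hab.2.1 (h4 h5)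
            refine ⟨fun hsK => absurd hsK fun _ => ?_, fun h5 => absurd h5 hbK⟩
            rcases hJmem K hK with h6 | h6
            · exact hbK (h3.1 (h6 haJ))
            · exact htJ (h6 ((hst K hK).1 hsK))
          · exact ⟨fun _ => h3.1 (h4 hab.1), fun _ => h4 (hle hsJ)⟩
        · refine h2 ⟨hab.1, fun h3 => htJ (hle h3), fun K hK hne => ?_⟩
          have h3 := hab.2.2 K hK hne
          rcases hτ.le_or_le hK hH with h4 | h4
          · exact ⟨fun h5 => absurd (h4 (h3.1 h5)) hab.2.1, fun h5 => absurd (hle (h4 h5)) htJ⟩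
          · have hbK : b ∈ K.1 := h3.1 (h4 hab.1)
            refine ⟨fun _ => ?_, fun _ => h4 hab.1⟩
            rcases hJmem K hK with h6 | h6
            · exact (hst K hK).1 (h6 hsJ)
            · exact absurd (h6 hbK) hbJ
      · refine ⟨fun h3 => absurd h3 haJ, fun h3 => ?_⟩
        rcases hJmem H hH with hle | hle
        · exact absurd (hle h3) hab.2.1
        · exact absurd (hle hab.1) haJ
    have hi' : ¬ SeparatedBy τ H q b := fun h1 =>
      hi ⟨(h H hH).2 h1.1, h1.2.1, fun K hK hne => (h K hK).trans (h1.2.2 K hK hne)⟩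
    have hii' : ¬ SeparatedBy τ H a q := fun h1 =>
      hii ⟨h1.1, fun h2 => h1.2.1 ((h H hH).1 h2), fun K hK hne =>
        (h1.2.2 K hK hne).trans (h K hK).symm⟩
    have key' : ∀ s t : Fin (n + 1), Unseparated τ s t → ¬ SeparatedBy τ H s b →
        ¬ SeparatedBy τ H a t → cutSum s t (mulX H w) τ = cutSum s t w τ -
          ∑ K : ProperFlat M with a ∈ K.1 ∧ b ∉ K.1, cutSum s t w (insert K τ) := by
      intro s t hst h1 h2
      rw [cutSum_mulX_of_forall hw hH (a := a) (b := b), sum_comm]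
      · rfl
      · intro J hsJ htJ hJτ
        refine ⟨hab.1, hab.2.1, fun K hK hne => ?_⟩
        rcases mem_insert.1 hK with rfl | hK
        · exact key s t hst h1 h2 K hsJ htJ hJτ
        · exact hab.2.2 K hK hne
    rw [key' p q h hi hii', key' q p h.symm hi' hii, h0]
    congr 1
    refine sum_congr rfl fun K hK => cutSum_comm hw fun hKτ J hJ => ?_
    simp only [mem_filter, mem_univ, true_and] at hK
    rcases mem_insert.1 hJ with rfl | hJ
    · by_contra hcon
      by_cases hpJ : p ∈ J.1
      · have := key p q h hi hii' J hpJ (by tauto) hKτ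
        tauto
      · have := key q p h.symm hi' hii J (by tauto) hpJ hKτ
        tauto
    · exact h J hJ

theorem mulX_mem (hw : w ∈ balancedWeights M) (H : ProperFlat M) :
    mulX H w ∈ balancedWeights M := by
  refine ⟨fun τ hτ => mulX_eq_zero_of_not_isFlag hw hτ, fun τ p q h => ?_⟩
  rw [← sub_eq_zero, starSum_sub_starSum, sub_eq_zero]
  by_cases hτ : IsFlag τ
  · by_cases hH : H ∈ τ
    · exact cutSum_mulX_of_mem hw hτ hH h
    · exact cutSum_mulX_of_notMem hw hH h
  · have h0 : ∀ a b, cutSum a b (mulX H w) τ = 0 := fun a b =>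
      sum_eq_zero fun J _ => mulX_eq_zero_of_not_isFlag hw
        fun h1 => hτ (h1.subset (subset_insert _ _))
    rw [h0, h0]

theorem mulX_mulX_eq_zero (hw : w ∈ balancedWeights M) {H K : ProperFlat M} (h1 : ¬ H ≤ K)
    (h2 : ¬ K ≤ H) : mulX H (mulX K w) = 0 := by
  have hz : ∀ σ, H ∈ σ → mulX K w σ = 0 := by
    intro σ hσ
    by_cases hK : K ∈ σ
    · exact mulX_eq_zero_of_not_isFlag hw fun h => (h.le_or_le hσ hK).elim h1 h2
    · rw [mulX_of_notMem hK]
      exact eq_zero_of_incomparable hw (mem_insert_of_mem hσ) (mem_insert_self K σ) h1 h2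
  funext τ
  by_cases hτ : IsFlag τ
  · by_cases hH : H ∈ τ
    · obtain ⟨a, b, hab⟩ := hτ.exists_separatedBy hH
      rw [mulX_of_mem (mulX_mem hw K) hH fun _ => hab, hz τ hH, cutSum,
        sum_eq_zero fun J _ => hz _ (mem_insert_of_mem hH)]
      rfl
    · rw [mulX_of_notMem hH, hz _ (mem_insert_self H τ)]
      rfl
  · exact mulX_eq_zero_of_not_isFlag (mulX_mem hw K) hτ

/-- If only one of the two variables belongs to the flag, a pair adapted to the larger flag
computes both sides. -/
theorem mulX_comm_of_notMem (hw : w ∈ balancedWeights M) {H K : ProperFlat M}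
    {τ : Finset (ProperFlat M)} (hH : H ∈ τ) (hK : K ∉ τ) :
    mulX H (mulX K w) τ = mulX K (mulX H w) τ := by
  rw [mulX_of_notMem hK]
  have hv := mulX_mem hw K
  by_cases hτ : IsFlag (insert K τ)
  · obtain ⟨a, b, hab⟩ := hτ.exists_separatedBy (mem_insert_of_mem hH)
    have hab' : SeparatedBy τ H a b :=
      ⟨hab.1, hab.2.1, fun J hJ => hab.2.2 J (mem_insert_of_mem hJ)⟩
    rw [mulX_of_mem hv hH fun _ => hab', mulX_of_mem hw (mem_insert_of_mem hH) fun _ => hab,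
      mulX_of_notMem hK]
    congr 1
    refine sum_congr rfl fun J hJ => ?_
    rw [mem_filter] at hJ
    have hKJ : K ≠ J := by
      rintro rfl
      have := hab.2.2 K (mem_insert_self K τ) (by rintro rfl; exact hK hH)
      tauto
    rw [mulX_of_notMem (by simp [hKJ, hK]), insert_comm]
  · rw [mulX_eq_zero_of_not_isFlag hw hτ]
    have hz : ∀ σ, τ ⊆ σ → mulX K w σ = 0 := by
      intro σ hσ
      by_cases hKσ : K ∈ σ
      · exact mulX_eq_zero_of_not_isFlag hw fun h => hτ (h.subset (insert_subset hKσ hσ))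
      · rw [mulX_of_notMem hKσ]
        exact eq_zero_of_subset hw (insert_subset_insert K hσ) hτ
    by_cases hτ' : IsFlag τ
    · obtain ⟨a, b, hab⟩ := hτ'.exists_separatedBy hH
      rw [mulX_of_mem hv hH fun _ => hab, hz τ subset_rfl, cutSum,
        sum_eq_zero fun J _ => hz _ (subset_insert J τ), sub_zero]
    · exact mulX_eq_zero_of_not_isFlag hv hτ'

/-- For `H < K` in a flag one can choose pairs separated by `H` and by `K` that do not interfere:
if `H` and `K` are neighbours, the pairs share the element between `H` and `K`. -/
theorem IsFlag.exists_separatedBy_pair {τ : Finset (ProperFlat M)} (hτ : IsFlag τ)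
    {H K : ProperFlat M} (hH : H ∈ τ) (hK : K ∈ τ) (hlt : H < K) :
    ∃ a b b' c, SeparatedBy τ H a b ∧ SeparatedBy τ K b' c ∧ ∀ J, IsFlag (insert J τ) →
      (a ∈ J.1 → b ∉ J.1 → SeparatedBy (insert J τ) K b' c) ∧
      (b' ∈ J.1 → c ∉ J.1 → SeparatedBy (insert J τ) H a b) := by
  obtain ⟨a, b, ha⟩ := hτ.exists_separatedBy hH
  obtain ⟨b', c, hb'⟩ := hτ.exists_separatedBy hK
  have hHK : H ≤ K := hlt.le
  have hb'H : b' ∉ H.1 := fun h => hb'.2.1 (hHK ((hb'.2.2 H hH hlt.ne).1 h))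
  have hcmp : ∀ {J}, IsFlag (insert J τ) → ∀ N ∈ τ, J ≤ N ∨ N ≤ J := fun hJ N hN =>
    hJ.le_or_le (mem_insert_self _ τ) (mem_insert_of_mem hN)
  by_cases hN : ∃ N ∈ τ, H < N ∧ N < K
  · obtain ⟨N, hN, hHN, hNK⟩ := hN
    have hbN : b ∈ N.1 := (ha.2.2 N hN hHN.ne').1 (hHN.le ha.1)
    have hb'N : b' ∉ N.1 := fun h => hb'.2.1 (hNK.le ((hb'.2.2 N hN hNK.ne).1 h))
    refine ⟨a, b, b', c, ha, hb', fun J hJ => ⟨fun haJ hbJ => ?_, fun hb'J hcJ => ?_⟩⟩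
    · have hJN : J ≤ N := (hcmp hJ N hN).resolve_right fun h => hbJ (h hbN)
      refine ⟨hb'.1, hb'.2.1, fun L hL hne => ?_⟩
      rcases mem_insert.1 hL with rfl | hL
      · exact ⟨fun h => absurd (hJN h) hb'N, fun h => absurd (hNK.le (hJN h)) hb'.2.1⟩
      · exact hb'.2.2 L hL hne
    · have hJN : N ≤ J := (hcmp hJ N hN).resolve_left fun h => hb'N (h hb'J)
      refine ⟨ha.1, ha.2.1, fun L hL hne => ?_⟩
      rcases mem_insert.1 hL with rfl | hL
      · exact ⟨fun _ => hJN hbN, fun _ => hJN (hHN.le ha.1)⟩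
      · exact ha.2.2 L hL hne
  · have hab' : SeparatedBy τ H a b' := by
      refine ⟨ha.1, hb'H, fun J hJ hne => ?_⟩
      rcases hτ.le_or_le hJ hH with h1 | h1
      · exact ⟨fun h => absurd (h1 ((ha.2.2 J hJ hne).1 h)) ha.2.1, fun h => absurd (h1 h) hb'H⟩
      · refine ⟨fun _ => ?_, fun _ => h1 ha.1⟩
        rcases hτ.le_or_le hK hJ with h2 | h2
        · exact h2 hb'.1
        · by_cases hJK : J = K
          · rw [hJK]; exact hb'.1
          · exact absurd ⟨J, hJ, lt_of_le_of_ne h1 (Ne.symm hne), lt_of_le_of_ne h2 hJK⟩ hN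
    refine ⟨a, b', b', c, hab', hb', fun J hJ => ⟨fun haJ hbJ => ?_, fun hb'J hcJ => ?_⟩⟩
    · have hJK : J ≤ K := (hcmp hJ K hK).resolve_right fun h => hbJ (h hb'.1)
      refine ⟨hb'.1, hb'.2.1, fun L hL hne => ?_⟩
      rcases mem_insert.1 hL with rfl | hL
      · exact ⟨fun h => absurd h hbJ, fun h => absurd (hJK h) hb'.2.1⟩
      · exact hb'.2.2 L hL hne
    · have hJH : H ≤ J := (hcmp hJ H hH).resolve_left fun h => hb'H (h hb'J)
      refine ⟨ha.1, hb'H, fun L hL hne => ?_⟩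
      rcases mem_insert.1 hL with rfl | hL
      · exact ⟨fun _ => hb'J, fun _ => hJH ha.1⟩
      · exact hab'.2.2 L hL hne

/-- For pairs that do not interfere, both orders give the same symmetric expression in `w`. -/
theorem mulX_comm_of_lt (hw : w ∈ balancedWeights M) {H K : ProperFlat M}
    {τ : Finset (ProperFlat M)} (hτ : IsFlag τ) (hH : H ∈ τ) (hK : K ∈ τ) (hlt : H < K) :
    mulX H (mulX K w) τ = mulX K (mulX H w) τ := by
  obtain ⟨a, b, b', c, hab, hbc, h⟩ := hτ.exists_separatedBy_pair hH hK hlt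
  rw [mulX_of_mem (mulX_mem hw K) hH fun _ => hab, mulX_of_mem (mulX_mem hw H) hK fun _ => hbc,
    mulX_of_mem hw hK fun _ => hbc, mulX_of_mem hw hH fun _ => hab,
    cutSum_mulX_of_forall hw hK fun J h1 h2 h3 => (h J h3).1 h1 h2,
    cutSum_mulX_of_forall hw hH fun J h1 h2 h3 => (h J h3).2 h1 h2, sum_comm]
  simp only [insert_comm]
  ring

theorem mulX_comm (hw : w ∈ balancedWeights M) (H K : ProperFlat M) :
    mulX H (mulX K w) = mulX K (mulX H w) := by
  funext τ
  by_cases hHK : H = K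
  · rw [hHK]
  by_cases hτ : IsFlag τ
  · by_cases hH : H ∈ τ <;> by_cases hK : K ∈ τ
    · rcases hτ.le_or_le hH hK with h | h
      · exact mulX_comm_of_lt hw hτ hH hK (lt_of_le_of_ne h hHK)
      · exact (mulX_comm_of_lt hw hτ hK hH (lt_of_le_of_ne h (Ne.symm hHK))).symm
    · exact mulX_comm_of_notMem hw hH hK
    · exact (mulX_comm_of_notMem hw hK hH).symm
    · rw [mulX_of_notMem hH, mulX_of_notMem hK, mulX_of_notMem (by simp [hK, Ne.symm hHK]),
        mulX_of_notMem (by simp [hH, hHK]), insert_comm]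
  · rw [mulX_eq_zero_of_not_isFlag (mulX_mem hw K) hτ,
      mulX_eq_zero_of_not_isFlag (mulX_mem hw H) hτ]

theorem sum_mulX_eq_of_unseparated (hw : w ∈ balancedWeights M) {τ : Finset (ProperFlat M)}
    {p q : Fin (n + 1)} (h : Unseparated τ p q) :
    ∑ H : ProperFlat M with p ∈ H.1, mulX H w τ = ∑ H : ProperFlat M with q ∈ H.1, mulX H w τ := by
  have key : ∀ s t, Unseparated τ s t →
      ∑ H : ProperFlat M with s ∈ H.1 ∧ t ∉ H.1, mulX H w τ = cutSum s t w τ := by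
    intro s t hst
    refine sum_congr rfl fun H hH => mulX_of_notMem fun h1 => ?_
    rw [mem_filter] at hH
    have := hst H h1
    tauto
  rw [← sub_eq_zero, sum_mem_sub_sum_mem, key p q h, key q p h.symm, cutSum_comm hw fun _ => h,
    sub_self]

/-- The linear relation for a pair separated by one member `K` of the flag: the term of `x_K` is
defined so as to cancel all others. -/
theorem sum_mulX_eq_of_separatedBy (hw : w ∈ balancedWeights M) {τ : Finset (ProperFlat M)}
    {K : ProperFlat M} (hK : K ∈ τ) {p q : Fin (n + 1)} (h : SeparatedBy τ K p q) :
    ∑ H : ProperFlat M with p ∈ H.1, mulX H w τ = ∑ H : ProperFlat M with q ∈ H.1, mulX H w τ := by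
  rw [← sub_eq_zero, sum_mem_sub_sum_mem, sub_eq_zero]
  have h1 : ∑ H : ProperFlat M with q ∈ H.1 ∧ p ∉ H.1, mulX H w τ = 0 := by
    refine sum_eq_zero fun H hH => ?_
    simp only [mem_filter, mem_univ, true_and] at hH
    have hHK : H ≠ K := by rintro rfl; exact hH.2 h.1
    have hHτ : H ∉ τ := fun h2 => by
      have := h.2.2 H h2 hHK
      tauto
    rw [mulX_of_notMem hHτ]
    exact eq_zero_of_cross hw (mem_insert_of_mem hK) (mem_insert_self H τ) h.1 hH.2 hH.1 h.2.1
  have hKmem : K ∈ univ.filter (fun H : ProperFlat M => p ∈ H.1 ∧ q ∉ H.1) := by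
    simp [h.1, h.2.1]
  rw [h1, ← add_sum_erase _ _ hKmem, mulX_of_mem hw hK fun _ => h, cutSum,
    ← add_sum_erase _ _ hKmem, insert_eq_of_mem hK, sub_add_eq_sub_sub, sub_self, zero_sub,
    neg_add_eq_zero]
  refine sum_congr rfl fun H hH => ?_
  simp only [mem_erase, mem_filter, mem_univ, true_and] at hH
  rw [mulX_of_notMem]
  intro h2
  have := h.2.2 H h2 hH.1
  tauto

/-- The linear relations hold for the action of the variables on weights. The element `p` is moved
across one member of the flag at a time. -/
theorem sum_mulX_eq (hw : w ∈ balancedWeights M) (τ : Finset (ProperFlat M))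
    (p q : Fin (n + 1)) :
    ∑ H : ProperFlat M with p ∈ H.1, mulX H w τ = ∑ H : ProperFlat M with q ∈ H.1, mulX H w τ := by
  by_cases hτ : IsFlag τ
  swap
  · rw [sum_eq_zero fun H _ => mulX_eq_zero_of_not_isFlag hw hτ,
      sum_eq_zero fun H _ => mulX_eq_zero_of_not_isFlag hw hτ]
  -- an element of the last gap
  obtain ⟨z, hz⟩ : ∃ z, ∀ J ∈ τ, z ∉ J.1 := by
    rcases hτ.exists_max (fun _ => True) with h | ⟨F, hF, -, hmax⟩
    · exact ⟨0, fun J hJ => absurd trivial (h J hJ)⟩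
    · obtain ⟨z, hz⟩ : ∃ z, z ∉ F.1 := by
        by_contra hcon
        push Not at hcon
        exact F.2.2.2 (eq_univ_iff_forall.2 hcon)
      exact ⟨z, fun J hJ h => hz (hmax J hJ trivial h)⟩
  have key : ∀ k, ∀ p : Fin (n + 1), #{J ∈ τ | p ∈ J.1} = k →
      ∑ H : ProperFlat M with p ∈ H.1, mulX H w τ =
        ∑ H : ProperFlat M with z ∈ H.1, mulX H w τ := by
    intro k
    induction k with
    | zero =>
      intro p hp
      rw [card_eq_zero, filter_eq_empty_iff] at hp
      refine sum_mulX_eq_of_unseparated hw fun J hJ => ?_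
      have := hp hJ
      have := hz J hJ
      tauto
    | succ k ih =>
      intro p hp
      rcases hτ.exists_min (fun J => p ∈ J.1) with h | ⟨K, hK, hpK, hmin⟩
      · rw [filter_eq_empty_iff.2 fun J hJ => h J hJ] at hp
        simp at hp
      obtain ⟨p', q', h'⟩ := hτ.exists_separatedBy hK
      have hpq : SeparatedBy τ K p q' := by
        refine ⟨hpK, h'.2.1, fun J hJ hne => ?_⟩
        have h1 := h'.2.2 J hJ hne
        rcases hτ.le_or_le hJ hK with h2 | h2
        · refine ⟨fun h3 => absurd (le_antisymm h2 (hmin J hJ h3)) hne, fun h3 => ?_⟩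
          exact absurd (h2 h3) h'.2.1
        · exact ⟨fun _ => h1.1 (h2 h'.1), fun _ => h2 hpK⟩
      rw [sum_mulX_eq_of_separatedBy hw hK hpq]
      apply ih
      have h3 : {J ∈ τ | q' ∈ J.1} = ({J ∈ τ | p ∈ J.1}).erase K := by
        ext J
        simp only [mem_filter, mem_erase]
        constructor
        · rintro ⟨hJ, hq'⟩
          have hne : J ≠ K := by rintro rfl; exact hpq.2.1 hq'
          exact ⟨hne, hJ, (hpq.2.2 J hJ hne).2 hq'⟩
        · rintro ⟨hne, hJ, hpJ⟩
          exact ⟨hJ, (hpq.2.2 J hJ hne).1 hpJ⟩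
      rw [h3, card_erase_of_mem (by simp [hK, hpK]), hp]
      rfl
  rw [key _ p rfl, key _ q rfl]

end weights

/-! ### The action of the Chow ring and the top weight -/

section operators

open scoped IsMulCommutative


/-- The action of `x_H` on balanced weights. -/
def mulXEnd (H : ProperFlat M) : Module.End ℤ (balancedWeights M) where
  toFun w := ⟨mulX H w, mulX_mem w.2 H⟩
  map_add' v w := by
    apply Subtype.ext
    funext τ
    simp only [mulX, starSum, Submodule.coe_add, Pi.add_apply, sum_add_distrib]
    split_ifs <;> ring
  map_smul' c w := by
    apply Subtype.ext
    funext τ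
    simp only [mulX, starSum, Submodule.coe_smul, Pi.smul_apply, ← smul_sum, RingHom.id_apply]
    split_ifs
    · simp only [smul_eq_mul]; ring
    · rfl

theorem mulXEnd_comm (H K : ProperFlat M) : mulXEnd H * mulXEnd K = mulXEnd K * mulXEnd H := by
  refine LinearMap.ext fun w => Subtype.ext ?_
  exact mulX_comm w.2 H K

variable (M) in
/-- The commutative ring of operators on balanced weights generated by the variables. -/
abbrev weightOperators : Subalgebra ℤ (Module.End ℤ (balancedWeights M)) :=
  Algebra.adjoin ℤ (Set.range (mulXEnd (M := M)))

instance : IsMulCommutative (weightOperators M) :=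
  Algebra.isMulCommutative_adjoin ℤ (by
    rintro _ ⟨H, rfl⟩ _ ⟨K, rfl⟩
    exact mulXEnd_comm H K)

/-- The action of polynomials in the variables `x_F` on balanced weights. -/
def polyAction : MvPolynomial (ProperFlat M) ℤ →+* weightOperators M :=
  MvPolynomial.eval₂Hom (Int.castRingHom _)
    (fun H => ⟨mulXEnd H, Algebra.subset_adjoin ⟨H, rfl⟩⟩)

theorem coe_polyAction_X (H : ProperFlat M) :
    ((polyAction (MvPolynomial.X H) : weightOperators M) : Module.End ℤ (balancedWeights M)) =
      mulXEnd H := by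
  simp [polyAction]

theorem polyAction_eq_zero (p : MvPolynomial (ProperFlat M) ℤ)
    (hp : p ∈ Ideal.span (chowRelations M)) : polyAction p = 0 := by
  suffices h : Ideal.span (chowRelations M) ≤ RingHom.ker (polyAction (M := M)) from h hp
  rw [Ideal.span_le]
  rintro q (⟨F, G, h1, h2, rfl⟩ | ⟨i, j, rfl⟩)
  · change polyAction _ = 0
    apply Subtype.ext
    rw [map_mul]
    change ((polyAction (MvPolynomial.X F) : weightOperators M) :
        Module.End ℤ (balancedWeights M)) *
      ((polyAction (MvPolynomial.X G) : weightOperators M) : Module.End ℤ (balancedWeights M)) = 0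
    rw [coe_polyAction_X, coe_polyAction_X]
    refine LinearMap.ext fun w => Subtype.ext ?_
    exact mulX_mulX_eq_zero w.2 h1 h2
  · change polyAction _ = 0
    rw [map_sub, sub_eq_zero, map_sum, map_sum]
    apply Subtype.ext
    refine LinearMap.ext fun w => Subtype.ext (funext fun τ => ?_)
    have h : ∀ i : Fin (n + 1), (((∑ F : ProperFlat M with i ∈ F.1,
        polyAction (MvPolynomial.X F) : weightOperators M) :
          Module.End ℤ (balancedWeights M)) w).1 τ =
          ∑ F : ProperFlat M with i ∈ F.1, mulX F w τ := by
      intro i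
      have h1 : ((∑ F : ProperFlat M with i ∈ F.1, polyAction (MvPolynomial.X F) :
          weightOperators M) : Module.End ℤ (balancedWeights M)) =
            ∑ F : ProperFlat M with i ∈ F.1, mulXEnd F := by
        rw [← Subalgebra.val_apply, map_sum]
        exact sum_congr rfl fun F _ => coe_polyAction_X F
      rw [h1, LinearMap.sum_apply, Submodule.coe_sum, Finset.sum_apply]
      rfl
    rw [h, h]
    exact sum_mulX_eq w.2 τ i j

/-- The action of the Chow ring on balanced weights. -/
def chowAction : ChowRing M →+* weightOperators M :=
  Ideal.Quotient.lift _ polyAction polyAction_eq_zero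

theorem coe_chowAction_chowX (H : ProperFlat M) :
    ((chowAction (chowX M H) : weightOperators M) : Module.End ℤ (balancedWeights M)) =
      mulXEnd H := by
  rw [chowAction, chowX, Ideal.Quotient.lift_mk, coe_polyAction_X]

/-- A squarefree monomial acts on weights by the restriction to a star. -/
theorem chowAction_prod_apply (σ : Finset (ProperFlat M)) (w : balancedWeights M)
    (τ : Finset (ProperFlat M)) (h : Disjoint σ τ) :
    (((chowAction (∏ H ∈ σ, chowX M H) : weightOperators M) :
      Module.End ℤ (balancedWeights M)) w).1 τ = w.1 (σ ∪ τ) := by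
  induction σ using Finset.induction_on generalizing τ with
  | empty => simp
  | insert H σ hH ih =>
    rw [disjoint_insert_left] at h
    rw [prod_insert hH, map_mul]
    change (((chowAction (chowX M H) : weightOperators M) :
      Module.End ℤ (balancedWeights M)) (((chowAction (∏ H ∈ σ, chowX M H) : weightOperators M) :
      Module.End ℤ (balancedWeights M)) w)).1 τ = _
    rw [coe_chowAction_chowX]
    change mulX H _ τ = _
    rw [mulX_of_notMem h.1, ih _ (disjoint_insert_right.2 ⟨hH, h.2⟩), insert_union, union_insert]

/-- A balanced weight defines a linear functional on the Chow ring: act on the weight and evaluate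
at the empty flag. -/
def weightFunctional (w : balancedWeights M) : ChowRing M →ₗ[ℤ] ℤ where
  toFun a := (((chowAction a : weightOperators M) : Module.End ℤ (balancedWeights M)) w).1 ∅
  map_add' a b := by simp
  map_smul' c a := by simp

theorem weightFunctional_prod (w : balancedWeights M) (σ : Finset (ProperFlat M)) :
    weightFunctional w (∏ H ∈ σ, chowX M H) = w.1 σ := by
  have := chowAction_prod_apply σ w ∅ (disjoint_empty_right σ)
  rwa [union_empty] at this

open scoped Classical in
/-- The weight with value `1` on the flags of length `r`. -/
def topWeight (r : ℕ) (τ : Finset (ProperFlat M)) : ℤ := if IsFlag τ ∧ #τ = r then 1 else 0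

theorem eRk_lt_eRk_of_isFlat (hE : M.E = Set.univ) {F G : Set (Fin (n + 1))} (hF : M.IsFlat F)
    (h : F ⊂ G) : M.eRk F < M.eRk G := by
  refine lt_of_le_of_ne (M.eRk_mono h.subset) fun heq => h.not_subset ?_
  have h1 : M.IsRkFinite F := M.isRkFinite_of_finite (Set.toFinite F)
  have h2 := h1.closure_eq_closure_of_subset_of_eRk_ge_eRk h.subset heq.ge
  rw [hF.closure] at h2
  rw [h2]
  exact M.subset_closure G (by simp [hE])

/-- The rank is strictly increasing along a flag, with values between `1` and `r`. -/
theorem IsFlag.card_le (hE : M.E = Set.univ) (hL : M.Loopless) {r : ℕ}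
    (hr : M.eRank = ((r + 1 : ℕ) : ℕ∞)) {τ : Finset (ProperFlat M)} (h : IsFlag τ) : #τ ≤ r := by
  let f : ProperFlat M → ℕ := fun F => (M.eRk (F.1 : Set (Fin (n + 1)))).toNat
  have hfin : ∀ F : ProperFlat M, (f F : ℕ∞) = M.eRk (F.1 : Set (Fin (n + 1))) := fun F =>
    ENat.natCast_toNat (M.isRkFinite_of_finite (Set.toFinite _)).eRk_lt_top.ne
  have hlt : ∀ F G : ProperFlat M, F < G → f F < f G := by
    intro F G hFG
    have := eRk_lt_eRk_of_isFlat hE F.2.1 (G := (G.1 : Set (Fin (n + 1)))) (by exact_mod_cast hFG)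
    rw [← hfin, ← hfin] at this
    exact_mod_cast this
  have hmaps : ∀ F ∈ τ, f F ∈ Icc 1 r := by
    intro F _
    rw [mem_Icc]
    constructor
    · obtain ⟨p, hp⟩ := F.2.2.1
      have h1 := M.eRk_mono (show ({p} : Set (Fin (n + 1))) ⊆ F.1 by simpa using hp)
      rw [Matroid.eRk_singleton_eq (by simp [hE]), ← hfin] at h1
      exact_mod_cast h1
    · have h1 : (F.1 : Set (Fin (n + 1))) ⊂ M.E := by
        rw [hE, Set.ssubset_univ_iff]
        exact_mod_cast F.2.2.2
      have h2 := eRk_lt_eRk_of_isFlat hE F.2.1 h1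
      rw [M.eRk_ground, hr, ← hfin] at h2
      exact Nat.lt_succ_iff.1 (by exact_mod_cast h2)
  have hinj : Set.InjOn f τ := by
    intro F hF G hG hfg
    by_contra hne
    rcases h.le_or_le hF hG with h1 | h1
    · exact (hlt F G (lt_of_le_of_ne h1 hne)).ne hfg
    · exact (hlt G F (lt_of_le_of_ne h1 (Ne.symm hne))).ne hfg.symm
  have := card_le_card_of_injOn f hmaps hinj
  simpa using this

theorem IsFlag.insert {τ : Finset (ProperFlat M)} (h : IsFlag τ) {F : ProperFlat M}
    (hF : ∀ G ∈ τ, F ≤ G ∨ G ≤ F) : IsFlag (insert F τ) := by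
  unfold IsFlag
  rw [coe_insert]
  exact IsChain.insert h fun G hG _ => hF G hG

/-- The flat that bounds from below the gap of a flag in which `p` lies. -/
theorem IsFlag.exists_floor (hL : M.Loopless) {τ : Finset (ProperFlat M)} (h : IsFlag τ)
    (p : Fin (n + 1)) : ∃ A : Set (Fin (n + 1)), M.IsFlat A ∧ p ∉ A ∧
      (∀ F ∈ τ, p ∉ F.1 → (F.1 : Set (Fin (n + 1))) ⊆ A) ∧
      (A = ∅ ∨ ∃ F ∈ τ, A = F.1) := by
  rcases h.exists_max (fun F => p ∉ F.1) with h1 | ⟨F, hF, hpF, hmax⟩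
  · have h2 := M.isFlat_closure ∅
    rw [← Matroid.loops, M.loops_eq_empty] at h2
    exact ⟨∅, h2, by simp, fun F hF hp => absurd hp (h1 F hF), Or.inl rfl⟩
  · exact ⟨F.1, F.2.1, by simpa using hpF, fun G hG hp => by exact_mod_cast hmax G hG hp,
      Or.inr ⟨F, hF, rfl⟩⟩

/-- The balancing condition for the maximal flags: in a gap of rank two the flats partition the
elements. -/
theorem topWeight_mem (hE : M.E = Set.univ) (hL : M.Loopless) {r : ℕ}
    (hr : M.eRank = ((r + 1 : ℕ) : ℕ∞)) : topWeight r ∈ balancedWeights M := by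
  classical
  refine ⟨fun τ hτ => if_neg fun h => hτ h.1, fun τ p q hpq => ?_⟩
  rw [← sub_eq_zero, starSum_sub_starSum, sub_eq_zero]
  -- `P a b` consists of the flats that complete `τ` and contain `a` but not `b`; it has at most one
  -- element, and it is empty exactly when `P b a` is
  let P : Fin (n + 1) → Fin (n + 1) → Finset (ProperFlat M) := fun a b =>
    {J | (a ∈ J.1 ∧ b ∉ J.1) ∧ IsFlag (insert J τ) ∧ #(insert J τ) = r}
  have hsum : ∀ a b, cutSum a b (topWeight r) τ = #(P a b) := by
    intro a b
    simp only [cutSum, topWeight, sum_boole, filter_filter, P]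
  have hmemP : ∀ a b J, J ∈ P a b ↔ (a ∈ J.1 ∧ b ∉ J.1) ∧ IsFlag (insert J τ) ∧
      #(insert J τ) = r := by
    intro a b J
    simp [P]
  have hnot : ∀ a b J, Unseparated τ a b → a ∈ J.1 → b ∉ J.1 → J ∉ τ := by
    intro a b J hab ha hb hJ
    have := hab J hJ
    tauto
  have key : ∀ a b, Unseparated τ a b → #(P a b) ≤ 1 ∧ ((P a b).Nonempty → (P b a).Nonempty) := by
    intro a b hab
    by_cases hτ : IsFlag τ
    swap
    · have : P a b = ∅ := by
        refine eq_empty_of_forall_notMem fun J hJ => hτ ?_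
        exact ((hmemP a b J).1 hJ).2.1.subset (subset_insert J τ)
      simp [this]
    obtain ⟨A, hA, haA, hAτ, hA'⟩ := hτ.exists_floor hL a
    have hbA : b ∉ A := by
      rcases hA' with rfl | ⟨F, hF, rfl⟩
      · simp
      · exact fun h => haA ((hab F hF).2 h)
    have hAF : ∀ F ∈ τ, ∀ c, c ∈ F.1 → c ∉ A → A ⊆ F.1 := by
      intro F hF c hcF hcA
      rcases hA' with rfl | ⟨G, hG, rfl⟩
      · simp
      · exact_mod_cast hτ.le_of_mem_of_notMem hG hF hcF hcA
    -- the flat covering the floor and containing a given element of the gap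
    have hcov : ∀ c d : Fin (n + 1), c ∉ A → (∀ F ∈ τ, c ∉ F.1 → (F.1 : Set (Fin (n + 1))) ⊆ A) →
        d ∉ M.closure (Insert.insert c A) → ∃ K : ProperFlat M,
          (K.1 : Set (Fin (n + 1))) = M.closure (Insert.insert c A) ∧ ∀ G ∈ τ, K ≤ G ∨ G ≤ K := by
      intro c d hcA hcτ hd
      have hsub : Insert.insert c A ⊆ M.closure (Insert.insert c A) :=
        M.subset_closure _ (by simp [hE])
      refine ⟨⟨(M.closure (Insert.insert c A)).toFinset, by simp,
        ⟨c, by simpa using hsub (Set.mem_insert c A)⟩, fun h => hd ?_⟩, by simp, fun G hG => ?_⟩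
      · have : d ∈ (M.closure (Insert.insert c A)).toFinset := by simp [h]
        simpa using this
      · by_cases hcG : c ∈ G.1
        · left
          change (M.closure (Insert.insert c A)).toFinset ⊆ G.1
          rw [Set.toFinset_subset, ← G.2.1.closure]
          refine M.closure_subset_closure (Set.insert_subset (by simpa using hcG) ?_)
          exact hAF G hG c hcG hcA
        · right
          change G.1 ⊆ (M.closure (Insert.insert c A)).toFinset
          rw [Set.subset_toFinset]
          exact (hcτ G hG hcG).trans ((Set.subset_insert c A).trans hsub)
    -- a flat that completes the flag is the cover of the floor, as a smaller one would give a flag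
    -- with more than `r` members
    have hJ : ∀ J ∈ P a b, (J.1 : Set (Fin (n + 1))) = M.closure (Insert.insert a A) := by
      intro J hJ
      obtain ⟨⟨haJ, hbJ⟩, hflag, hcard⟩ := (hmemP a b J).1 hJ
      have hAJ : A ⊆ J.1 := by
        rcases hA' with rfl | ⟨G, hG, rfl⟩
        · simp
        · exact_mod_cast hflag.le_of_mem_of_notMem (mem_insert_of_mem hG) (mem_insert_self J τ)
            haJ haA
      have hclJ : M.closure (Insert.insert a A) ⊆ J.1 := by
        rw [← J.2.1.closure]
        exact M.closure_subset_closure (Set.insert_subset (by simpa using haJ) hAJ)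
      obtain ⟨K, hK, hKτ⟩ := hcov a b haA hAτ fun h => hbJ (hclJ h)
      have haK : a ∈ K.1 := by
        rw [← mem_coe, hK]
        exact M.mem_closure_of_mem' (Set.mem_insert a A) (by simp [hE])
      have hbK : b ∉ K.1 := by
        rw [← mem_coe, hK]
        exact fun h => hbJ (hclJ h)
      have hKJ : K ≤ J := by
        change K.1 ⊆ J.1
        rw [← coe_subset, hK]
        exact hclJ
      by_contra hne
      have hne' : K ≠ J := by rintro rfl; exact hne hK
      have h1 : IsFlag (Insert.insert K (Insert.insert J τ)) := hflag.insert fun G hG => by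
        rcases mem_insert.1 hG with rfl | hG
        · exact Or.inl hKJ
        · exact hKτ G hG
      have h2 := h1.card_le hE hL hr
      rw [card_insert_of_notMem, hcard] at h2
      · omega
      · rw [mem_insert, not_or]
        exact ⟨hne', hnot a b K hab haK hbK⟩
    constructor
    · rw [card_le_one]
      intro J1 h1 J2 h2
      apply Subtype.ext
      rw [← coe_inj, hJ J1 h1, hJ J2 h2]
    -- by exchange, the cover of the floor that contains `b` does not contain `a`
    · rintro ⟨J, hJP⟩
      obtain ⟨⟨haJ, hbJ⟩, hflag, hcard⟩ := (hmemP a b J).1 hJP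
      have hacl : a ∉ M.closure (Insert.insert b A) := by
        intro h
        have h1 := M.closure_exchange (e := a) (f := b) (X := A) ⟨h, by rwa [hA.closure]⟩
        rw [← hJ J hJP] at h1
        exact hbJ h1.1
      obtain ⟨K, hK, hKτ⟩ := hcov b a hbA
        (fun F hF hbF => hAτ F hF fun h => hbF ((hab F hF).1 h)) hacl
      have hbK : b ∈ K.1 := by
        rw [← mem_coe, hK]
        exact M.mem_closure_of_mem' (Set.mem_insert b A) (by simp [hE])
      have haK : a ∉ K.1 := by
        rw [← mem_coe, hK]
        exact hacl
      refine ⟨K, (hmemP b a K).2 ⟨⟨hbK, haK⟩, hτ.insert hKτ, ?_⟩⟩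
      rw [← hcard, card_insert_of_notMem (hnot b a K hab.symm hbK haK),
        card_insert_of_notMem (hnot a b J hab haJ hbJ)]
  rw [hsum, hsum]
  obtain ⟨h1, h2⟩ := key p q hpq
  obtain ⟨h3, h4⟩ := key q p hpq.symm
  congr 1
  rcases (P p q).eq_empty_or_nonempty with h5 | h5
  · rcases (P q p).eq_empty_or_nonempty with h6 | h6
    · rw [h5, h6]
    · have := h4 h6
      simp [h5] at this
  · have h6 := card_pos.2 (h2 h5)
    have h7 := card_pos.2 h5
    omega

end operators

/-! ### Monomials of flags and the degree map -/

theorem chowX_mul_eq_zero {F G : ProperFlat M} (h1 : ¬ F ≤ G) (h2 : ¬ G ≤ F) :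
    chowX M F * chowX M G = 0 := by
  unfold chowX
  rw [← map_mul, Ideal.Quotient.eq_zero_iff_mem]
  exact Ideal.subset_span (Or.inl ⟨F, G, h1, h2, rfl⟩)

theorem sum_chowX_eq (i j : Fin (n + 1)) :
    ∑ F : ProperFlat M with i ∈ F.1, chowX M F = ∑ F : ProperFlat M with j ∈ F.1, chowX M F := by
  unfold chowX
  rw [← sub_eq_zero, ← map_sum, ← map_sum, ← map_sub, Ideal.Quotient.eq_zero_iff_mem]
  exact Ideal.subset_span (Or.inr ⟨i, j, rfl⟩)

theorem sum_cut_chowX_eq (i j : Fin (n + 1)) :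
    ∑ F : ProperFlat M with i ∈ F.1 ∧ j ∉ F.1, chowX M F =
      ∑ F : ProperFlat M with j ∈ F.1 ∧ i ∉ F.1, chowX M F := by
  rw [← sub_eq_zero, ← sum_mem_sub_sum_mem, sum_chowX_eq i j, sub_self]

theorem prod_chowX_eq_zero {σ : Finset (ProperFlat M)} (h : ¬ IsFlag σ) :
    ∏ F ∈ σ, chowX M F = 0 := by
  classical
  unfold IsFlag IsChain Set.Pairwise at h
  push Not at h
  obtain ⟨F, hF, G, hG, hne, h1, h2⟩ := h
  rw [← mul_prod_erase _ _ (mem_coe.1 hF),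
    ← mul_prod_erase _ _ (mem_erase.2 ⟨hne.symm, mem_coe.1 hG⟩), ← mul_assoc,
    chowX_mul_eq_zero h1 h2, zero_mul]

variable (M) in
/-- The span of the squarefree monomials of degree `k` supported on flags. -/
def flagSpan (k : ℕ) : Submodule ℤ (ChowRing M) :=
  Submodule.span ℤ {a | ∃ σ : Finset (ProperFlat M), IsFlag σ ∧ #σ = k ∧ a = ∏ F ∈ σ, chowX M F}

theorem prod_mem_flagSpan {σ : Finset (ProperFlat M)} :
    ∏ F ∈ σ, chowX M F ∈ flagSpan M #σ := by
  by_cases h : IsFlag σ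
  · exact Submodule.subset_span ⟨σ, h, rfl, rfl⟩
  · rw [prod_chowX_eq_zero h]
    exact Submodule.zero_mem _

/-- If `x_H` already occurs in the monomial, it is replaced by means of the linear relation of a
pair that is separated by `H` alone. -/
theorem chowX_mul_prod_mem (H : ProperFlat M) {σ : Finset (ProperFlat M)} (hσ : IsFlag σ) :
    chowX M H * ∏ F ∈ σ, chowX M F ∈ flagSpan M (#σ + 1) := by
  by_cases hH : H ∈ σ
  swap
  · rw [← prod_insert hH, ← card_insert_of_notMem hH]
    exact prod_mem_flagSpan
  obtain ⟨p, q, hpq⟩ := hσ.exists_separatedBy hH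
  have hHmem : H ∈ univ.filter (fun J : ProperFlat M => p ∈ J.1 ∧ q ∉ J.1) := by
    simp [hpq.1, hpq.2.1]
  have h := sum_cut_chowX_eq (M := M) p q
  rw [← add_sum_erase _ _ hHmem] at h
  rw [eq_sub_of_add_eq h, sub_mul, sum_mul, sum_mul]
  have hnot : ∀ J : ProperFlat M, J ≠ H → ¬ (p ∈ J.1 ↔ q ∈ J.1) → J ∉ σ :=
    fun J hne h hJ => h (hpq.2.2 J hJ hne)
  refine Submodule.sub_mem _ (Submodule.sum_mem _ fun J hJ => ?_)
    (Submodule.sum_mem _ fun J hJ => ?_)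
  · simp only [mem_filter, mem_univ, true_and] at hJ
    have hJσ : J ∉ σ := hnot J (by rintro rfl; exact hJ.2 hpq.1) (by tauto)
    rw [← prod_insert hJσ, ← card_insert_of_notMem hJσ]
    exact prod_mem_flagSpan
  · simp only [mem_erase, mem_filter, mem_univ, true_and] at hJ
    have hJσ : J ∉ σ := hnot J hJ.1 (by tauto)
    rw [← prod_insert hJσ, ← card_insert_of_notMem hJσ]
    exact prod_mem_flagSpan

theorem chowX_mul_mem_flagSpan (H : ProperFlat M) {k : ℕ} {a : ChowRing M}
    (ha : a ∈ flagSpan M k) : chowX M H * a ∈ flagSpan M (k + 1) := by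
  induction ha using Submodule.span_induction with
  | mem x hx =>
    obtain ⟨σ, hσ, rfl, rfl⟩ := hx
    exact chowX_mul_prod_mem H hσ
  | zero => simp
  | add x y _ _ hx hy => rw [mul_add]; exact Submodule.add_mem _ hx hy
  | smul c x _ hx => rw [mul_smul_comm]; exact Submodule.smul_mem _ c hx

theorem mk_monomial_mem_flagSpan (d : ProperFlat M →₀ ℕ) :
    Ideal.Quotient.mk (Ideal.span (chowRelations M)) (MvPolynomial.monomial d 1) ∈
      flagSpan M d.degree := by
  classical
  generalize hk : d.degree = k
  induction k generalizing d with
  | zero =>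
    rw [Finsupp.degree_eq_zero_iff] at hk
    subst hk
    refine Submodule.subset_span ⟨∅, by simp [IsFlag], rfl, ?_⟩
    simp
  | succ k ih =>
    have hd : d ≠ 0 := by rintro rfl; simp at hk
    obtain ⟨H, hH⟩ := Finsupp.ne_iff.1 hd
    have hd' : d = Finsupp.single H 1 + (d - Finsupp.single H 1) := by
      ext F
      by_cases hF : F = H
      · subst hF
        simp only [Finsupp.coe_zero, Pi.zero_apply, ne_eq] at hH
        simp
        omega
      · simp [Ne.symm hF]
    have hk' : (d - Finsupp.single H 1).degree = k := by
      have := congrArg Finsupp.degree hd'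
      rw [map_add, hk, Finsupp.degree_single] at this
      omega
    rw [hd', show (1 : ℤ) = 1 * 1 by simp, ← MvPolynomial.monomial_mul, map_mul]
    exact chowX_mul_mem_flagSpan H (ih _ hk')

/-- Each graded piece of the Chow ring is spanned by the squarefree monomials of flags. -/
theorem chowGraded_eq_flagSpan (k : ℕ) : chowGraded M k = flagSpan M k := by
  apply le_antisymm
  · rintro _ ⟨p, hp, rfl⟩
    change Ideal.Quotient.mk _ p ∈ _
    rw [p.as_sum, map_sum]
    refine Submodule.sum_mem _ fun d hd => ?_
    have hdeg : d.degree = k := by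
      by_contra hne
      exact MvPolynomial.mem_support_iff.1 hd
        (((MvPolynomial.mem_homogeneousSubmodule _ _).1 hp).coeff_eq_zero hne)
    rw [← mul_one (MvPolynomial.coeff d p), ← smul_eq_mul, ← MvPolynomial.smul_monomial,
      ← hdeg, ← Ideal.Quotient.mkₐ_eq_mk ℤ, map_smul]
    exact Submodule.smul_mem _ _ (mk_monomial_mem_flagSpan d)
  · refine Submodule.span_le.2 ?_
    rintro _ ⟨σ, -, rfl, rfl⟩
    refine ⟨∏ F ∈ σ, MvPolynomial.X F, ?_, ?_⟩
    · have := MvPolynomial.IsHomogeneous.prod (R := ℤ) σ (fun F => MvPolynomial.X F) (fun _ => 1)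
        fun F _ => MvPolynomial.isHomogeneous_X ℤ F
      simpa using this
    · change Ideal.Quotient.mk _ _ = _
      rw [map_prod]
      rfl

theorem mem_iSup_flagSpan (a : ChowRing M) : a ∈ ⨆ k, flagSpan M k := by
  obtain ⟨p, rfl⟩ := Ideal.Quotient.mk_surjective a
  rw [p.as_sum, map_sum]
  refine Submodule.sum_mem _ fun d _ => ?_
  rw [← mul_one (MvPolynomial.coeff d p), ← smul_eq_mul, ← MvPolynomial.smul_monomial,
    ← Ideal.Quotient.mkₐ_eq_mk ℤ, map_smul]
  exact Submodule.smul_mem _ _ (Submodule.mem_iSup_of_mem _ (mk_monomial_mem_flagSpan d))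

theorem chainClass_eq_prod {c : ℕ} (F : FlatChain M c) :
    chainClass F = ∏ H ∈ univ.image F.1, chowX M H := by
  rw [prod_image fun i _ j _ h => F.2.injective h]
  rfl

theorem isFlag_image {c : ℕ} (F : FlatChain M c) : IsFlag (univ.image F.1) := by
  rintro A hA B hB _
  simp only [coe_image, coe_univ, Set.image_univ, Set.mem_range] at hA hB
  obtain ⟨i, rfl⟩ := hA
  obtain ⟨j, rfl⟩ := hB
  exact (le_total i j).imp (fun h => F.2.monotone h) fun h => F.2.monotone h

theorem card_image_flatChain {c : ℕ} (F : FlatChain M c) : #(univ.image F.1) = c := by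
  rw [card_image_of_injective _ F.2.injective, card_univ, Fintype.card_fin]

/-- Flags of `c` flats are the same as chains of length `c`. -/
theorem IsFlag.exists_flatChain {σ : Finset (ProperFlat M)} (h : IsFlag σ) :
    ∃ F : FlatChain M #σ, univ.image F.1 = σ := by
  classical
  let _ : LinearOrder σ :=
    { (inferInstance : PartialOrder σ) with
      le_total := fun a b => h.le_or_le a.2 b.2
      toDecidableLE := Classical.decRel _ }
  let e := monoEquivOfFin σ (Fintype.card_coe σ)
  refine ⟨⟨fun i => (e i).1, fun i j hij => e.strictMono hij⟩, ?_⟩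
  ext G
  simp only [mem_image, mem_univ, true_and]
  constructor
  · rintro ⟨i, rfl⟩
    exact (e i).2
  · intro hG
    exact ⟨e.symm ⟨G, hG⟩, by simp⟩

theorem IsDegreeMap.apply_prod {r : ℕ} {d : ChowRing M →ₗ[ℤ] ℤ} (hd : IsDegreeMap M r d)
    {σ : Finset (ProperFlat M)} (h : IsFlag σ) (hσ : #σ = r) : d (∏ F ∈ σ, chowX M F) = 1 := by
  subst hσ
  obtain ⟨F, hF⟩ := h.exists_flatChain
  rw [← hF, ← chainClass_eq_prod]
  have := hd.2 F
  exact this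

theorem IsDegreeMap.unique {r : ℕ} {d d' : ChowRing M →ₗ[ℤ] ℤ} (hd : IsDegreeMap M r d)
    (hd' : IsDegreeMap M r d') : d = d' := by
  refine LinearMap.ext fun a => ?_
  suffices h : ⨆ k, flagSpan M k ≤ LinearMap.eqLocus d d' from h (mem_iSup_flagSpan a)
  refine iSup_le fun k => Submodule.span_le.2 ?_
  rintro _ ⟨σ, hσ, rfl, rfl⟩
  change d _ = d' _
  by_cases hk : #σ = r
  · rw [hd.apply_prod hσ hk, hd'.apply_prod hσ hk]
  · have hmem : ∏ F ∈ σ, chowX M F ∈ chowGraded M #σ := by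
      rw [chowGraded_eq_flagSpan]
      exact prod_mem_flagSpan
    rw [hd.1 _ hk _ hmem, hd'.1 _ hk _ hmem]

/-- The degree map is the functional of the weight that is `1` on the maximal flags. -/
theorem existsUnique_isDegreeMap (hE : M.E = Set.univ) (hL : M.Loopless) {r : ℕ}
    (hr : M.eRank = ((r + 1 : ℕ) : ℕ∞)) : ∃! d, IsDegreeMap M r d := by
  classical
  refine existsUnique_of_exists_of_unique
    ⟨weightFunctional ⟨topWeight r, topWeight_mem hE hL hr⟩, ?_, ?_⟩ fun _ _ h h' => h.unique h'
  · intro k hk a ha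
    rw [chowGraded_eq_flagSpan] at ha
    suffices h : flagSpan M k ≤ LinearMap.ker
        (weightFunctional ⟨topWeight r, topWeight_mem hE hL hr⟩) from h ha
    refine Submodule.span_le.2 ?_
    rintro _ ⟨σ, -, rfl, rfl⟩
    change weightFunctional _ _ = 0
    rw [weightFunctional_prod]
    exact if_neg fun h => hk h.2
  · intro F
    rw [chainClass_eq_prod, weightFunctional_prod]
    exact if_pos ⟨isFlag_image F, card_image_flatChain F⟩

theorem isDegreeMap_chowDeg (hE : M.E = Set.univ) (hL : M.Loopless) {r : ℕ}
    (hr : M.eRank = ((r + 1 : ℕ) : ℕ∞)) : IsDegreeMap M r (chowDeg M r) := by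
  classical
  have h := (existsUnique_isDegreeMap hE hL hr).exists
  rw [chowDeg, dif_pos h]
  exact h.choose_spec

theorem boolMatroid_ground (n : ℕ) : (boolMatroid n).E = Set.univ := by simp

theorem boolMatroid_loopless (n : ℕ) : (boolMatroid n).Loopless := by
  rw [Matroid.loopless_iff_forall_isNonloop]
  intro e _
  rw [← Matroid.indep_singleton]
  simp

theorem boolMatroid_eRank (n : ℕ) : (boolMatroid n).eRank = ((n + 1 : ℕ) : ℕ∞) := by
  rw [← Matroid.eRk_ground, Matroid.Indep.eRk_eq_encard (by simp), boolMatroid_ground,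
    Set.encard_univ, ENat.card_eq_coe_fintype_card, Fintype.card_fin]

theorem isDegreeMap_boolMatroid (n : ℕ) :
    IsDegreeMap (boolMatroid n) n (chowDeg (boolMatroid n) n) :=
  isDegreeMap_chowDeg (boolMatroid_ground n) (boolMatroid_loopless n) (boolMatroid_eRank n)

/-! ### Permutations and duality for the permutohedral variety -/

/-- A sequence with a strict descent between two positions has a descent between neighbours. -/
theorem exists_adjacent_gt {α : Type*} [LinearOrder α] {f : Fin (n + 1) → α} {i j : Fin (n + 1)}
    (hij : i < j) (h : f j < f i) :
    ∃ m : Fin n, i ≤ m.castSucc ∧ m.succ ≤ j ∧ f m.succ < f m.castSucc := by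
  by_contra hcon
  push Not at hcon
  have key : ∀ k : ℕ, ∀ hk : k < n + 1, i.val ≤ k → k ≤ j.val → f i ≤ f ⟨k, hk⟩ := by
    intro k hk hik
    induction k, hik using Nat.le_induction with
    | base => exact fun _ => le_rfl
    | succ k hik ih =>
      intro hkj
      refine (ih (by omega) (by omega)).trans ?_
      exact hcon ⟨k, by omega⟩ (by simpa [Fin.le_def] using hik) (by simpa [Fin.le_def] using hkj)
  exact absurd (key j.val j.2 (Fin.le_def.1 hij.le) le_rfl) (not_le.2 h)

/-- The set of the first `m + 1` values of a permutation. -/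
def segFlat (u : Equiv.Perm (Fin (n + 1))) (m : Fin n) : ProperFlat (boolMatroid n) :=
  ⟨univ.filter fun e => u.symm e ≤ m.castSucc, boolMatroid_isFlat _, ⟨u 0, by simp⟩, fun h => by
    have h1 : u (Fin.last n) ∈ univ.filter fun e => u.symm e ≤ m.castSucc := by
      rw [h]; simp
    simp only [mem_filter, mem_univ, true_and, Equiv.symm_apply_apply, Fin.last_le_iff] at h1
    exact absurd h1 (Fin.castSucc_lt_last m).ne⟩

@[simp] theorem mem_segFlat {u : Equiv.Perm (Fin (n + 1))} {m : Fin n} {e : Fin (n + 1)} :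
    e ∈ (segFlat u m).1 ↔ u.symm e ≤ m.castSucc := by
  simp [segFlat]

theorem segFlat_strictMono (u : Equiv.Perm (Fin (n + 1))) : StrictMono (segFlat u) := by
  intro m m' h
  refine lt_of_le_of_ne (fun e he => ?_) fun heq => ?_
  · rw [mem_segFlat] at he ⊢
    exact he.trans (Fin.castSucc_le_castSucc_iff.2 h.le)
  · have h1 : u m'.castSucc ∈ (segFlat u m).1 := by rw [heq]; simp
    rw [mem_segFlat, Equiv.symm_apply_apply] at h1
    exact absurd h1 (not_le.2 (Fin.castSucc_lt_castSucc_iff.2 h))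

/-- The descent positions of a permutation. -/
def desSet (u : Equiv.Perm (Fin (n + 1))) : Finset (Fin n) := {m | u m.succ < u m.castSucc}

/-- The flag of initial segments of a permutation that end at a descent. -/
def desFlag (u : Equiv.Perm (Fin (n + 1))) : Finset (ProperFlat (boolMatroid n)) :=
  (desSet u).image (segFlat u)

/-- The flag of initial segments of a permutation that end at an ascent. -/
def ascFlag (u : Equiv.Perm (Fin (n + 1))) : Finset (ProperFlat (boolMatroid n)) :=
  (desSet u)ᶜ.image (segFlat u)

/-- The pairs of elements that a permutation lists in the wrong order. -/
def inversions (u : Equiv.Perm (Fin (n + 1))) : Finset (Fin (n + 1) × Fin (n + 1)) :=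
  {e | e.1 < e.2 ∧ u.symm e.2 < u.symm e.1}

theorem isFlag_image_segFlat (u : Equiv.Perm (Fin (n + 1))) (s : Finset (Fin n)) :
    IsFlag (s.image (segFlat u)) := by
  rintro A hA B hB _
  simp only [coe_image, Set.mem_image] at hA hB
  obtain ⟨i, -, rfl⟩ := hA
  obtain ⟨j, -, rfl⟩ := hB
  exact (le_total i j).imp (fun h => (segFlat_strictMono u).monotone h)
    fun h => (segFlat_strictMono u).monotone h

theorem card_image_segFlat (u : Equiv.Perm (Fin (n + 1))) (s : Finset (Fin n)) :
    #(s.image (segFlat u)) = #s :=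
  card_image_of_injective _ (segFlat_strictMono u).injective

/-- A permutation is determined by its inversions. -/
theorem inversions_injective : Function.Injective (inversions (n := n)) := by
  intro u v h
  have h1 : ∀ e e' : Fin (n + 1), e < e' → (u.symm e' < u.symm e ↔ v.symm e' < v.symm e) := by
    intro e e' he
    have : (e, e') ∈ inversions u ↔ (e, e') ∈ inversions v := by rw [h]
    simpa [inversions, he] using this
  have h2 : StrictMono (fun i => v.symm (u i)) := by
    intro i j hij
    have hne : u i ≠ u j := fun h => hij.ne (u.injective h)
    rcases lt_or_gt_of_ne hne with h3 | h3
    · have h4 := h1 _ _ h3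
      simp only [Equiv.symm_apply_apply] at h4
      have h5 : ¬ v.symm (u j) < v.symm (u i) := fun h6 => absurd (h4.2 h6) (not_lt.2 hij.le)
      exact lt_of_le_of_ne (not_lt.1 h5) fun h6 => hne (v.symm.injective h6)
    · have h4 := h1 _ _ h3
      simp only [Equiv.symm_apply_apply] at h4
      exact h4.1 hij
  have h3 : ∀ i, v.symm (u i) = i := fun i =>
    congrFun ((h2.range_inj strictMono_id).1
      (by rw [Set.range_id]; exact (v.symm.surjective.comp u.surjective).range_eq)) i
  ext1 i
  have := congrArg v (h3 i)
  simpa using this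

theorem chowDeg_prod_desFlag_mul_prod_ascFlag (u : Equiv.Perm (Fin (n + 1))) :
    chowDeg (boolMatroid n) n ((∏ F ∈ desFlag u, chowX (boolMatroid n) F) *
      ∏ F ∈ ascFlag u, chowX (boolMatroid n) F) = 1 := by
  have hinj : ∀ s : Finset (Fin n), Set.InjOn (segFlat u) s := fun s =>
    (segFlat_strictMono u).injective.injOn
  have hd : Disjoint (desFlag u) (ascFlag u) := by
    rw [desFlag, ascFlag, disjoint_image (segFlat_strictMono u).injective]
    exact disjoint_compl_right
  have hu : desFlag u ∪ ascFlag u = univ.image (segFlat u) := by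
    rw [desFlag, ascFlag, ← image_union, union_compl]
  rw [← prod_union hd, hu]
  exact (isDegreeMap_boolMatroid n).apply_prod (isFlag_image_segFlat u univ)
    (by rw [card_image_segFlat, card_univ, Fintype.card_fin])

/-- Between the two entries of an inversion there is a descent. -/
theorem exists_mem_desFlag {u : Equiv.Perm (Fin (n + 1))} {e e' : Fin (n + 1)} (h : e < e')
    (hu : u.symm e' < u.symm e) : ∃ m ∈ desSet u, e' ∈ (segFlat u m).1 ∧ e ∉ (segFlat u m).1 := by
  obtain ⟨m, h1, h2, h3⟩ := exists_adjacent_gt (f := u) hu (by simpa using h)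
  refine ⟨m, by simpa [desSet] using h3, by simpa using h1, ?_⟩
  rw [mem_segFlat, not_le]
  exact lt_of_lt_of_le Fin.castSucc_lt_succ h2

/-- Between two entries in increasing order there is an ascent. -/
theorem exists_mem_ascFlag {u : Equiv.Perm (Fin (n + 1))} {e e' : Fin (n + 1)} (h : e < e')
    (hu : u.symm e < u.symm e') :
    ∃ m ∈ (desSet u)ᶜ, e ∈ (segFlat u m).1 ∧ e' ∉ (segFlat u m).1 := by
  obtain ⟨m, h1, h2, h3⟩ := exists_adjacent_gt (f := fun i => OrderDual.toDual (u i)) hu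
    (by simpa using h)
  refine ⟨m, ?_, by simpa using h1, ?_⟩
  · simp only [desSet, mem_compl, mem_filter, mem_univ, true_and, not_lt]
    exact (OrderDual.toDual_lt_toDual.1 h3).le
  · rw [mem_segFlat, not_le]
    exact lt_of_lt_of_le Fin.castSucc_lt_succ h2

theorem prod_mul_prod_eq_zero {M : Matroid (Fin (n + 1))} {σ τ : Finset (ProperFlat M)}
    {F G : ProperFlat M} (hF : F ∈ σ) (hG : G ∈ τ) (h1 : ¬ F ≤ G) (h2 : ¬ G ≤ F) :
    (∏ H ∈ σ, chowX M H) * ∏ H ∈ τ, chowX M H = 0 := by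
  rw [← mul_prod_erase σ _ hF, ← mul_prod_erase τ _ hG, mul_mul_mul_comm, chowX_mul_eq_zero h1 h2,
    zero_mul]

/-- The descent and ascent monomials pair triangularly: an inversion of `u` that is not an inversion
of `v` is separated in opposite ways by a member of the descent flag of `u` and a member of the
ascent flag of `v`. -/
theorem inversions_subset_of_prod_ne_zero {u v : Equiv.Perm (Fin (n + 1))}
    (h : (∏ F ∈ desFlag u, chowX (boolMatroid n) F) *
      ∏ F ∈ ascFlag v, chowX (boolMatroid n) F ≠ 0) :
    inversions u ⊆ inversions v := by
  rintro ⟨e, e'⟩ he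
  simp only [inversions, mem_filter, mem_univ, true_and] at he ⊢
  refine ⟨he.1, ?_⟩
  by_contra hlt
  have hlt' : v.symm e < v.symm e' :=
    lt_of_le_of_ne (not_lt.1 hlt) fun h1 => he.1.ne (v.symm.injective h1)
  obtain ⟨m, hm, h1, h2⟩ := exists_mem_desFlag he.1 he.2
  obtain ⟨m', hm', h3, h4⟩ := exists_mem_ascFlag he.1 hlt'
  exact h (prod_mul_prod_eq_zero (mem_image_of_mem _ hm) (mem_image_of_mem _ hm')
    (fun h5 => h4 (h5 h1)) fun h5 => h2 (h5 h3))

/-- The full flag obtained by refining a flag, each of whose blocks is sorted increasingly. -/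
theorem IsFlag.exists_perm {τ : Finset (ProperFlat (boolMatroid n))} (hτ : IsFlag τ) :
    ∃ u : Equiv.Perm (Fin (n + 1)), (∀ F ∈ τ, ∃ m, segFlat u m = F) ∧
      ∀ m, segFlat u m ∉ τ → u m.castSucc < u m.succ := by
  -- sort by the number of members of the flag that miss an element, then by the element itself
  let key : Fin (n + 1) → ℕ := fun e => (n + 1) * #{F ∈ τ | e ∉ F.1} + e.val
  have hinj : Function.Injective key := by
    intro e e' h
    have := congrArg (fun k => k % (n + 1)) h
    simp only [key, Nat.mul_add_mod, Nat.mod_eq_of_lt e.2, Nat.mod_eq_of_lt e'.2] at this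
    exact Fin.ext this
  let u := Tuple.sort key
  have hmono : StrictMono (key ∘ u) :=
    (Tuple.monotone_sort key).strictMono_of_injective (hinj.comp u.injective)
  have hpos : ∀ e e', u.symm e < u.symm e' ↔ key e < key e' := by
    intro e e'
    have := hmono.lt_iff_lt (a := u.symm e) (b := u.symm e')
    simpa using this.symm
  have hcount : ∀ e e', #{F ∈ τ | e ∉ F.1} < #{F ∈ τ | e' ∉ F.1} → key e < key e' := by
    intro e e' h
    have h1 : (n + 1) * (#{F ∈ τ | e ∉ F.1} + 1) ≤ (n + 1) * #{F ∈ τ | e' ∉ F.1} :=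
      Nat.mul_le_mul_left _ h
    have := e.2
    simp only [key]
    rw [mul_add] at h1
    omega
  have hF : ∀ F ∈ τ, ∀ e ∈ F.1, ∀ e', e' ∉ F.1 → u.symm e < u.symm e' := by
    intro F hF e he e' he'
    rw [hpos]
    apply hcount
    apply card_lt_card
    refine ⟨fun G hG => ?_, fun h => ?_⟩
    · simp only [mem_filter] at hG ⊢
      exact ⟨hG.1, fun h1 => he' (hτ.le_of_mem_of_notMem hG.1 hF he hG.2 h1)⟩
    · have := h (mem_filter.2 ⟨hF, he'⟩)
      exact (mem_filter.1 this).2 he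
  have hseg : ∀ F ∈ τ, ∃ m, segFlat u m = F := by
    intro F hFτ
    obtain ⟨e0, he0, hmax⟩ := F.1.exists_max_image u.symm F.2.2.1
    obtain ⟨z, hz⟩ : ∃ z, z ∉ F.1 := by
      by_contra hcon
      push Not at hcon
      exact F.2.2.2 (eq_univ_iff_forall.2 hcon)
    have hne : u.symm e0 ≠ Fin.last n := by
      intro h
      have := hF F hFτ e0 he0 z hz
      rw [h] at this
      exact absurd (Fin.le_last _) (not_le.2 this)
    refine ⟨(u.symm e0).castPred hne, Subtype.ext ?_⟩
    ext e
    rw [mem_segFlat, Fin.castSucc_castPred]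
    constructor
    · intro h
      by_contra he
      exact absurd h (not_le.2 (hF F hFτ e0 he0 e he))
    · exact hmax e
  refine ⟨u, hseg, fun m hm => ?_⟩
  by_contra hcon
  have hne : u m.castSucc ≠ u m.succ := fun h => Fin.castSucc_lt_succ.ne (u.injective h)
  have hlt : u m.succ < u m.castSucc := lt_of_le_of_ne (not_lt.1 hcon) hne.symm
  have h1 : key (u m.castSucc) < key (u m.succ) := hmono Fin.castSucc_lt_succ
  have h2 : ¬ #{F ∈ τ | u m.succ ∉ F.1} ≤ #{F ∈ τ | u m.castSucc ∉ F.1} := by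
    intro h3
    have h4 := Nat.mul_le_mul_left (n + 1) h3
    have h5 := Fin.lt_def.1 hlt
    simp only [key] at h1
    omega
  apply h2
  apply card_le_card
  intro F hFm
  simp only [mem_filter] at hFm ⊢
  refine ⟨hFm.1, fun h3 => ?_⟩
  obtain ⟨m', rfl⟩ := hseg F hFm.1
  have h4 := hFm.2
  rw [mem_segFlat, Equiv.symm_apply_apply] at h3 h4
  have h5 : m = m' := by
    apply le_antisymm
    · exact Fin.castSucc_le_castSucc_iff.1 h3
    · rw [not_le] at h4
      exact Fin.castSucc_lt_succ_iff.1 h4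
  exact hm (h5 ▸ hFm.1)

/-- The pairs `e < e'` such that `e'` appears before `e` in a flag. -/
def flagInversions (τ : Finset (ProperFlat (boolMatroid n))) :
    Finset (Fin (n + 1) × Fin (n + 1)) :=
  {e | e.1 < e.2 ∧ ∃ F ∈ τ, e.2 ∈ F.1 ∧ e.1 ∉ F.1}

theorem mem_flagInversions {τ : Finset (ProperFlat (boolMatroid n))} {e e' : Fin (n + 1)} :
    (e, e') ∈ flagInversions τ ↔ e < e' ∧ ∃ F ∈ τ, e' ∈ F.1 ∧ e ∉ F.1 := by
  simp [flagInversions]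

section straightening

variable {τ : Finset (ProperFlat (boolMatroid n))} {u : Equiv.Perm (Fin (n + 1))}

/-- If the blocks of a flag are sorted increasingly, every inversion is caused by a member of the
flag that ends at a descent. -/
theorem exists_mem_of_inversion (hu : ∀ m, segFlat u m ∉ τ → u m.castSucc < u m.succ)
    {e e' : Fin (n + 1)} (h : e < e') (hpos : u.symm e' < u.symm e) :
    ∃ m ∈ desSet u, segFlat u m ∈ τ ∧ e' ∈ (segFlat u m).1 ∧ e ∉ (segFlat u m).1 := by
  obtain ⟨m, hm, h1, h2⟩ := exists_mem_desFlag h hpos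
  refine ⟨m, hm, ?_, h1, h2⟩
  by_contra hcon
  simp only [desSet, mem_filter, mem_univ, true_and] at hm
  exact lt_asymm hm (hu m hcon)

/-- Replacing the member of a flag at an ascent by another set that separates the two neighbouring
elements creates inversions and destroys none. -/
theorem flagInversions_ssubset (hseg : ∀ F ∈ τ, ∃ m, segFlat u m = F)
    (hu : ∀ m, segFlat u m ∉ τ → u m.castSucc < u m.succ) {m : Fin n}
    (hlt : u m.castSucc < u m.succ) {J : ProperFlat (boolMatroid n)} (hne : J ≠ segFlat u m)
    (hJ : ¬ (u m.castSucc ∈ J.1 ↔ u m.succ ∈ J.1))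
    (hflag : IsFlag (insert J (τ.erase (segFlat u m)))) :
    flagInversions τ ⊂ flagInversions (insert J (τ.erase (segFlat u m))) := by
  have hdes : ∀ m' ∈ desSet u, m' ≠ m := by
    rintro m' hm' rfl
    simp only [desSet, mem_filter, mem_univ, true_and] at hm'
    exact lt_asymm hm' hlt
  have hmem : ∀ m' ∈ desSet u, segFlat u m' ∈ τ →
      segFlat u m' ∈ insert J (τ.erase (segFlat u m)) := fun m' hm' h =>
    mem_insert_of_mem (mem_erase.2 ⟨fun h1 =>
      hdes m' hm' ((segFlat_strictMono u).injective h1), h⟩)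
  have hpos : ∀ {e e'}, (e, e') ∈ flagInversions τ → u.symm e' < u.symm e := by
    intro e e' h
    obtain ⟨_, F, hF, h1, h2⟩ := mem_flagInversions.1 h
    obtain ⟨m', rfl⟩ := hseg F hF
    rw [mem_segFlat] at h1 h2
    exact lt_of_le_of_lt h1 (not_le.1 h2)
  have hsub : flagInversions τ ⊆ flagInversions (insert J (τ.erase (segFlat u m))) := by
    rintro ⟨e, e'⟩ h
    have hlt := (mem_flagInversions.1 h).1
    obtain ⟨m', hm', h1, h2, h3⟩ := exists_mem_of_inversion hu hlt (hpos h)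
    exact mem_flagInversions.2 ⟨hlt, _, hmem m' hm' h1, h2, h3⟩
  refine ⟨hsub, fun hsup => ?_⟩
  have hJinv : ∀ e e', e < e' → e' ∈ J.1 → e ∉ J.1 → u.symm e' < u.symm e := fun e e' h h1 h2 =>
    hpos (hsup (mem_flagInversions.2 ⟨h, J, mem_insert_self _ _, h1, h2⟩))
  -- elements before and after the ascent are separated from it by members of the flag
  have hcross : ∀ e e', e < e' → u.symm e' < u.symm e → e' ∉ J.1 → e ∉ J.1 ∨ e' ∈ J.1 := by
    intro e e' h h1 h2
    obtain ⟨m', hm', h3, h4, h5⟩ := exists_mem_of_inversion hu h h1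
    by_contra hcon
    push Not at hcon
    rcases hflag.le_or_le (mem_insert_self J _) (hmem m' hm' h3) with h6 | h6
    · exact h5 (h6 hcon.1)
    · exact hcon.2 (h6 h4)
  by_cases hp : u m.castSucc ∈ J.1
  · have hq : u m.succ ∉ J.1 := by tauto
    apply hne
    apply Subtype.ext
    ext z
    rw [mem_segFlat]
    constructor
    · intro hz
      by_contra hcon
      rw [not_le] at hcon
      have hz1 : m.succ ≤ u.symm z := Fin.le_def.2 (Fin.lt_def.1 hcon)
      have hzq : z ≠ u m.succ := by rintro rfl; exact hq hz
      rcases lt_or_gt_of_ne hzq with h | h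
      · have hlt2 : u.symm (u m.succ) < u.symm z := by
          rw [Equiv.symm_apply_apply]
          exact lt_of_le_of_ne hz1 fun h2 => hzq (by rw [h2]; simp)
        rcases hcross _ _ h hlt2 hq with h3 | h3
        · exact h3 hz
        · exact hq h3
      · have := hJinv _ _ h hz hq
        rw [Equiv.symm_apply_apply] at this
        exact absurd hz1 (not_le.2 this)
    · intro hz
      by_contra hcon
      have hzp : z ≠ u m.castSucc := by rintro rfl; exact hcon hp
      rcases lt_or_gt_of_ne hzp with h | h
      · have := hJinv _ _ h hp hcon
        rw [Equiv.symm_apply_apply] at this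
        exact absurd hz (not_le.2 this)
      · have hlt2 : u.symm z < u.symm (u m.castSucc) := by
          rw [Equiv.symm_apply_apply]
          refine lt_of_le_of_ne hz fun h2 => hzp ?_
          rw [← h2]; simp
        rcases hcross _ _ h hlt2 hcon with h3 | h3
        · exact h3 hp
        · exact hcon h3
  · have hq : u m.succ ∈ J.1 := by tauto
    have := hJinv _ _ hlt hq hp
    simp only [Equiv.symm_apply_apply] at this
    exact lt_asymm this Fin.castSucc_lt_succ

end straightening

variable (n) in
/-- The span of the descent monomials of degree `r`. -/
def desSpan (r : ℕ) : Submodule ℤ (ChowRing (boolMatroid n)) :=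
  Submodule.span ℤ (Set.range fun u : {u : Equiv.Perm (Fin (n + 1)) // #(desSet u) = r} =>
    ∏ F ∈ desFlag u.1, chowX (boolMatroid n) F)

/-- Straightening: the descent monomials span the Chow ring of the permutohedral variety. The
induction is on the number of inversions still missing. -/
theorem prod_mem_desSpan (k : ℕ) : ∀ τ : Finset (ProperFlat (boolMatroid n)),
    Fintype.card (Fin (n + 1) × Fin (n + 1)) - #(flagInversions τ) = k →
      ∏ F ∈ τ, chowX (boolMatroid n) F ∈ desSpan n #τ := by
  induction k using Nat.strong_induction_on with
  | _ k ih =>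
    intro τ hk
    by_cases hτ : IsFlag τ
    swap
    · rw [prod_chowX_eq_zero hτ]
      exact Submodule.zero_mem _
    obtain ⟨u, hseg, hu⟩ := hτ.exists_perm
    by_cases hdes : ∀ m, segFlat u m ∈ τ → m ∈ desSet u
    · have hτu : desFlag u = τ := by
        ext F
        rw [desFlag, mem_image]
        constructor
        · rintro ⟨m, hm, rfl⟩
          by_contra hcon
          simp only [desSet, mem_filter, mem_univ, true_and] at hm
          exact lt_asymm hm (hu m hcon)
        · intro hF
          obtain ⟨m, rfl⟩ := hseg F hF
          exact ⟨m, hdes m hF, rfl⟩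
      have hcard : #(desSet u) = #τ := by rw [← hτu, desFlag, card_image_segFlat]
      refine Submodule.subset_span ⟨⟨u, hcard⟩, ?_⟩
      simp only [hτu]
    · push Not at hdes
      obtain ⟨m, hm, hmd⟩ := hdes
      set p := u m.castSucc with hp
      set q := u m.succ with hq
      have hlt : p < q := by
        simp only [desSet, mem_filter, mem_univ, true_and, not_lt] at hmd
        exact lt_of_le_of_ne hmd fun h => Fin.castSucc_lt_succ.ne (u.injective h)
      have hFp : p ∈ (segFlat u m).1 := by simp [hp]
      have hFq : q ∉ (segFlat u m).1 := by simp [hq]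
      have hunsep : ∀ J ∈ τ.erase (segFlat u m), (p ∈ J.1 ↔ q ∈ J.1) := by
        intro J hJ
        obtain ⟨m', rfl⟩ := hseg J (mem_of_mem_erase hJ)
        have hne : m' ≠ m := by rintro rfl; simp at hJ
        rw [mem_segFlat, mem_segFlat, hp, hq, Equiv.symm_apply_apply, Equiv.symm_apply_apply]
        simp only [Fin.le_def, Fin.val_castSucc, Fin.val_succ]
        have : m'.val ≠ m.val := fun h => hne (Fin.ext h)
        omega
      have hFmem : segFlat u m ∈
          univ.filter (fun J : ProperFlat (boolMatroid n) => p ∈ J.1 ∧ q ∉ J.1) := by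
        simp only [mem_filter, mem_univ, true_and]
        exact ⟨hFp, hFq⟩
      have h := sum_cut_chowX_eq (M := boolMatroid n) p q
      rw [← add_sum_erase _ _ hFmem] at h
      have hterm : ∀ J : ProperFlat (boolMatroid n), J ≠ segFlat u m →
          ¬ (p ∈ J.1 ↔ q ∈ J.1) → chowX (boolMatroid n) J *
            ∏ F ∈ τ.erase (segFlat u m), chowX (boolMatroid n) F ∈ desSpan n #τ := by
        intro J hne hJ
        have hJτ : J ∉ τ.erase (segFlat u m) := fun h1 => hJ (hunsep J h1)
        rw [← prod_insert hJτ]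
        by_cases hflag : IsFlag (insert J (τ.erase (segFlat u m)))
        · have hss := card_lt_card (flagInversions_ssubset hseg hu hlt hne hJ hflag)
          have hle := card_le_univ (flagInversions (insert J (τ.erase (segFlat u m))))
          have hcard : #(insert J (τ.erase (segFlat u m))) = #τ := by
            rw [card_insert_of_notMem hJτ, card_erase_add_one hm]
          have := ih _ (by omega) (insert J (τ.erase (segFlat u m))) rfl
          rwa [hcard] at this
        · rw [prod_chowX_eq_zero hflag]
          exact Submodule.zero_mem _
      rw [← mul_prod_erase _ _ hm, eq_sub_of_add_eq h, sub_mul, sum_mul, sum_mul]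
      refine Submodule.sub_mem _ (Submodule.sum_mem _ fun J hJ => ?_)
        (Submodule.sum_mem _ fun J hJ => ?_)
      · simp only [mem_filter, mem_univ, true_and] at hJ
        exact hterm J (by rintro rfl; exact hJ.2 hFp) (by tauto)
      · simp only [mem_erase, mem_filter, mem_univ, true_and] at hJ
        exact hterm J hJ.1 (by tauto)

/-- Poincaré duality for the permutohedral variety, in the form that a class is determined by its
weight. -/
theorem eq_zero_of_forall_chowDeg_eq_zero {r : ℕ} {a : ChowRing (boolMatroid n)}
    (ha : a ∈ chowGraded (boolMatroid n) r)
    (h : ∀ G : FlatChain (boolMatroid n) (n - r),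
      chowDeg (boolMatroid n) n (a * chainClass G) = 0) : a = 0 := by
  have hspan : a ∈ desSpan n r := by
    rw [chowGraded_eq_flagSpan] at ha
    refine Submodule.span_le.2 ?_ ha
    rintro _ ⟨σ, -, rfl, rfl⟩
    exact prod_mem_desSpan _ σ rfl
  obtain ⟨c, rfl⟩ := (Submodule.mem_span_range_iff_exists_fun ℤ).1 hspan
  suffices hc : ∀ u, c u = 0 by simp [hc]
  by_contra hcon
  push Not at hcon
  -- pair with the ascent monomial of a permutation in the support with the fewest inversions
  obtain ⟨v, hv, hmin⟩ := exists_min_image (univ.filter fun u => c u ≠ 0)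
    (fun u => #(inversions u.1)) (by obtain ⟨u, hu⟩ := hcon; exact ⟨u, by simp [hu]⟩)
  simp only [mem_filter, mem_univ, true_and] at hv hmin
  have hcard : #(ascFlag v.1) = n - r := by
    rw [ascFlag, card_image_segFlat, card_compl, Fintype.card_fin, v.2]
  obtain ⟨G, hG⟩ := (isFlag_image_segFlat v.1 (desSet v.1)ᶜ).exists_flatChain
  have h1 : chowDeg (boolMatroid n) n ((∑ u, c u • ∏ F ∈ desFlag u.1, chowX (boolMatroid n) F) *
      ∏ F ∈ ascFlag v.1, chowX (boolMatroid n) F) = 0 := by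
    change #((desSet v.1)ᶜ.image (segFlat v.1)) = n - r at hcard
    have h2 := chainClass_eq_prod G
    rw [hG] at h2
    rw [ascFlag, ← h2]
    clear h2 hG
    revert G
    rw [hcard]
    exact h
  rw [sum_mul, map_sum, sum_eq_single v] at h1
  · rw [smul_mul_assoc, map_smul, chowDeg_prod_desFlag_mul_prod_ascFlag, smul_eq_mul,
      mul_one] at h1
    exact hv h1
  · intro u _ huv
    rw [smul_mul_assoc, map_smul, smul_eq_mul]
    by_cases hcu : c u = 0
    · rw [hcu, zero_mul]
    · by_contra hne
      have hne' : (∏ F ∈ desFlag u.1, chowX (boolMatroid n) F) *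
          ∏ F ∈ ascFlag v.1, chowX (boolMatroid n) F ≠ 0 := by
        intro h2
        rw [h2, map_zero, mul_zero] at hne
        exact hne rfl
      have h3 := inversions_subset_of_prod_ne_zero hne'
      have h4 := eq_of_subset_of_card_le h3 (hmin u hcu)
      exact huv (Subtype.ext (inversions_injective h4))
  · exact fun h2 => absurd (mem_univ v) h2

/-! ### Sliding sums on a stratum of codimension one -/

/-- The elements of `S` that are less than `t`. -/
def below (S : Finset (Fin (n + 1))) (t : ℕ) : Finset (Fin (n + 1)) := {z ∈ S | z.val < t}

theorem mem_below {S : Finset (Fin (n + 1))} {t : ℕ} {z : Fin (n + 1)} :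
    z ∈ below S t ↔ z ∈ S ∧ z.val < t := by simp [below]

theorem card_below_sdiff_add {A F H : Finset (Fin (n + 1))} (h1 : A ⊆ F) (h2 : F ⊆ H) (t : ℕ) :
    #(below (H \ A) t) = #(below (F \ A) t) + #(below (H \ F) t) := by
  rw [← card_union_of_disjoint]
  · congr 1
    ext z
    simp only [mem_union, mem_below, mem_sdiff]
    have := @h1 z
    have := @h2 z
    tauto
  · rw [disjoint_left]
    intro z hz hz'
    simp only [mem_below, mem_sdiff] at hz hz'
    tauto

/-- A family of ring elements indexed by the subsets of `{0, ..., n}` that satisfies the relations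
of the Chow ring of the permutohedral variety: products of incomparable members vanish and the
linear relations hold. The empty and the full set are comparable to every set and occur in no
linear relation, so the values at them are arbitrary. -/
structure IsChowFamily {R : Type*} [CommRing R] (ξ : Finset (Fin (n + 1)) → R) : Prop where
  mul_eq_zero : ∀ F G, ¬ F ⊆ G → ¬ G ⊆ F → ξ F * ξ G = 0
  sum_eq : ∀ p q, ∑ F with p ∈ F ∧ q ∉ F, ξ F = ∑ F with q ∈ F ∧ p ∉ F, ξ F

section sliding

variable {R : Type*} [CommRing R] (ξ : Finset (Fin (n + 1)) → R) (y : R)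

/-- The elements of `S` below `t` have `0, 1, 2, ...` elements of `S` below them. -/
theorem sum_pow_card_below (S : Finset (Fin (n + 1))) (t : ℕ) :
    ∑ z ∈ below S t, y ^ #(below S z) = ∑ i ∈ range #(below S t), y ^ i := by
  induction t with
  | zero =>
    have : below S 0 = ∅ := by ext z; simp [mem_below]
    simp [this]
  | succ t ih =>
    by_cases h : ∃ z ∈ S, z.val = t
    · obtain ⟨z, hz, rfl⟩ := h
      have h1 : below S (z.val + 1) = insert z (below S z) := by
        ext x
        simp only [mem_below, mem_insert, Nat.lt_succ_iff_lt_or_eq, Fin.val_inj]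
        constructor
        · rintro ⟨h1, h2 | h2⟩
          · exact Or.inr ⟨h1, h2⟩
          · exact Or.inl h2
        · rintro (rfl | h1)
          · exact ⟨hz, Or.inr rfl⟩
          · exact ⟨h1.1, Or.inl h1.2⟩
      have h2 : z ∉ below S z := by simp [mem_below]
      rw [h1, sum_insert h2, card_insert_of_notMem h2, sum_range_succ, ih, add_comm]
    · have h1 : below S (t + 1) = below S t := by
        ext x
        simp only [mem_below, Nat.lt_succ_iff_lt_or_eq]
        push Not at h
        have := h x
        tauto
      rw [h1, ih]

theorem sub_one_mul_sum_pow_card_below (S : Finset (Fin (n + 1))) (t : ℕ) :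
    (y - 1) * ∑ z ∈ below S t, y ^ #(below S z) = y ^ #(below S t) - 1 := by
  rw [sum_pow_card_below, mul_geom_sum]

theorem pow_card_below_sub (S : Finset (Fin (n + 1))) {x t : ℕ} (h : x ≤ t) :
    y ^ #(below S t) - y ^ #(below S x) =
      (y - 1) * ∑ z ∈ below S t with x ≤ z.val, y ^ #(below S z) := by
  have h1 := sub_one_mul_sum_pow_card_below y S t
  have h2 := sub_one_mul_sum_pow_card_below y S x
  have h3 : (below S t).filter (fun z => ¬ x ≤ z.val) = below S x := by
    ext z
    simp only [mem_filter, mem_below, not_le]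
    constructor
    · exact fun h => ⟨h.1.1, h.2⟩
    · exact fun h' => ⟨⟨h'.1, h'.2.trans_le h⟩, h'.2⟩
  rw [← sum_filter_add_sum_filter_not _ (fun z => x ≤ z.val), h3] at h1
  linear_combination h2 - h1

/-- If `T` and `S` are disjoint, a difference of powers of `y` that counts elements of `S` below two
bounds is distributed over the elements of `S` between the bounds. -/
theorem sum_pow_card_below_sub {S T : Finset (Fin (n + 1))} (h : Disjoint S T) (t : ℕ)
    (f : Fin (n + 1) → R) :
    ∑ x ∈ below T t, (y ^ #(below S t) - y ^ #(below S x)) * f x =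
      (y - 1) * ∑ z ∈ below S t, y ^ #(below S z) * ∑ x ∈ below T z, f x := by
  have h1 : ∀ x ∈ below T t, (y ^ #(below S t) - y ^ #(below S x)) * f x =
      (y - 1) * ∑ z ∈ below S t with x.val ≤ z.val, y ^ #(below S z) * f x := by
    intro x hx
    rw [pow_card_below_sub y S (mem_below.1 hx).2.le, mul_assoc, sum_mul]
  rw [sum_congr rfl h1, ← mul_sum]
  congr 1
  simp only [mul_sum]
  refine sum_comm' fun x z => ?_
  simp only [mem_below, mem_filter]
  constructor
  · rintro ⟨⟨hx, hxt⟩, ⟨hz, hzt⟩, hle⟩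
    refine ⟨⟨hx, lt_of_le_of_ne hle fun h1 => ?_⟩, hz, hzt⟩
    exact disjoint_left.1 h hz (Fin.ext h1 ▸ hx)
  · rintro ⟨⟨hx, hxz⟩, hz, hzt⟩
    exact ⟨⟨hx, hxz.trans hzt⟩, ⟨hz, hzt⟩, hxz.le⟩

/-- The generating function of the sliding statistic over the chains of `m` sets strictly between
`A` and `B` with decreasing transversals bounded by `t`. A chain `F_1 ⊂ ⋯ ⊂ F_m` has weight
`ξ F_1 ⋯ ξ F_m`, and each chosen element contributes a factor `y` for every smaller element of its
block. The recursion splits off the first set `F` and the first chosen element `x`, which bounds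
the remaining ones. -/
def slideSum : ℕ → Finset (Fin (n + 1)) → Finset (Fin (n + 1)) → ℕ → R
  | 0, A, B, t => ∑ x ∈ below (B \ A) t, y ^ #(below (B \ A) x)
  | m + 1, A, B, t => ∑ F ∈ Ioo A B, ξ F *
      ∑ x ∈ below (F \ A) t, y ^ #(below (F \ A) x) * slideSum m F B x

/-- The contribution to `slideSum` of the part of the chain after its first block, where `K` is the
end of the first block and `x` its chosen element. -/
def slideTail : ℕ → Finset (Fin (n + 1)) → Finset (Fin (n + 1)) → ℕ → R
  | 0, K, B, _ => if K = B then 1 else 0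
  | m + 1, K, B, x => if K = B then 0 else ξ K * slideSum ξ y m K B x

theorem slideSum_eq_sum_slideTail (m : ℕ) {A B : Finset (Fin (n + 1))} (h : A ⊆ B) (t : ℕ) :
    slideSum ξ y m A B t = ∑ K ∈ Ioc A B, ∑ x ∈ below (K \ A) t,
      y ^ #(below (K \ A) x) * slideTail ξ y m K B x := by
  cases m with
  | zero =>
    by_cases hAB : A = B
    · subst hAB
      simp [slideSum, below]
    · have hB : B ∈ Ioc A B := by
        rw [mem_Ioc]
        exact ⟨lt_of_le_of_ne h hAB, le_rfl⟩
      rw [sum_eq_single_of_mem B hB]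
      · simp [slideSum, slideTail]
      · intro K _ hK
        simp [slideTail, hK]
  | succ m =>
    symm
    rw [slideSum]
    refine sum_subset_zero_on_sdiff (s₁ := Ioo A B) ?_ ?_ ?_ |>.symm
    · exact Ioo_subset_Ioc_self
    · intro K hK
      simp only [mem_sdiff, mem_Ioc, mem_Ioo, not_and] at hK
      have hKB : K = B := by
        by_contra hne
        exact hK.2 hK.1.1 (lt_of_le_of_ne hK.1.2 hne)
      simp [slideTail, hKB]
    · intro K hK
      rw [mem_Ioo] at hK
      rw [mul_sum]
      refine sum_congr rfl fun x _ => ?_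
      rw [slideTail, if_neg hK.2.ne]
      ring

variable {ξ}

theorem mul_slideTail_eq_zero (hξ : IsChowFamily ξ) (m : ℕ) {F K : Finset (Fin (n + 1))} (x : ℕ)
    (h1 : ¬ F ⊆ K) (h2 : ¬ K ⊆ F) : ξ F * slideTail ξ y m K univ x = 0 := by
  have hK : K ≠ univ := by rintro rfl; exact h1 (subset_univ F)
  cases m with
  | zero => simp [slideTail, hK]
  | succ m => rw [slideTail, if_neg hK, ← mul_assoc, hξ.mul_eq_zero F K h1 h2, zero_mul]

/-- The linear relation of the chosen element `z` of the block ending in `H` and the chosen element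
`x` of the following block, which ends in `K`. Of the sets that contain `z` but not `x`, only those
up to `H` and those between `H` and `K` are comparable to `A`, `H` and `K`; all sets that contain
`x` but not `z` are incomparable to `H`. -/
theorem relation_slideTail (hξ : IsChowFamily ξ) (m : ℕ) {A H K : Finset (Fin (n + 1))}
    (hHK : H ⊂ K) {z x : Fin (n + 1)} (hzH : z ∈ H) (hzA : z ∉ A)
    (hxK : x ∈ K) (hxH : x ∉ H) (s : ℕ) :
    ξ A * ξ H * slideTail ξ y m K univ s * ∑ F ∈ Ioc A H with z ∈ F, ξ F =
      - (ξ A * ξ H * slideTail ξ y m K univ s * ∑ F ∈ Ioo H K with x ∉ F, ξ F) := by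
  have h0 : ξ A * ξ H * slideTail ξ y m K univ s * ∑ F with x ∈ F ∧ z ∉ F, ξ F = 0 := by
    rw [mul_sum]
    refine sum_eq_zero fun F hF => ?_
    simp only [mem_filter, mem_univ, true_and] at hF
    have : ξ H * ξ F = 0 := hξ.mul_eq_zero H F (fun h => hF.2 (h hzH)) fun h => hxH (h hF.1)
    linear_combination (ξ A * slideTail ξ y m K univ s) * this
  have h1 : ξ A * ξ H * slideTail ξ y m K univ s * ∑ F with z ∈ F ∧ x ∉ F, ξ F =
      ξ A * ξ H * slideTail ξ y m K univ s *
        ∑ F ∈ (Ioc A H).filter (z ∈ ·) ∪ (Ioo H K).filter (x ∉ ·), ξ F := by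
    rw [mul_sum, mul_sum]
    symm
    refine sum_subset_zero_on_sdiff ?_ ?_ fun _ _ => rfl
    · intro F hF
      simp only [mem_union, mem_filter, mem_Ioc, mem_Ioo, mem_univ, true_and] at hF ⊢
      rcases hF with ⟨hF, hz⟩ | ⟨hF, hx⟩
      · exact ⟨hz, fun h => hxH (hF.2 h)⟩
      · exact ⟨hF.1.le hzH, hx⟩
    · intro F hF
      simp only [mem_sdiff, mem_union, mem_filter, mem_Ioc, mem_Ioo, mem_univ, true_and] at hF
      obtain ⟨⟨hz, hx⟩, hF⟩ := hF
      push Not at hF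
      by_cases hAF : A ⊆ F
      · have hAF' : A < F := lt_of_le_of_ne hAF (by rintro rfl; exact hzA hz)
        have hFH : ¬ F ⊆ H := fun h => hF.1 ⟨hAF', h⟩ hz
        by_cases hHF : H ⊆ F
        · have hHF' : H < F := lt_of_le_of_ne hHF (by rintro rfl; exact hFH subset_rfl)
          have hFK : ¬ F ⊆ K := fun h =>
            hx (hF.2 ⟨hHF', lt_of_le_of_ne h (by rintro rfl; exact hx hxK)⟩)
          have := mul_slideTail_eq_zero y hξ m s hFK fun h => hx (h hxK)
          linear_combination (ξ A * ξ H) * this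
        · have := hξ.mul_eq_zero H F hHF hFH
          linear_combination (ξ A * slideTail ξ y m K univ s) * this
      · have := hξ.mul_eq_zero A F hAF fun h => hzA (h hz)
        linear_combination (ξ H * slideTail ξ y m K univ s) * this
  have hdisj : Disjoint ((Ioc A H).filter (z ∈ ·)) ((Ioo H K).filter (x ∉ ·)) := by
    rw [disjoint_left]
    intro F hF hF'
    simp only [mem_filter, mem_Ioc, mem_Ioo] at hF hF'
    exact absurd hF.1.2 (not_le_of_gt hF'.1.1)
  rw [hξ.sum_eq z x, h0, sum_union hdisj] at h1
  linear_combination -h1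

variable (ξ) in
/-- Chains that start at a set `F` above `H`, weighted by a power of `y` that counts the elements
of `F \ H`, once below the bound `z` and once below the first chosen element `x`. The difference is
distributed over the elements of `F \ H` between `x` and `z`, each of which becomes a new first
chosen element. -/
theorem sum_slideSum_sub (m : ℕ) (H : Finset (Fin (n + 1))) (z : ℕ) :
    ∑ F ∈ Ioo H univ, ξ F * (y ^ #(below (F \ H) z) * slideSum ξ y m F univ z) -
      ∑ K ∈ Ioc H univ, ∑ x ∈ below (K \ H) z, y ^ #(below (K \ H) x) *
        (slideTail ξ y m K univ x * ∑ F ∈ Ioo H K with x ∉ F, ξ F) =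
    (y - 1) * slideSum ξ y (m + 1) H univ z := by
  have h1 : ∑ K ∈ Ioc H univ, ∑ x ∈ below (K \ H) z, y ^ #(below (K \ H) x) *
        (slideTail ξ y m K univ x * ∑ F ∈ Ioo H K with x ∉ F, ξ F) =
      ∑ F ∈ Ioo H univ, ξ F * ∑ K ∈ Ioc F univ, ∑ x ∈ below (K \ F) z,
        y ^ #(below (F \ H) x) * (y ^ #(below (K \ F) x) * slideTail ξ y m K univ x) := by
    have h2 : ∀ K ∈ Ioc H univ, ∑ x ∈ below (K \ H) z, y ^ #(below (K \ H) x) *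
          (slideTail ξ y m K univ x * ∑ F ∈ Ioo H K with x ∉ F, ξ F) =
        ∑ F ∈ Ioo H K, ∑ x ∈ below (K \ F) z, ξ F *
          (y ^ #(below (F \ H) x) * (y ^ #(below (K \ F) x) * slideTail ξ y m K univ x)) := by
      intro K _
      simp only [mul_sum]
      rw [sum_comm' (t' := Ioo H K) (s' := fun F => below (K \ F) z)]
      · refine sum_congr rfl fun F hF => sum_congr rfl fun x _ => ?_
        rw [mem_Ioo] at hF
        rw [card_below_sdiff_add hF.1.le hF.2.le, pow_add]
        ring
      · intro x F
        simp only [mem_below, mem_sdiff, mem_filter, mem_Ioo]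
        constructor
        · rintro ⟨⟨⟨h1, h2⟩, h3⟩, h4, h5⟩
          exact ⟨⟨⟨h1, h5⟩, h3⟩, h4⟩
        · rintro ⟨⟨⟨h1, h5⟩, h3⟩, h4⟩
          exact ⟨⟨⟨h1, fun h => h5 (h4.1.le h)⟩, h3⟩, h4, h5⟩
    rw [sum_congr rfl h2, sum_comm' (t' := Ioo H univ) (s' := fun F => Ioc F univ)]
    · simp only [mul_sum]
    · intro K F
      simp only [mem_Ioo, mem_Ioc]
      constructor
      · rintro ⟨⟨h1, h2⟩, h3, h4⟩
        exact ⟨⟨h4, h2⟩, h3, h4.trans_le h2⟩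
      · rintro ⟨⟨h1, h2⟩, h3, h4⟩
        exact ⟨⟨h3.trans h1, h2⟩, h3, h1⟩
  rw [h1, ← sum_sub_distrib, slideSum, mul_sum]
  refine sum_congr rfl fun F _ => ?_
  have h3 : ∀ t, slideSum ξ y m F univ t = _ := slideSum_eq_sum_slideTail ξ y m (subset_univ F)
  have h4 : ∀ K ∈ Ioc F univ, ∑ x ∈ below (K \ F) z,
      (y ^ #(below (F \ H) z) - y ^ #(below (F \ H) x)) *
        (y ^ #(below (K \ F) x) * slideTail ξ y m K univ x) =
      (y - 1) * ∑ x ∈ below (F \ H) z, y ^ #(below (F \ H) x) *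
        ∑ w ∈ below (K \ F) x, y ^ #(below (K \ F) w) * slideTail ξ y m K univ w := fun K _ => by
    refine sum_pow_card_below_sub y ?_ z _
    rw [disjoint_left]
    intro a ha ha'
    exact (mem_sdiff.1 ha').2 (mem_sdiff.1 ha).1
  have h5 := sum_congr (rfl : Ioc F univ = Ioc F univ) h4
  simp only [sub_mul, sum_sub_distrib, ← mul_sum] at h5
  rw [sum_comm] at h5
  simp only [← mul_sum, ← h3] at h5
  linear_combination ξ F * h5

/-- On the stratum of `A ⊂ H`, the chains above `A` reduce to the chains above `H` and those
between `A` and `H`. The induction on `m` treats chains whose first set `F` lies below `H`. The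
chains with `F = H` and with `F` above `H` are then matched by the linear relations
`relation_slideTail`. -/
theorem mul_slideSum (hξ : IsChowFamily ξ) (m : ℕ) : ∀ {A H : Finset (Fin (n + 1))} (_ : A ⊂ H)
    (t : ℕ), ξ A * ξ H * slideSum ξ y m A univ t =
      ξ A * ξ H * (y ^ #(below (H \ A) t) * slideSum ξ y m H univ t + slideSum ξ y m A H t) := by
  induction m with
  | zero =>
    intro A H hAH t
    congr 1
    simp only [slideSum, sum_pow_card_below]
    rw [card_below_sdiff_add hAH.subset (subset_univ H), sum_range_add]
    rw [add_comm, mul_sum]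
    congr 1
    exact sum_congr rfl fun i _ => pow_add _ _ _
  | succ m ih =>
    intro A H hAH t
    by_cases hH : H = univ
    · subst hH
      congr 1
      simp [slideSum]
    have hHu : H < univ := lt_of_le_of_ne (subset_univ H) hH
    -- the sum over the first member `F` of the chain, for `F` below, equal to or above `H`
    have hsplit : ξ A * ξ H * slideSum ξ y (m + 1) A univ t =
        ∑ F ∈ Ioo A H ∪ ({H} ∪ Ioo H univ), ξ A * ξ H * (ξ F *
          ∑ x ∈ below (F \ A) t, y ^ #(below (F \ A) x) * slideSum ξ y m F univ x) := by
      rw [slideSum, mul_sum]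
      symm
      refine sum_subset_zero_on_sdiff ?_ ?_ fun _ _ => rfl
      · intro F hF
        simp only [mem_union, mem_Ioo, mem_singleton] at hF ⊢
        rcases hF with h | rfl | h
        · exact ⟨h.1, h.2.trans hHu⟩
        · exact ⟨hAH, hHu⟩
        · exact ⟨lt_trans hAH h.1, h.2⟩
      · intro F hF
        simp only [mem_sdiff, mem_union, mem_Ioo, mem_singleton] at hF
        obtain ⟨hF1, hF2⟩ := hF
        push Not at hF2
        have h1 : ¬ H ⊆ F := fun h => hF2.2.2 (lt_of_le_of_ne h (Ne.symm hF2.2.1)) hF1.2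
        have h2 : ¬ F ⊆ H := fun h => hF2.1 hF1.1 (lt_of_le_of_ne h hF2.2.1)
        have := hξ.mul_eq_zero H F h1 h2
        linear_combination (ξ A * ∑ x ∈ below (F \ A) t,
          y ^ #(below (F \ A) x) * slideSum ξ y m F univ x) * this
    have hd1 : Disjoint ({H} : Finset (Finset (Fin (n + 1)))) (Ioo H univ) := by simp
    have hd2 : Disjoint (Ioo A H) ({H} ∪ Ioo H univ) := by
      rw [disjoint_left]
      intro F hF hF'
      simp only [mem_union, mem_Ioo, mem_singleton] at hF hF'
      rcases hF' with rfl | h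
      · exact lt_irrefl _ hF.2
      · exact lt_asymm hF.2 h.1
    rw [hsplit, sum_union hd2, sum_union hd1, sum_singleton]
    -- below `H`: induction
    have hlow : ∑ F ∈ Ioo A H, ξ A * ξ H * (ξ F *
          ∑ x ∈ below (F \ A) t, y ^ #(below (F \ A) x) * slideSum ξ y m F univ x) =
        ξ A * ξ H * ∑ z ∈ below (H \ A) t, y ^ #(below (H \ A) z) *
          (slideSum ξ y m H univ z * ∑ F ∈ Ioo A H with z ∈ F, ξ F) +
        ξ A * ξ H * slideSum ξ y (m + 1) A H t := by
      have h1 : ∀ F ∈ Ioo A H, ξ A * ξ H * (ξ F *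
          ∑ x ∈ below (F \ A) t, y ^ #(below (F \ A) x) * slideSum ξ y m F univ x) =
          ∑ x ∈ below (F \ A) t, ξ A * ξ H * (y ^ #(below (H \ A) x) *
            (slideSum ξ y m H univ x * ξ F)) + ξ A * ξ H * (ξ F *
          ∑ x ∈ below (F \ A) t, y ^ #(below (F \ A) x) * slideSum ξ y m F H x) := by
        intro F hF
        rw [mem_Ioo] at hF
        simp only [mul_sum]
        rw [← sum_add_distrib]
        refine sum_congr rfl fun x _ => ?_
        have := ih hF.2 x
        rw [card_below_sdiff_add hF.1.le hF.2.le, pow_add]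
        linear_combination (ξ A * y ^ #(below (F \ A) x)) * this
      rw [sum_congr rfl h1, sum_add_distrib, slideSum, ← mul_sum (Ioo A H)]
      congr 1
      simp only [mul_sum]
      refine sum_comm' fun F x => ?_
      simp only [mem_Ioo, mem_below, mem_sdiff, mem_filter]
      constructor
      · rintro ⟨h1, ⟨h2, h3⟩, h4⟩
        exact ⟨⟨h1, h2⟩, ⟨h1.2.le h2, h3⟩, h4⟩
      · rintro ⟨⟨h1, h2⟩, ⟨h5, h3⟩, h4⟩
        exact ⟨h1, ⟨h2, h3⟩, h4⟩
    -- the relation between `z` and the chosen element of the following block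
    have hrel : ∀ z ∈ below (H \ A) t, ξ A * ξ H * (slideSum ξ y m H univ z *
        ∑ F ∈ Ioc A H with z ∈ F, ξ F) = - (ξ A * ξ H * ∑ K ∈ Ioc H univ,
          ∑ x ∈ below (K \ H) z, y ^ #(below (K \ H) x) *
            (slideTail ξ y m K univ x * ∑ F ∈ Ioo H K with x ∉ F, ξ F)) := by
      intro z hz
      rw [mem_below, mem_sdiff] at hz
      rw [slideSum_eq_sum_slideTail ξ y m hHu.le, sum_mul, mul_sum, mul_sum, ← sum_neg_distrib]
      refine sum_congr rfl fun K hK => ?_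
      rw [sum_mul, mul_sum, mul_sum, ← sum_neg_distrib]
      refine sum_congr rfl fun x hx => ?_
      rw [mem_below, mem_sdiff] at hx
      have := relation_slideTail y hξ m (mem_Ioc.1 hK).1 hz.1.1 hz.1.2 hx.1.1 hx.1.2 x.val
      linear_combination (y ^ #(below (K \ H) x)) * this
    have hIoc : ∀ z ∈ below (H \ A) t, ∑ F ∈ Ioc A H with z ∈ F, ξ F =
        ξ H + ∑ F ∈ Ioo A H with z ∈ F, ξ F := by
      intro z hz
      rw [mem_below, mem_sdiff] at hz
      rw [← Ioo_insert_right hAH, filter_insert, if_pos hz.1.1, sum_insert]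
      simp
    -- above `H`
    have hhigh : ∀ F ∈ Ioo H univ,
        ∑ x ∈ below (F \ A) t, y ^ #(below (F \ A) x) * slideSum ξ y m F univ x =
        y ^ #(below (H \ A) t) * ∑ x ∈ below (F \ H) t,
            y ^ #(below (F \ H) x) * slideSum ξ y m F univ x +
          ∑ z ∈ below (H \ A) t, y ^ #(below (H \ A) z) *
            (y ^ #(below (F \ H) z) * slideSum ξ y m F univ z - (y - 1) *
              ∑ x ∈ below (F \ H) z, y ^ #(below (F \ H) x) * slideSum ξ y m F univ x) := by
      intro F hF
      rw [mem_Ioo] at hF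
      have hdis : Disjoint (H \ A) (F \ H) := by
        rw [disjoint_left]
        intro a ha ha'
        exact (mem_sdiff.1 ha').2 (mem_sdiff.1 ha).1
      have h1 : below (F \ A) t = below (H \ A) t ∪ below (F \ H) t := by
        ext a
        simp only [mem_union, mem_below, mem_sdiff]
        have h5 : a ∈ A → a ∈ H := fun h => hAH.subset h
        have h6 : a ∈ H → a ∈ F := fun h => hF.1.le h
        tauto
      have h2 : Disjoint (below (H \ A) t) (below (F \ H) t) :=
        hdis.mono (filter_subset _ _) (filter_subset _ _)
      have h3 := sum_pow_card_below_sub y hdis t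
        (fun x => y ^ #(below (F \ H) x) * slideSum ξ y m F univ x)
      rw [h1, sum_union h2]
      simp only [card_below_sdiff_add hAH.subset hF.1.le, pow_add]
      simp only [sub_mul, sum_sub_distrib, ← mul_sum] at h3
      simp only [mul_sub, sum_sub_distrib]
      simp only [mul_left_comm _ (y - 1), ← mul_sum]
      simp only [mul_assoc] at h3 ⊢
      linear_combination -h3
    have hhigh' : ∑ F ∈ Ioo H univ, ξ A * ξ H * (ξ F *
          ∑ x ∈ below (F \ A) t, y ^ #(below (F \ A) x) * slideSum ξ y m F univ x) =
        ξ A * ξ H * (y ^ #(below (H \ A) t) * slideSum ξ y (m + 1) H univ t) +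
          ξ A * ξ H * ∑ F ∈ Ioo H univ, ξ F * ∑ z ∈ below (H \ A) t, y ^ #(below (H \ A) z) *
            (y ^ #(below (F \ H) z) * slideSum ξ y m F univ z - (y - 1) *
              ∑ x ∈ below (F \ H) z, y ^ #(below (F \ H) x) * slideSum ξ y m F univ x) := by
      rw [slideSum, mul_sum (Ioo H univ), mul_sum (Ioo H univ), mul_sum (Ioo H univ),
        ← sum_add_distrib]
      refine sum_congr rfl fun F hF => ?_
      rw [hhigh F hF]
      ring
    rw [hlow, hhigh']
    -- assemble, for every `z` in the block that ends in `H`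
    have hfin : ∀ z ∈ below (H \ A) t, y ^ #(below (H \ A) z) *
        (ξ A * ξ H * (slideSum ξ y m H univ z * ∑ F ∈ Ioc A H with z ∈ F, ξ F)) +
        ξ A * ξ H * (y ^ #(below (H \ A) z) *
          ∑ F ∈ Ioo H univ, ξ F * (y ^ #(below (F \ H) z) * slideSum ξ y m F univ z - (y - 1) *
              ∑ x ∈ below (F \ H) z, y ^ #(below (F \ H) x) * slideSum ξ y m F univ x)) = 0 := by
      intro z hz
      rw [hrel z hz]
      have h1 := sum_slideSum_sub ξ y m H z.val
      rw [slideSum] at h1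
      simp only [mul_sub, sum_sub_distrib]
      simp only [mul_left_comm _ (y - 1), ← mul_sum]
      linear_combination (ξ A * ξ H * y ^ #(below (H \ A) z)) * h1
    have hfin' := sum_eq_zero hfin
    rw [sum_add_distrib] at hfin'
    have hA : ∑ z ∈ below (H \ A) t, y ^ #(below (H \ A) z) *
        (ξ A * ξ H * (slideSum ξ y m H univ z * ∑ F ∈ Ioc A H with z ∈ F, ξ F)) =
        ξ A * ξ H * (ξ H * ∑ x ∈ below (H \ A) t,
          y ^ #(below (H \ A) x) * slideSum ξ y m H univ x) +
        ξ A * ξ H * ∑ z ∈ below (H \ A) t, y ^ #(below (H \ A) z) *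
          (slideSum ξ y m H univ z * ∑ F ∈ Ioo A H with z ∈ F, ξ F) := by
      simp only [mul_sum (below (H \ A) t)]
      rw [← sum_add_distrib]
      refine sum_congr rfl fun z hz => ?_
      rw [hIoc z hz]
      ring
    have hB : ∑ z ∈ below (H \ A) t, ξ A * ξ H * (y ^ #(below (H \ A) z) *
          ∑ F ∈ Ioo H univ, ξ F * (y ^ #(below (F \ H) z) * slideSum ξ y m F univ z - (y - 1) *
              ∑ x ∈ below (F \ H) z, y ^ #(below (F \ H) x) * slideSum ξ y m F univ x)) =
        ξ A * ξ H * ∑ F ∈ Ioo H univ, ξ F * ∑ z ∈ below (H \ A) t, y ^ #(below (H \ A) z) *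
            (y ^ #(below (F \ H) z) * slideSum ξ y m F univ z - (y - 1) *
              ∑ x ∈ below (F \ H) z, y ^ #(below (F \ H) x) * slideSum ξ y m F univ x) := by
      rw [← mul_sum]
      congr 1
      simp only [mul_sum (Ioo H univ), mul_sum (below (H \ A) t)]
      rw [sum_comm]
      refine sum_congr rfl fun F _ => sum_congr rfl fun z _ => ?_
      ring
    rw [hA, hB] at hfin'
    linear_combination hfin'

end sliding

/-! ### Sliding sums on the stratum of a chain -/

section stratum

variable {R : Type*} [CommRing R] (ξ : Finset (Fin (n + 1)) → R) (y : R)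

theorem below_eq_self (S : Finset (Fin (n + 1))) : below S (n + 1) = S := by
  ext z
  rw [mem_below, and_iff_left z.isLt]

/-- A sliding sum over chains with too few elements for a transversal vanishes. -/
theorem slideSum_eq_zero (m : ℕ) : ∀ {A B : Finset (Fin (n + 1))} {t : ℕ},
    #(below (B \ A) t) ≤ m → slideSum ξ y m A B t = 0 := by
  induction m with
  | zero =>
    intro A B t h
    rw [slideSum, card_eq_zero.1 (Nat.le_zero.1 h), sum_empty]
  | succ m ih =>
    intro A B t h
    rw [slideSum]
    refine sum_eq_zero fun F hF => ?_
    rw [sum_eq_zero, mul_zero]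
    intro x hx
    rw [ih, mul_zero]
    rw [mem_Ioo] at hF
    rw [mem_below, mem_sdiff] at hx
    have h1 : below (B \ F) x ⊂ below (B \ A) t := by
      rw [ssubset_iff_of_subset]
      · refine ⟨x, ?_, ?_⟩
        · rw [mem_below, mem_sdiff]
          exact ⟨⟨hF.2.le hx.1.1, hx.1.2⟩, hx.2⟩
        · simp [mem_below]
      · intro z hz
        rw [mem_below, mem_sdiff] at hz ⊢
        exact ⟨⟨hz.1.1, fun h => hz.1.2 (hF.1.le h)⟩, hz.2.trans hx.2⟩
    have := card_lt_card h1
    omega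

/-- If there are just enough elements for a transversal, the only transversal takes them in
decreasing order, and the sliding sum is a single product over a maximal chain. -/
theorem exists_slideSum_eq_prod (m : ℕ) : ∀ {A B : Finset (Fin (n + 1))} {t : ℕ}, A ⊆ B →
    #(B \ A) = m + 1 → (∀ z ∈ B \ A, z.val < t) →
    ∃ τ : Finset (Finset (Fin (n + 1))), IsChain (· ≤ ·) (τ : Set (Finset (Fin (n + 1)))) ∧
      #τ = m ∧ (∀ F ∈ τ, F ∈ Ioo A B) ∧ slideSum ξ y m A B t = ∏ F ∈ τ, ξ F := by
  induction m with
  | zero =>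
    intro A B t hAB hc ht
    obtain ⟨z, hz⟩ := card_eq_one.1 hc
    have h1 : below {z} t = {z} := by
      ext a
      rw [mem_below, mem_singleton]
      refine ⟨fun h => h.1, fun h => ⟨h, ht a ?_⟩⟩
      rw [hz, h, mem_singleton]
    have h2 : below {z} z.val = ∅ := by
      ext a
      rw [mem_below, mem_singleton]
      simp only [notMem_empty, iff_false, not_and]
      rintro rfl
      exact lt_irrefl _
    refine ⟨∅, by simp, rfl, by simp, ?_⟩
    rw [slideSum, hz, h1, sum_singleton, h2, card_empty, pow_zero, prod_empty]
  | succ m ih =>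
    intro A B t hAB hc ht
    have hne : (B \ A).Nonempty := card_pos.1 (by omega)
    obtain ⟨z, hz, hmax⟩ := exists_max_image (B \ A) id hne
    simp only [id] at hmax
    have hz' := mem_sdiff.1 hz
    have hsd : B \ insert z A = (B \ A).erase z := by
      ext a
      simp only [mem_sdiff, mem_insert, mem_erase]
      tauto
    have hcard : #(B \ insert z A) = m + 1 := by
      rw [hsd, card_erase_of_mem hz, hc]
      rfl
    have hsub : insert z A ⊆ B := insert_subset hz'.1 hAB
    have hmem : insert z A ∈ Ioo A B := by
      rw [mem_Ioo]
      refine ⟨ssubset_insert hz'.2, lt_of_le_of_ne hsub ?_⟩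
      rintro rfl
      simp at hcard
    obtain ⟨τ, h1, h2, h3, h4⟩ := ih (t := z.val) hsub hcard (by
      intro a ha
      rw [hsd, mem_erase] at ha
      exact lt_of_le_of_ne (hmax a ha.2) fun h => ha.1 (Fin.ext h))
    have h5 : insert z A ∉ τ := fun h => lt_irrefl _ (mem_Ioo.1 (h3 _ h)).1
    refine ⟨insert (insert z A) τ, ?_, ?_, ?_, ?_⟩
    · rw [coe_insert]
      exact h1.insert fun F hF _ => Or.inl (mem_Ioo.1 (h3 F hF)).1.le
    · rw [card_insert_of_notMem h5, h2]
    · intro F hF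
      rcases mem_insert.1 hF with rfl | hF
      · exact hmem
      · have := mem_Ioo.1 (h3 F hF)
        exact mem_Ioo.2 ⟨(mem_Ioo.1 hmem).1.trans this.1, this.2⟩
    · rw [slideSum, sum_eq_single_of_mem _ hmem, prod_insert h5, ← h4]
      · have h6 : insert z A \ A = {z} := by
          ext a
          simp only [mem_sdiff, mem_insert, mem_singleton]
          refine ⟨fun h => h.1.resolve_right h.2, ?_⟩
          rintro rfl
          exact ⟨Or.inl rfl, hz'.2⟩
        have h7 : below {z} t = {z} := by
          ext a
          rw [mem_below, mem_singleton]
          refine ⟨fun h => h.1, ?_⟩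
          rintro rfl
          exact ⟨rfl, ht _ hz⟩
        have h8 : below {z} z.val = ∅ := by
          ext a
          rw [mem_below, mem_singleton]
          simp only [notMem_empty, iff_false, not_and]
          rintro rfl
          exact lt_irrefl _
        rw [h6, h7, sum_singleton, h8, card_empty, pow_zero, one_mul]
      · intro F hF hFz
        rw [mem_Ioo] at hF
        rw [sum_eq_zero, mul_zero]
        intro x hx
        rw [slideSum_eq_zero, mul_zero]
        rw [mem_below, mem_sdiff] at hx
        -- a second element that is not available for the rest of the transversal
        obtain ⟨w, hw, hwx, hw'⟩ : ∃ w ∈ B \ A, w ≠ x ∧ w ∉ below (B \ F) x := by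
          by_cases hxz : x = z
          · subst hxz
            have h6 : ¬ F ⊆ insert x A := fun h =>
              hFz (subset_antisymm h (insert_subset hx.1.1 hF.1.le))
            obtain ⟨w, hwF, hw⟩ := not_subset.1 h6
            rw [mem_insert, not_or] at hw
            refine ⟨w, mem_sdiff.2 ⟨hF.2.le hwF, hw.2⟩, hw.1, fun h => ?_⟩
            exact (mem_sdiff.1 (mem_below.1 h).1).2 hwF
          · refine ⟨z, hz, fun h => hxz h.symm, fun h => ?_⟩
            have := hmax x (mem_sdiff.2 ⟨hF.2.le hx.1.1, hx.1.2⟩)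
            exact absurd (mem_below.1 h).2 (not_lt.2 this)
        have h6 : below (B \ F) x ⊆ ((B \ A).erase x).erase w := by
          intro a ha
          rw [mem_erase, mem_erase]
          refine ⟨fun h => hw' (h ▸ ha), ?_, ?_⟩
          · rintro rfl
            exact lt_irrefl _ (mem_below.1 ha).2
          · have := mem_sdiff.1 (mem_below.1 ha).1
            exact mem_sdiff.2 ⟨this.1, fun h => this.2 (hF.1.le h)⟩
        have h7 := card_le_card h6
        rw [card_erase_of_mem (mem_erase.2 ⟨hwx, hw⟩),
          card_erase_of_mem (mem_sdiff.2 ⟨hF.2.le hx.1.1, hx.1.2⟩), hc] at h7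
        exact h7

variable {ξ}

/-- On the stratum of a chain, the sliding class is the sum of the sliding classes of the gaps of
the chain. -/
theorem prod_mul_slideSum (hξ : IsChowFamily ξ) (m c : ℕ) (f : ℕ → Finset (Fin (n + 1)))
    (h0 : f 0 = ∅) (hf : ∀ i ≤ c, f i ⊂ f (i + 1)) (hc : f (c + 1) = univ) :
    (∏ i ∈ range (c + 2), ξ (f i)) * slideSum ξ y m ∅ univ (n + 1) =
      (∏ i ∈ range (c + 2), ξ (f i)) *
        ∑ i ∈ range (c + 1), y ^ #(f i) * slideSum ξ y m (f i) (f (i + 1)) (n + 1) := by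
  have key : ∀ j ≤ c + 1, (∏ i ∈ range (c + 2), ξ (f i)) * slideSum ξ y m ∅ univ (n + 1) =
      (∏ i ∈ range (c + 2), ξ (f i)) * (y ^ #(f j) * slideSum ξ y m (f j) univ (n + 1) +
        ∑ i ∈ range j, y ^ #(f i) * slideSum ξ y m (f i) (f (i + 1)) (n + 1)) := by
    intro j
    induction j with
    | zero => simp [h0]
    | succ j ih =>
      intro hj
      rw [ih (by omega), sum_range_succ]
      have h1 := mul_slideSum y hξ m (hf j (by omega)) (n + 1)
      rw [below_eq_self] at h1
      have h2 : #(f (j + 1)) = #(f j) + #(f (j + 1) \ f j) := by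
        have := card_sdiff_add_card_eq_card (hf j (by omega)).subset
        omega
      obtain ⟨Q, hQ⟩ : ξ (f j) * ξ (f (j + 1)) ∣ ∏ i ∈ range (c + 2), ξ (f i) := by
        rw [← prod_pair (f := fun i => ξ (f i)) (show j ≠ j + 1 by omega)]
        refine prod_dvd_prod_of_subset _ _ _ fun i hi => ?_
        rw [mem_insert, mem_singleton] at hi
        rw [mem_range]
        omega
      rw [hQ, h2, pow_add]
      linear_combination (Q * y ^ #(f j)) * h1
  rw [key (c + 1) le_rfl, hc, slideSum_eq_zero ξ y m (by simp [below]), mul_zero, zero_add]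

end stratum

/-! ### Sliding sums as sums over chains -/

theorem sum_fin_cons {α S : Type*} [Fintype α] [AddCommMonoid S] {m : ℕ}
    (φ : (Fin (m + 1) → α) → S) :
    ∑ x, φ x = ∑ a, ∑ x : Fin m → α, φ (Fin.cons a x : Fin (m + 1) → α) := by
  rw [← Equiv.sum_comp (Fin.consEquiv fun _ => α), Fintype.sum_prod_type]
  rfl

section expansion

variable {R : Type*} [CommRing R] (ξ : Finset (Fin (n + 1)) → R) (y : R)

/-- The sequence `A, f 0, ..., f (m - 1), B, B, ...`. -/
def extendSeq {m : ℕ} (A : Finset (Fin (n + 1))) (f : Fin m → Finset (Fin (n + 1)))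
    (B : Finset (Fin (n + 1))) (i : ℕ) : Finset (Fin (n + 1)) :=
  if i = 0 then A else if h : i - 1 < m then f ⟨i - 1, h⟩ else B

@[simp] theorem extendSeq_zero {m : ℕ} (A : Finset (Fin (n + 1)))
    (f : Fin m → Finset (Fin (n + 1))) (B : Finset (Fin (n + 1))) : extendSeq A f B 0 = A := by
  simp [extendSeq]

theorem extendSeq_cons {m : ℕ} (A F : Finset (Fin (n + 1))) (f : Fin m → Finset (Fin (n + 1)))
    (B : Finset (Fin (n + 1))) (i : ℕ) :
    extendSeq A (Fin.cons F f : Fin (m + 1) → Finset (Fin (n + 1))) B (i + 1) =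
      extendSeq F f B i := by
  cases i with
  | zero => simp [extendSeq]
  | succ j =>
    unfold extendSeq
    by_cases h : j < m
    · have h' : j + 1 < m + 1 := by omega
      simp only [Nat.add_sub_cancel, Nat.succ_ne_zero, if_false, dif_pos h, dif_pos h']
      exact Fin.cons_succ (α := fun _ => Finset (Fin (n + 1))) F f ⟨j, h⟩
    · have h' : ¬ j + 1 < m + 1 := by omega
      simp only [Nat.add_sub_cancel, Nat.succ_ne_zero, if_false, dif_neg h, dif_neg h']

/-- `x` is a decreasing transversal of the blocks `g (i + 1) \ g i`, bounded by `t`. -/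
def IsTransversal {m : ℕ} (g : ℕ → Finset (Fin (n + 1))) (t : ℕ)
    (x : Fin (m + 1) → Fin (n + 1)) : Prop :=
  (∀ i : Fin (m + 1), x i ∈ g (i + 1) \ g i) ∧ StrictAnti x ∧ (x 0).val < t

theorem isTransversal_cons {m : ℕ} (g : ℕ → Finset (Fin (n + 1))) (t : ℕ) (a : Fin (n + 1))
    (x : Fin (m + 1) → Fin (n + 1)) :
    IsTransversal g t (Fin.cons a x : Fin (m + 2) → Fin (n + 1)) ↔
      a ∈ below (g 1 \ g 0) t ∧ IsTransversal (fun i => g (i + 1)) a x := by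
  have h1 : StrictAnti (Fin.cons a x : Fin (m + 2) → Fin (n + 1)) ↔ x 0 < a ∧ StrictAnti x :=
    strictAnti_vecCons
  unfold IsTransversal
  rw [h1, Fin.forall_fin_succ, mem_below]
  simp only [Fin.cons_zero, Fin.cons_succ, Fin.val_zero, Fin.val_succ, zero_add, Fin.lt_def]
  tauto

open scoped Classical in
/-- The generating function of the sliding statistic over the decreasing transversals of a fixed
chain. -/
def transversalSum (m : ℕ) (g : ℕ → Finset (Fin (n + 1))) (t : ℕ) : R :=
  ∑ x : Fin (m + 1) → Fin (n + 1) with IsTransversal g t x,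
    y ^ ∑ i : Fin (m + 1), #(below (g (i + 1) \ g i) (x i))

theorem transversalSum_zero (g : ℕ → Finset (Fin (n + 1))) (t : ℕ) :
    transversalSum y 0 g t = ∑ x ∈ below (g 1 \ g 0) t, y ^ #(below (g 1 \ g 0) x) := by
  classical
  have : Subsingleton (Fin (0 + 1)) := inferInstanceAs (Subsingleton (Fin 1))
  unfold transversalSum
  refine sum_nbij' (fun x => x 0) (fun a _ => a) ?_ ?_ ?_ ?_ ?_
  · intro x hx
    have h := (mem_filter.1 hx).2
    exact mem_below.2 ⟨h.1 0, h.2.2⟩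
  · intro a ha
    rw [mem_below] at ha
    refine mem_filter.2 ⟨mem_univ _, fun i => ?_, Subsingleton.strictAnti _, ha.2⟩
    rw [Subsingleton.elim i 0]
    exact ha.1
  · intro x _
    funext i
    rw [Subsingleton.elim i 0]
  · intro a _
    rfl
  · intro x _
    simp

theorem transversalSum_succ (m : ℕ) (g : ℕ → Finset (Fin (n + 1))) (t : ℕ) :
    transversalSum y (m + 1) g t = ∑ x ∈ below (g 1 \ g 0) t,
      y ^ #(below (g 1 \ g 0) x) * transversalSum y m (fun i => g (i + 1)) x := by
  classical
  unfold transversalSum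
  rw [sum_filter, sum_fin_cons]
  symm
  refine sum_subset_zero_on_sdiff (subset_univ _) ?_ ?_
  · intro a ha
    refine sum_eq_zero fun x _ => if_neg fun h => ?_
    exact (mem_sdiff.1 ha).2 ((isTransversal_cons g t a x).1 h).1
  · intro a ha
    rw [mul_sum, sum_filter]
    refine sum_congr rfl fun x _ => ?_
    simp only [isTransversal_cons, ha, true_and]
    split_ifs
    · rw [Fin.sum_univ_succ (n := m + 1), pow_add]
      rfl
    · rfl

theorem strictMono_cons_iff {m : ℕ} {A B F : Finset (Fin (n + 1))}
    {f : Fin m → Finset (Fin (n + 1))} :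
    (StrictMono (Fin.cons F f : Fin (m + 1) → Finset (Fin (n + 1))) ∧
      ∀ i, (Fin.cons F f : Fin (m + 1) → Finset (Fin (n + 1))) i ∈ Ioo A B) ↔
    F ∈ Ioo A B ∧ StrictMono f ∧ ∀ i, f i ∈ Ioo F B := by
  rw [Fin.forall_fin_succ]
  simp only [Fin.cons_zero, Fin.cons_succ, mem_Ioo]
  constructor
  · rintro ⟨h1, h2, h3⟩
    refine ⟨h2, fun i j hij => ?_, fun i => ⟨?_, (h3 i).2⟩⟩
    · simpa using h1 (Fin.succ_lt_succ_iff.2 hij)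
    · simpa using h1 (Fin.succ_pos i)
  · rintro ⟨h1, h2, h3⟩
    refine ⟨?_, h1, fun i => ⟨h1.1.trans (h3 i).1, (h3 i).2⟩⟩
    intro i j hij
    cases j using Fin.cases with
    | zero => exact absurd hij (Fin.not_lt_zero i)
    | succ j =>
      cases i using Fin.cases with
      | zero => simpa using (h3 j).1
      | succ i => simpa using h2 (Fin.succ_lt_succ_iff.1 hij)

open scoped Classical in
/-- The sliding sum, unfolded into a sum over chains and their decreasing transversals. -/
theorem slideSum_eq_sum_chains (m : ℕ) : ∀ (A B : Finset (Fin (n + 1))) (t : ℕ),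
    slideSum ξ y m A B t =
      ∑ f : Fin m → Finset (Fin (n + 1)) with StrictMono f ∧ ∀ i, f i ∈ Ioo A B,
        transversalSum y m (extendSeq A f B) t * ∏ i, ξ (f i) := by
  induction m with
  | zero =>
    intro A B t
    rw [slideSum, sum_filter, Fintype.sum_subsingleton _ Fin.elim0, if_pos, transversalSum_zero]
    · simp [extendSeq]
    · exact ⟨Subsingleton.strictMono _, fun i => i.elim0⟩
  | succ m ih =>
    intro A B t
    rw [slideSum, sum_filter, sum_fin_cons]
    refine sum_subset_zero_on_sdiff (subset_univ _) ?_ ?_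
    · intro F hF
      refine sum_eq_zero fun f _ => if_neg fun h => ?_
      exact (mem_sdiff.1 hF).2 (strictMono_cons_iff.1 h).1
    · intro F hF
      simp only [strictMono_cons_iff, hF, true_and]
      rw [← sum_filter, mul_sum]
      simp only [ih, mul_sum]
      rw [sum_comm]
      refine sum_congr rfl fun f _ => ?_
      rw [transversalSum_succ, Fin.prod_univ_succ, sum_mul]
      have h1 : extendSeq A (Fin.cons F f : Fin (m + 1) → Finset (Fin (n + 1))) B 1 = F := by
        rw [extendSeq_cons, extendSeq_zero]
      have h2 : (fun i => extendSeq A (Fin.cons F f : Fin (m + 1) → Finset (Fin (n + 1))) B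
          (i + 1)) = extendSeq F f B := funext fun i => extendSeq_cons A F f B i
      rw [h1, h2, extendSeq_zero]
      refine sum_congr rfl fun x _ => ?_
      simp only [Fin.cons_zero, Fin.cons_succ]
      ring

end expansion

theorem coeff_transversalSum {S : Type*} [CommRing S] {r : ℕ} {M : Matroid (Fin (n + 1))}
    (F : FlatChain M r) (k : ℕ) :
    (transversalSum (X : S[X]) r (flagTerm F) (n + 1)).coeff k = (slidingCount F k : S) := by
  classical
  unfold transversalSum slidingCount
  rw [finsetSum_coeff]
  simp only [coeff_X_pow]
  rw [sum_boole, filter_filter]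
  congr 2
  refine filter_congr fun x _ => ?_
  have h1 : ∀ (T : Finset (Fin (n + 1))) (z : Fin (n + 1)), below T z = {y ∈ T | y < z} := by
    intro T z
    ext a
    simp [mem_below]
  simp only [IsTransversal, flagBlock, h1]
  have := (x 0).isLt
  constructor
  · rintro ⟨⟨h1, h2, h3⟩, rfl⟩
    exact ⟨h1, rfl, h2⟩
  · rintro ⟨h1, rfl, h2⟩
    exact ⟨⟨h1, h2, this⟩, rfl⟩

/-! ### The sliding class -/

open scoped Classical in
/-- The variable of the Chow ring of the permutohedral variety that belongs to a set `F`, extended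
by `1` to the empty and the full set. -/
def permVar (n : ℕ) (F : Finset (Fin (n + 1))) : ChowRing (boolMatroid n) :=
  if h : F.Nonempty ∧ F ≠ univ then chowX (boolMatroid n) ⟨F, boolMatroid_isFlat _, h⟩ else 1

@[simp] theorem permVar_coe (F : ProperFlat (boolMatroid n)) :
    permVar n F.1 = chowX (boolMatroid n) F := by
  rw [permVar, dif_pos F.2.2]

@[simp] theorem permVar_empty : permVar n ∅ = 1 := by simp [permVar]

@[simp] theorem permVar_univ : permVar n univ = 1 := by simp [permVar]

theorem isChowFamily_permVar :
    IsChowFamily fun F => (C (permVar n F) : (ChowRing (boolMatroid n))[X]) where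
  mul_eq_zero F G h1 h2 := by
    have hF : F.Nonempty ∧ F ≠ univ := by
      rw [nonempty_iff_ne_empty]
      constructor
      · rintro rfl
        exact h1 (empty_subset _)
      · rintro rfl
        exact h2 (subset_univ _)
    have hG : G.Nonempty ∧ G ≠ univ := by
      rw [nonempty_iff_ne_empty]
      constructor
      · rintro rfl
        exact h2 (empty_subset _)
      · rintro rfl
        exact h1 (subset_univ _)
    rw [← C_mul, permVar, permVar, dif_pos hF, dif_pos hG, chowX_mul_eq_zero h1 h2, C_0]
  sum_eq p q := by
    have key : ∀ p q : Fin (n + 1), ∑ F with p ∈ F ∧ q ∉ F, permVar n F =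
        ∑ F : ProperFlat (boolMatroid n) with p ∈ F.1 ∧ q ∉ F.1, chowX (boolMatroid n) F := by
      intro p q
      symm
      refine sum_bij (fun F _ => F.1) ?_ (fun F _ G _ h => Subtype.ext h) ?_ ?_
      · intro F hF
        simpa using hF
      · intro F hF
        rw [mem_filter] at hF
        refine ⟨⟨F, boolMatroid_isFlat _, ⟨p, hF.2.1⟩, ?_⟩, by simpa using hF.2, rfl⟩
        rintro rfl
        exact hF.2.2 (mem_univ q)
      · intro F _
        rw [permVar_coe]
    rw [← map_sum, ← map_sum, key, key, sum_cut_chowX_eq]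

/-- The sliding class: the sum of the monomials of the chains of `r` sets, each with the number of
decreasing transversals of sliding statistic `k` as coefficient. It is defined as a coefficient of
the generating function; the bound `n + 1` is no restriction. -/
def slidingClass (n r k : ℕ) : ChowRing (boolMatroid n) :=
  (slideSum (fun F => (C (permVar n F) : (ChowRing (boolMatroid n))[X])) X r ∅ univ
    (n + 1)).coeff k

/-- The generating function `slideSum` collects the sliding counts of the chains. -/
theorem slidingClass_eq_sum (n r k : ℕ) :
    slidingClass n r k = ∑ F : FlatChain (boolMatroid n) r, slidingCount F k • chainClass F := by
  classical
  rw [slidingClass, slideSum_eq_sum_chains, finsetSum_coeff]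
  symm
  refine sum_bij (fun F _ => fun i => (F.1 i).1) ?_ ?_ ?_ ?_
  · intro F _
    rw [mem_filter]
    refine ⟨mem_univ _, fun i j hij => F.2 hij, fun i => mem_Ioo.2 ⟨?_, ?_⟩⟩
    · exact (F.1 i).2.2.1.empty_ssubset
    · exact lt_of_le_of_ne (subset_univ _) (F.1 i).2.2.2
  · intro F _ G _ h
    exact Subtype.ext (funext fun i => Subtype.ext (congrFun h i))
  · intro f hf
    rw [mem_filter] at hf
    have h1 := fun i => mem_Ioo.1 (hf.2.2 i)
    exact ⟨⟨fun i => ⟨f i, boolMatroid_isFlat _,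
      nonempty_iff_ne_empty.2 (h1 i).1.ne', (h1 i).2.ne⟩, fun i j hij => hf.2.1 hij⟩,
      mem_univ _, rfl⟩
  · intro F _
    have h1 : extendSeq ∅ (fun i => (F.1 i).1) univ = flagTerm F := rfl
    rw [h1, ← map_prod, coeff_mul_C, coeff_transversalSum, nsmul_eq_mul]
    simp only [permVar_coe]
    rfl

theorem slidingClass_mem (n r k : ℕ) :
    slidingClass n r k ∈ chowGraded (boolMatroid n) r := by
  rw [slidingClass_eq_sum, chowGraded_eq_flagSpan]
  refine Submodule.sum_mem _ fun F _ => Submodule.smul_of_tower_mem _ _ ?_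
  have h := prod_mem_flagSpan (σ := univ.image F.1)
  rwa [card_image_flatChain, ← chainClass_eq_prod] at h

/-! ### The weight of the sliding class -/

theorem flagTerm_ssubset {M : Matroid (Fin (n + 1))} {c : ℕ} (F : FlatChain M c) {i : ℕ}
    (hi : i ≤ c) : flagTerm F i ⊂ flagTerm F (i + 1) := by
  cases i with
  | zero =>
    rw [flagTerm_zero]
    refine Nonempty.empty_ssubset ?_
    rcases Nat.eq_zero_or_pos c with rfl | hc
    · rw [flagTerm_last]
      exact univ_nonempty
    · rw [flagTerm_succ F hc]
      exact (F.1 ⟨0, hc⟩).2.2.1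
  | succ i =>
    rw [flagTerm_succ F (show i < c by omega)]
    rcases Nat.lt_or_ge (i + 1) c with h | h
    · rw [flagTerm_succ F h]
      exact F.2 (show (⟨i, by omega⟩ : Fin c) < ⟨i + 1, h⟩ from Nat.lt_succ_self i)
    · obtain rfl : c = i + 1 := by omega
      rw [flagTerm_last]
      exact lt_of_le_of_ne (subset_univ _) (F.1 _).2.2.2

theorem card_flagTerm_add_le {M : Matroid (Fin (n + 1))} {c : ℕ} (F : FlatChain M c) {i j : ℕ}
    (hij : i ≤ j) (hj : j ≤ c + 1) : #(flagTerm F i) + (j - i) ≤ #(flagTerm F j) := by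
  induction j, hij using Nat.le_induction with
  | base => simp
  | succ j hij ih =>
    have := card_lt_card (flagTerm_ssubset F (show j ≤ c by omega))
    have := ih (by omega)
    omega

theorem prod_permVar_flagTerm {c : ℕ} (G : FlatChain (boolMatroid n) c) :
    ∏ i ∈ range (c + 2), permVar n (flagTerm G i) = chainClass G := by
  rw [prod_range_succ, flagTerm_last, permVar_univ, mul_one, prod_range_succ', flagTerm_zero,
    permVar_empty, mul_one, prod_range]
  refine prod_congr rfl fun i _ => ?_
  rw [flagTerm_succ G i.2, permVar_coe]

/-- A maximal chain in one gap of a chain completes it to a maximal chain, of degree one. -/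
theorem chowDeg_chainClass_mul_prod {c r i : ℕ} (hc : c + r = n)
    (G : FlatChain (boolMatroid n) c) {τ : Finset (Finset (Fin (n + 1)))}
    (hτ : IsChain (· ≤ ·) (τ : Set (Finset (Fin (n + 1))))) (hcard : #τ = r)
    (hmem : ∀ F ∈ τ, F ∈ Ioo (flagTerm G i) (flagTerm G (i + 1))) :
    chowDeg (boolMatroid n) n (chainClass G * ∏ F ∈ τ, permVar n F) = 1 := by
  classical
  have hprop : ∀ F ∈ τ, F.Nonempty ∧ F ≠ univ := by
    intro F hF
    have h := mem_Ioo.1 (hmem F hF)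
    refine ⟨nonempty_iff_ne_empty.2 ?_, ?_⟩
    · rintro rfl
      exact h.1.2 (empty_subset _)
    · rintro rfl
      exact h.2.2 (subset_univ _)
  set τ' : Finset (ProperFlat (boolMatroid n)) := {H | H.1 ∈ τ} with hτ'
  have himage : τ'.image (fun H => H.1) = τ := by
    ext F
    simp only [hτ', mem_image, mem_filter, mem_univ, true_and]
    constructor
    · rintro ⟨H, hH, rfl⟩
      exact hH
    · exact fun hF => ⟨⟨F, boolMatroid_isFlat _, hprop F hF⟩, hF, rfl⟩
  have hinj : Set.InjOn (fun H : ProperFlat (boolMatroid n) => H.1)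
      (τ' : Set (ProperFlat (boolMatroid n))) := fun _ _ _ _ h => Subtype.ext h
  have hcard' : #τ' = r := by rw [← hcard, ← himage, card_image_of_injOn hinj]
  have hprod : ∏ F ∈ τ, permVar n F = ∏ H ∈ τ', chowX (boolMatroid n) H := by
    rw [← himage, prod_image hinj]
    exact prod_congr rfl fun H _ => permVar_coe H
  -- members of `τ` are compared with members of the chain
  have hlow : ∀ j : Fin c, j.val + 1 ≤ i → ∀ H ∈ τ', (G.1 j).1 ⊂ H.1 := by
    intro j hj H hH
    rw [← flagTerm_succ G j.2]
    exact lt_of_le_of_lt (flagTerm_mono G hj) (mem_Ioo.1 (hmem _ (mem_filter.1 hH).2)).1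
  have hhigh : ∀ j : Fin c, i ≤ j.val → ∀ H ∈ τ', H.1 ⊂ (G.1 j).1 := by
    intro j hj H hH
    rw [← flagTerm_succ G j.2]
    exact lt_of_lt_of_le (mem_Ioo.1 (hmem _ (mem_filter.1 hH).2)).2
      (flagTerm_mono G (Nat.succ_le_succ hj))
  have hdisj : Disjoint (univ.image G.1) τ' := by
    rw [disjoint_left]
    intro H hH hH'
    obtain ⟨j, _, rfl⟩ := mem_image.1 hH
    rcases Nat.lt_or_ge j.val i with h | h
    · exact lt_irrefl _ (hlow j h _ hH')
    · exact lt_irrefl _ (hhigh j h _ hH')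
  have hflag : IsFlag (univ.image G.1 ∪ τ') := by
    have hmix : ∀ H ∈ univ.image G.1, ∀ K ∈ τ', H ≤ K ∨ K ≤ H := by
      intro H hH K hK
      obtain ⟨j, _, rfl⟩ := mem_image.1 hH
      rcases Nat.lt_or_ge j.val i with h | h
      · exact Or.inl (hlow j h _ hK).le
      · exact Or.inr (hhigh j h _ hK).le
    intro H hH K hK hne
    rcases mem_union.1 (mem_coe.1 hH) with hH | hH <;>
      rcases mem_union.1 (mem_coe.1 hK) with hK | hK
    · exact isFlag_image G hH hK hne
    · exact hmix H hH K hK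
    · exact (hmix K hK H hH).symm
    · exact hτ (mem_filter.1 hH).2 (mem_filter.1 hK).2 fun h => hne (Subtype.ext h)
  rw [hprod, chainClass_eq_prod, ← prod_union hdisj]
  refine (isDegreeMap_boolMatroid n).apply_prod hflag ?_
  rw [card_union_of_disjoint hdisj, card_image_flatChain, hcard', hc]

/-- The contribution of a gap of a chain to the weight of the sliding class. A chain of `n - r` sets
has no gap with more than `r + 1` elements, a gap with fewer elements contains no transversal, and a
gap with `r + 1` elements contains a maximal chain. -/
theorem exists_C_mul_slideSum_gap {c r i : ℕ} (hc : c + r = n)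
    (G : FlatChain (boolMatroid n) c) (hi : i ≤ c) :
    ∃ b : ChowRing (boolMatroid n), C (chainClass G) *
        slideSum (fun F => (C (permVar n F) : (ChowRing (boolMatroid n))[X])) X r (flagTerm G i)
          (flagTerm G (i + 1)) (n + 1) = C b ∧
      chowDeg (boolMatroid n) n b =
        if #(flagTerm G (i + 1)) = #(flagTerm G i) + r + 1 then 1 else 0 := by
  have hsub := (flagTerm_ssubset G hi).subset
  have hsd := card_sdiff_add_card_eq_card hsub
  have h1 := card_flagTerm_add_le G (Nat.zero_le i) (by omega)
  have h2 := card_flagTerm_add_le G (show i + 1 ≤ c + 1 by omega) le_rfl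
  rw [flagTerm_last, card_univ, Fintype.card_fin] at h2
  split_ifs with h
  · obtain ⟨τ, hτ, hcard, hmem, hprod⟩ := exists_slideSum_eq_prod
      (fun F => (C (permVar n F) : (ChowRing (boolMatroid n))[X])) X r (t := n + 1) hsub (by omega)
      fun z _ => z.isLt
    refine ⟨chainClass G * ∏ F ∈ τ, permVar n F, ?_,
      chowDeg_chainClass_mul_prod hc G hτ hcard hmem⟩
    rw [hprod, C_mul, map_prod]
  · refine ⟨0, ?_, map_zero _⟩
    rw [slideSum_eq_zero, mul_zero, C_0]
    rw [below_eq_self]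
    omega

theorem chowDeg_slidingClass_mul {c r : ℕ} (hc : c + r = n) (k : ℕ)
    (G : FlatChain (boolMatroid n) c) :
    chowDeg (boolMatroid n) n (slidingClass n r k * chainClass G) =
      ∑ i ∈ range (c + 1),
        if #(flagTerm G i) = k ∧ #(flagTerm G (i + 1)) = k + r + 1 then 1 else 0 := by
  have h1 := prod_mul_slideSum X isChowFamily_permVar r c (flagTerm G) (flagTerm_zero G)
    (fun i hi => flagTerm_ssubset G hi) (flagTerm_last G)
  rw [← map_prod, prod_permVar_flagTerm] at h1
  rw [slidingClass, ← coeff_mul_C, (mul_comm _ _).trans h1, mul_sum, finsetSum_coeff, map_sum]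
  refine sum_congr rfl fun i hi => ?_
  obtain ⟨b, hb, hdeg⟩ := exists_C_mul_slideSum_gap hc G (Nat.lt_succ_iff.1 (mem_range.1 hi))
  rw [(mul_left_comm _ _ _).trans (congrArg _ hb), coeff_mul_C, coeff_X_pow]
  by_cases hk : k = #(flagTerm G i)
  · rw [if_pos hk, one_mul, hdeg, hk]
    simp
  · rw [if_neg hk, zero_mul, map_zero, if_neg fun h => hk h.1.symm]

/-- The sizes of a chain avoid exactly the window `[k + 1, k + r]` if and only if the chain has a
gap from size `k` to size `k + r + 1`. -/
theorem image_card_eq_iff {c r k : ℕ} (hc : c + r = n) (hk : k ≤ c)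
    (G : FlatChain (boolMatroid n) c) :
    univ.image (fun i => #(G.1 i).1) = Icc 1 n \ Icc (k + 1) (k + r) ↔
      ∃ i ≤ c, #(flagTerm G i) = k ∧ #(flagTerm G (i + 1)) = k + r + 1 := by
  have hlt : ∀ {i j}, i < j → j ≤ c + 1 → #(flagTerm G i) < #(flagTerm G j) := by
    intro i j hij hj
    have := card_flagTerm_add_le G hij.le hj
    omega
  have hlast : #(flagTerm G (c + 1)) = n + 1 := by simp [flagTerm_last]
  have hG : ∀ i : Fin c, #(G.1 i).1 = #(flagTerm G (i + 1)) := by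
    intro i
    rw [flagTerm_succ G i.2]
  constructor
  · intro h
    have hmem : ∀ m, m ∈ Icc 1 n \ Icc (k + 1) (k + r) → ∃ i < c, #(flagTerm G (i + 1)) = m := by
      intro m hm
      rw [← h, mem_image] at hm
      obtain ⟨i, _, hi⟩ := hm
      exact ⟨i, i.2, by rw [← hi, hG]⟩
    have hnot : ∀ i < c, #(flagTerm G (i + 1)) ∈ Icc 1 n \ Icc (k + 1) (k + r) := by
      intro i hi
      rw [← h, mem_image]
      exact ⟨⟨i, hi⟩, mem_univ _, hG _⟩
    obtain ⟨i, hi, hik⟩ : ∃ i ≤ c, #(flagTerm G i) = k := by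
      rcases Nat.eq_zero_or_pos k with rfl | hk0
      · exact ⟨0, Nat.zero_le _, by simp⟩
      · obtain ⟨i, hi, h⟩ := hmem k (by simp; omega)
        exact ⟨i + 1, hi, h⟩
    obtain ⟨j, hj, hjk⟩ : ∃ j ≤ c + 1, #(flagTerm G j) = k + r + 1 := by
      rcases Nat.lt_or_ge k c with hkc | hkc
      · obtain ⟨j, hj, h⟩ := hmem (k + r + 1) (by simp; omega)
        exact ⟨j + 1, by omega, h⟩
      · exact ⟨c + 1, le_rfl, by omega⟩
    have hij : i < j := by
      by_contra hij
      rcases Nat.eq_or_lt_of_le (not_lt.1 hij) with rfl | hij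
      · omega
      · have := hlt hij (by omega)
        omega
    -- the term after `i` cannot lie in the window
    have hij' : j = i + 1 := by
      by_contra hne
      have h1 := hlt (show i < i + 1 by omega) (by omega)
      have h2 := hlt (show i + 1 < j by omega) hj
      have h3 := hnot i (by omega)
      rw [mem_sdiff, mem_Icc, mem_Icc] at h3
      omega
    exact ⟨i, hi, hik, hij' ▸ hjk⟩
  · rintro ⟨i, hi, h1, h2⟩
    refine eq_of_subset_of_card_le ?_ ?_
    · intro m hm
      obtain ⟨j, _, rfl⟩ := mem_image.1 hm
      rw [hG, mem_sdiff, mem_Icc, mem_Icc]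
      have h3 := hlt (show 0 < j.val + 1 by omega) (by omega)
      have h4 := hlt (show j.val + 1 < c + 1 by omega) le_rfl
      have h5 : #(flagTerm G (j + 1)) ≤ #(flagTerm G i) ∨
          #(flagTerm G (i + 1)) ≤ #(flagTerm G (j + 1)) := by
        rcases Nat.lt_or_ge j.val i with h | h
        · exact Or.inl (card_le_card (flagTerm_mono G h))
        · exact Or.inr (card_le_card (flagTerm_mono G (Nat.succ_le_succ h)))
      omega
    · rw [card_image_of_injective, card_univ, Fintype.card_fin, card_sdiff_of_subset, Nat.card_Icc,
        Nat.card_Icc]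
      · omega
      · exact Icc_subset_Icc (by omega) (by omega)
      · intro a b hab
        simp only [hG] at hab
        by_contra hne
        rcases Nat.lt_or_gt_of_ne fun h => hne (Fin.ext h) with h | h
        · have := hlt (Nat.add_lt_add_right h 1) (by omega)
          omega
        · have := hlt (Nat.add_lt_add_right h 1) (by omega)
          omega

/-- The sliding class is the class of the one-window weight. -/
theorem hasWeight_slidingClass {r k : ℕ} (hr : r ≤ n) (hk : k ≤ n - r) :
    HasWeight (r := r) (slidingClass n r k) (oneWindowWeight n r k) := by
  refine ⟨slidingClass_mem n r k, fun G => ?_⟩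
  have hc : n - r + r = n := by omega
  rw [chowDeg_slidingClass_mul hc, oneWindowWeight, coSymWeight, symWeight]
  split_ifs with h
  · obtain ⟨i, hi, hi'⟩ := (image_card_eq_iff hc hk G).1 h
    rw [sum_eq_single_of_mem i (mem_range.2 (by omega)), if_pos hi']
    intro j hj hji
    rw [mem_range] at hj
    refine if_neg fun hj' => ?_
    rcases Nat.lt_or_gt_of_ne hji with h | h
    · have := card_flagTerm_add_le G h.le (by omega)
      omega
    · have := card_flagTerm_add_le G h.le (by omega)
      omega
  · refine sum_eq_zero fun i hi => if_neg fun hi' => ?_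
    exact h ((image_card_eq_iff hc hk G).2 ⟨i, Nat.lt_succ_iff.1 (mem_range.1 hi), hi'⟩)

theorem HasWeight.unique {r : ℕ} {a b : ChowRing (boolMatroid n)}
    {w : FlatChain (boolMatroid n) (n - r) → ℤ} (ha : HasWeight (r := r) a w)
    (hb : HasWeight (r := r) b w) : a = b := by
  rw [← sub_eq_zero]
  refine eq_zero_of_forall_chowDeg_eq_zero (Submodule.sub_mem _ ha.1 hb.1) fun G => ?_
  rw [sub_mul, map_sub, ha.2, hb.2, sub_self]

/-! ### Restriction to a matroid -/

theorem chowRestrict_chowX (M : Matroid (Fin (n + 1))) (F : ProperFlat (boolMatroid n)) :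
    chowRestrict M (chowX (boolMatroid n) F) = restrictX M F := by
  unfold chowRestrict chowX
  rw [Ideal.Quotient.lift_mk]
  exact MvPolynomial.aeval_X _ _

theorem slidingCount_eq_of_coe_eq {M N : Matroid (Fin (n + 1))} {c : ℕ} {F : FlatChain M c}
    {G : FlatChain N c} (h : ∀ i, (F.1 i).1 = (G.1 i).1) (k : ℕ) :
    slidingCount F k = slidingCount G k := by
  have h1 : flagTerm F = flagTerm G := by
    funext i
    unfold flagTerm
    simp only [h]
  unfold slidingCount flagBlock
  rw [h1]

/-- Chains with a member that is not a flat of `M` restrict to zero. -/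
theorem chowRestrict_slidingClass (M : Matroid (Fin (n + 1))) (r k : ℕ) :
    chowRestrict M (slidingClass n r k) =
      ∑ F : FlatChain M r, slidingCount F k • chainClass F := by
  classical
  rw [slidingClass_eq_sum, map_sum]
  symm
  refine sum_of_injOn (fun F => ⟨fun i => ⟨(F.1 i).1, boolMatroid_isFlat _, (F.1 i).2.2⟩,
    fun i j hij => F.2 hij⟩) ?_ ?_ ?_ ?_
  · intro F _ G _ h
    refine Subtype.ext (funext fun i => Subtype.ext ?_)
    exact congrArg (fun K : FlatChain (boolMatroid n) r => (K.1 i).1) h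
  · exact fun F _ => mem_coe.2 (mem_univ _)
  · intro F _ hF
    have h1 : ∃ i, ¬ M.IsFlat ((F.1 i).1 : Set (Fin (n + 1))) := by
      by_contra! h
      exact hF ⟨⟨fun i => ⟨(F.1 i).1, h i, (F.1 i).2.2⟩, fun i j hij => F.2 hij⟩,
        mem_coe.2 (mem_univ _), rfl⟩
    obtain ⟨i, hi⟩ := h1
    rw [map_nsmul, chainClass, map_prod, prod_eq_zero (mem_univ i), smul_zero]
    rw [chowRestrict_chowX, restrictX, dif_neg hi]
  · intro F _
    rw [map_nsmul, chainClass, chainClass, map_prod]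
    refine congrArg₂ _ (slidingCount_eq_of_coe_eq (fun i => rfl) k) ?_
    refine prod_congr rfl fun i _ => ?_
    rw [chowRestrict_chowX, restrictX, dif_pos (F.1 i).2.1]

theorem chowDeg_chowRestrict_slidingClass {M : Matroid (Fin (n + 1))} (hE : M.E = Set.univ)
    (hL : M.Loopless) {r : ℕ} (hr : M.eRank = ((r + 1 : ℕ) : ℕ∞)) (k : ℕ) :
    chowDeg M r (chowRestrict M (slidingClass n r k)) =
      ∑ F : FlatChain M r, (slidingCount F k : ℤ) := by
  rw [chowRestrict_slidingClass, map_sum]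
  refine sum_congr rfl fun F _ => ?_
  rw [map_nsmul, (isDegreeMap_chowDeg hE hL hr).2 F, nsmul_eq_mul, mul_one]

theorem le_of_eRank_eq {M : Matroid (Fin (n + 1))} {r : ℕ}
    (hr : M.eRank = ((r + 1 : ℕ) : ℕ∞)) : r ≤ n := by
  have h1 : M.eRank ≤ ((n + 1 : ℕ) : ℕ∞) := by
    refine (M.eRank_le_encard_ground).trans ((Set.encard_le_encard (Set.subset_univ _)).trans ?_)
    rw [Set.encard_univ]
    simp
  rw [hr] at h1
  have := Nat.cast_le.1 h1
  omega

end

end MatroidChow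

theorem mainTheorem3 (n r : ℕ) (M : Matroid (Fin (n + 1))) (hE : M.E = Set.univ)
    (hL : M.Loopless) (hr : M.eRank = ((r + 1 : ℕ) : ℕ∞)) :
    -- the degree maps are well defined
    (∃! d, MatroidChow.IsDegreeMap M r d) ∧
    (∃! d, MatroidChow.IsDegreeMap (MatroidChow.boolMatroid n) n d) ∧
    -- the one-window weights come from Chow classes
    (∀ k ≤ n - r, ∃ a : MatroidChow.ChowRing (MatroidChow.boolMatroid n),
      MatroidChow.HasWeight (r := r) a (MatroidChow.oneWindowWeight n r k)) ∧
    ∀ Φ : ℕ → MatroidChow.ChowRing (MatroidChow.boolMatroid n),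
      (∀ k ≤ n - r, MatroidChow.HasWeight (r := r) (Φ k) (MatroidChow.oneWindowWeight n r k)) →
      MatroidChow.tutteOne M =
          ∑ k ∈ Finset.range (n - r + 1), Polynomial.monomial k
            (MatroidChow.chowDeg M r (MatroidChow.chowRestrict M (Φ k))) ∧
        ∀ k ≤ n - r,
          MatroidChow.chowDeg M r (MatroidChow.chowRestrict M (Φ k)) =
              ∑ F : MatroidChow.FlatChain M r, (MatroidChow.slidingCount F k : ℤ) ∧
          ∑ F : MatroidChow.FlatChain M r, MatroidChow.slidingCount F k =
              MatroidChow.activityCount M k := by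
  have hrn := MatroidChow.le_of_eRank_eq hr
  refine ⟨MatroidChow.existsUnique_isDegreeMap hE hL hr,
    ⟨_, MatroidChow.isDegreeMap_boolMatroid n,
      fun _ hd => hd.unique (MatroidChow.isDegreeMap_boolMatroid n)⟩,
    fun k hk => ⟨_, MatroidChow.hasWeight_slidingClass hrn hk⟩, fun Φ hΦ => ?_⟩
  have hdeg : ∀ k ≤ n - r, MatroidChow.chowDeg M r (MatroidChow.chowRestrict M (Φ k)) =
      ∑ F : MatroidChow.FlatChain M r, (MatroidChow.slidingCount F k : ℤ) := by
    intro k hk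
    rw [(hΦ k hk).unique (MatroidChow.hasWeight_slidingClass hrn hk)]
    exact MatroidChow.chowDeg_chowRestrict_slidingClass hE hL hr k
  have hact := MatroidChow.sum_slidingCount_eq_activityCount hE hL hr
  refine ⟨?_, fun k hk => ⟨hdeg k hk, hact k⟩⟩
  rw [MatroidChow.tutteOne_eq_sum_activityCount hE hr]
  refine Finset.sum_congr rfl fun k hk => ?_
  rw [hdeg k (Nat.lt_succ_iff.1 (Finset.mem_range.1 hk)), ← hact k, Nat.cast_sum]
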